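/- **Setting.** Let $\hat V:\mathbb Z^3\to[0,\infty)$ with $\|\hat V\|_1=\sum_k\hat V(k)<\infty$, let $0<\delta<1/6$, $0<\theta<1/2$, $C_0\in\mathbb R$, and fix a branch of the complex logarithm with imaginary part in $(t-2\pi,t]$, $0<t<2\pi$ (so that $\log 1=0$). For $k_F>0$ put $B_F=\{p\in\mathbb Z^3:|p|\le k_F\}$, $N=|B_F|$, $\hbar=N^{-1/3}$, $\kappa=k_FN^{-1/3}$. On the fermionic Fock space $\mathcal F$ over $L^2(\mathbb T^3)$ let $a_p^*,a_p$ ($p\in\mathbb Z^3$) be the creation and annihilation operators of plane waves, and $$\mathcal N=\sum_p a_p^*a_p,\qquad \mathcal N_\delta=\sum_{p:\,||p|-k_F|>\theta N^{-\delta}}a_p^*a_p .$$ *Patches.* Let $R>0$, let $M$ be even, and let $p_1,\dots,p_M$ be measurable subsets of the unit sphere with marked points (centers) $\hat\omega_\alpha\in p_\alpha$, where $M/2$ of the pairs $(p_\alpha,\hat\omega_\alpha)$ lie in a closed half sphere and the other $M/2$ are their reflections at the origin, such that $\operatorname{diam}p_\alpha\le C_0M^{-1/2}$, $|\operatorname{area}(p_\alpha)-4\pi/M|\le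 C_0(1+R)N^{-1/3}M^{-1/2}$, and the patches $B_\alpha=\{p\in\mathbb R^3:k_F-R\le|p|\le k_F+R,\ p/|p|\in p_\alpha\}$ have pairwise distances larger than $R$: $|p-q|>R$ for $p\in B_\alpha$, $q\in B_\beta$, $\alpha\ne\beta$. *Pair operators.* Let $\Gamma^{\rm nor}$ be the set of $k\in\mathbb Z^3$ with $|k|<R$ and either $k_3>0$, or $k_3=0<k_2$, or $k_3=k_2=0<k_1$. Let $\mathcal I_k^\pm=\{\alpha:\pm k\cdot\hat\omega_\alpha\ge N^{-\delta}\}$, $\mathcal I_k=\mathcal I_k^+\cup\mathcal I_k^-$. For $\alpha\in\mathcal I_k^+$ let $n_\alpha(k)^2$ be the number of $p\in B_F^c\cap B_\alpha$ with $p-k\in B_F\cap B_\alpha$, and $b_\alpha^*(k)=n_\alpha(k)^{-1}\sum_pa_p^*a_{p-k}^*$, the sum running over these $p$ (and $b_\alpha^*(k)=0$ if there are none). For $k\in\Gamma^{\rm nor}$ let $c_\alpha^*(k)=b_\alpha^*(k)$ if $\alpha\in\mathcal I_k^+$; if $\alpha\in\mathcal I_k^-$, let $c_\alpha^*(k)=b_\alpha^*(-k)$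 and $n_\alpha(k):=n_\alpha(-k)$. *Kernels.* For $k\in\Gamma^{\rm nor}$ let $D,W,\widetilde W$ be the real symmetric matrices indexed by $\mathcal I_k$ with $D_{\alpha\beta}=\delta_{\alpha\beta}|\hat k\cdot\hat\omega_\alpha|$, where $\hat k=k/|k|$; $W_{\alpha\beta}=\frac{\hat V(k)}{2\hbar\kappa N|k|}n_\alpha(k)n_\beta(k)$ if $\alpha,\beta$ both lie in $\mathcal I_k^+$ or both in $\mathcal I_k^-$, and $0$ otherwise; $\widetilde W_{\alpha\beta}$ is the same number if one of $\alpha,\beta$ lies in $\mathcal I_k^+$ and the other in $\mathcal I_k^-$, and $0$ otherwise. Let $E=[(D+W-\widetilde W)^{1/2}(D+W+\widetilde W)(D+W-\widetilde W)^{1/2}]^{1/2}$, $S_1=(D+W-\widetilde W)^{1/2}E^{-1/2}$, $K(k)=\log|S_1^T|$, and let $O$ be the orthogonal factor in the polar decomposition $S_1=O|S_1|$. On $\mathcal I_k^+$ let $d=\operatorname{diag}(|\hat k\cdot\hat\omega_\alpha|)$, $v_\alpha=\hbar n_\alpha(k)/(\kappa|k|^{1/2})$, $b=\frac{\kappa\hat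 V(k)}{2}|v\rangle\langle v|$, and let $A$ be the orthogonal factor in the polar decomposition of $(d+2b)^{1/2}d^{1/2}$. Identifying $\mathcal I_k^-$ with $\mathcal I_k^+$ by reflection, let $U=\frac1{\sqrt2}\begin{pmatrix}1&1\\1&-1\end{pmatrix}$, $\widetilde O=U\begin{pmatrix}1&0\\0&A\end{pmatrix}U^T$ and $L(k)=\log(O\widetilde O)$. For $\lambda\in\mathbb R$ set $$T_\lambda=\exp\Big(\frac\lambda2\sum_{k\in\Gamma^{\rm nor}}\sum_{\alpha,\beta\in\mathcal I_k}K(k)_{\alpha\beta}c_\alpha^*(k)c_\beta^*(k)-\text{h.c.}\Big),\qquad Z_\lambda=\exp\Big(\lambda\sum_{k\in\Gamma^{\rm nor}}\sum_{\alpha,\beta\in\mathcal I_k}L(k)_{\alpha\beta}c_\alpha^*(k)c_\beta(k)\Big).$$ **Lemma (stability of number operators).** There is $A_0>0$, depending only on $\hat V,\delta,\theta,t,C_0$, and for every $m\in\mathbb N_0$ there is $C>0$, depending only on these data and $m$, such that for all $k_F>0$, $R>0$, all $M$ and all patch decompositions as above with $M\ge A_0N^{2\delta}R^2$, and all $\lambda\in[-1,1]$,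 $$T_\lambda^*\mathcal N^mT_\lambda\le C(\mathcal N+1)^m,\qquad T_\lambda^*\mathcal N_\delta\mathcal N^mT_\lambda\le C(\mathcal N_\delta+1)(\mathcal N+1)^m,$$ $$Z_\lambda^*\mathcal N^mZ_\lambda=\mathcal N^m,\qquad Z_\lambda^*\mathcal N_\delta\mathcal N^mZ_\lambda\le C\,\mathcal N_\delta\mathcal N^m .$$ The inequalities are inequalities of quadratic forms on all of $\mathcal F$ with values in $[0,\infty]$; the equality is one of unbounded operators, including their domains. -/

import Mathlib

open scoped ENNReal NNReal

namespace RPA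

noncomputable section

/-! ### Momenta and the Fermi ball -/

/-- Momenta `p ∈ ℤ³`. -/
abbrev Mom := Fin 3 → ℤ

/-- Euclidean three-space. -/
abbrev E3 := EuclideanSpace ℝ (Fin 3)

/-- The inclusion `ℤ³ ⊆ ℝ³`. -/
def toE3 (p : Mom) : E3 := WithLp.toLp 2 (fun i => (p i : ℝ))

/-- The lattice points of the cube `[-⌈r⌉, ⌈r⌉]³`, which contains the ball of radius `r`. -/
def box (r : ℝ) : Finset Mom := Finset.Icc (fun _ => -⌈r⌉) (fun _ => ⌈r⌉)

open Classical in
/-- The Fermi ball `B_F = {p ∈ ℤ³ : |p| ≤ k_F}`. -/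
def fermiBall (kF : ℝ) : Finset Mom := {p ∈ box kF | ‖toE3 p‖ ≤ kF}

theorem mem_box {r : ℝ} {p : Mom} (h : ‖toE3 p‖ ≤ r) : p ∈ box r := by
  have h1 : ∀ i, |(p i : ℝ)| ≤ r := fun i => by
    have := PiLp.norm_apply_le (toE3 p) i
    simpa [toE3] using this.trans h
  have h2 : ∀ i, (p i : ℝ) ≤ (⌈r⌉ : ℤ) ∧ -((⌈r⌉ : ℤ) : ℝ) ≤ p i := fun i => by
    have h3 := abs_le.mp (h1 i)
    have h4 := Int.le_ceil r
    constructor <;> linarith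
  refine Finset.mem_Icc.mpr ⟨fun i => ?_, fun i => ?_⟩
  · exact_mod_cast (h2 i).2
  · exact_mod_cast (h2 i).1

theorem mem_fermiBall {kF : ℝ} {p : Mom} : p ∈ fermiBall kF ↔ ‖toE3 p‖ ≤ kF := by
  unfold fermiBall
  rw [Finset.mem_filter]
  exact ⟨fun h => h.2, fun h => ⟨mem_box h, h⟩⟩

/-- The particle number `N = |B_F|`. -/
def numN (kF : ℝ) : ℕ := (fermiBall kF).card

/-- `ħ = N^{-1/3}`. -/
def hbar (kF : ℝ) : ℝ := (numN kF : ℝ) ^ (-(1 / 3) : ℝ)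

/-- `κ`, defined by `k_F = κ N^{1/3}`. -/
def kappa (kF : ℝ) : ℝ := kF / (numN kF : ℝ) ^ (1 / 3 : ℝ)

/-! ### Fermionic Fock space

The fermionic Fock space over `L²(𝕋³)` in the occupation number representation.  The plane waves
`f_p`, `p ∈ ℤ³`, form an orthonormal basis of `L²(𝕋³)`, so the Slater determinants
`e_S = f_{p₁} ∧ … ∧ f_{pₙ}`, one for each finite set `S = {p₁ < … < pₙ}` of momenta (ordered
lexicographically), form an orthonormal basis of Fock space.  A Fock space vector is the family of
its coefficients `ψ S` in this basis. -/

/-- Fermionic Fock space. -/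
abbrev Fock := lp (fun _ : Finset Mom => ℂ) 2

open Classical in
/-- The sign `(-1)^{|{q ∈ S : q < p}|}`. -/
def jwSign (p : Mom) (S : Finset Mom) : ℂ :=
  (-1) ^ (S.filter (fun q => toLex q < toLex p)).card

/-- The coefficients of `a_p ψ`: one has `a_p e_{S ∪ {p}} = ± e_S` if `p ∉ S`, and `a_p e_S = 0`
otherwise. -/
def annCoeff (p : Mom) (ψ : Finset Mom → ℂ) (S : Finset Mom) : ℂ :=
  if p ∈ S then 0 else jwSign p S * ψ (insert p S)

theorem norm_jwSign (p : Mom) (S : Finset Mom) : ‖jwSign p S‖ = 1 := by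
  simp [jwSign]

theorem sum_annCoeff_le (p : Mom) (ψ : Fock) (s : Finset (Finset Mom)) :
    ∑ S ∈ s, ‖annCoeff p ψ S‖ ^ (2 : ℝ≥0∞).toReal ≤ ‖ψ‖ ^ (2 : ℝ≥0∞).toReal := by
  classical
  have h2 : 0 < (2 : ℝ≥0∞).toReal := by norm_num
  have h1 : ∑ S ∈ s, ‖annCoeff p ψ S‖ ^ (2 : ℝ≥0∞).toReal
      = ∑ S ∈ s.filter (fun S => p ∉ S), ‖ψ (insert p S)‖ ^ (2 : ℝ≥0∞).toReal := by
    rw [Finset.sum_filter]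
    refine Finset.sum_congr rfl fun S _ => ?_
    by_cases h : p ∈ S
    · simp [annCoeff, h]
    · simp [annCoeff, h, norm_jwSign]
  have h3 : Set.InjOn (fun S : Finset Mom => insert p S)
      ((s.filter (fun S => p ∉ S) : Finset (Finset Mom)) : Set (Finset Mom)) := by
    intro S hS T hT h
    have hS' : p ∉ S := (Finset.mem_filter.mp hS).2
    have hT' : p ∉ T := (Finset.mem_filter.mp hT).2
    rw [← Finset.erase_insert hS', ← Finset.erase_insert hT']
    exact congrArg (fun U => Finset.erase U p) h
  rw [h1, ← Finset.sum_image (f := fun S => ‖ψ S‖ ^ (2 : ℝ≥0∞).toReal) h3]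
  exact lp.sum_rpow_le_norm_rpow h2 ψ _

theorem memℓp_annCoeff (p : Mom) (ψ : Fock) : Memℓp (annCoeff p ψ) 2 :=
  memℓp_gen' (sum_annCoeff_le p ψ)

/-- The annihilation operator `a_p`. -/
def ann (p : Mom) : Fock →L[ℂ] Fock :=
  LinearMap.mkContinuous
    { toFun := fun ψ => ⟨annCoeff p ψ, memℓp_annCoeff p ψ⟩
      map_add' := fun ψ φ => by
        ext S
        change annCoeff p (ψ + φ) S = annCoeff p ψ S + annCoeff p φ S
        by_cases h : p ∈ S <;> simp [annCoeff, h, mul_add]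
      map_smul' := fun c ψ => by
        ext S
        change annCoeff p (c • ψ) S = c * annCoeff p ψ S
        by_cases h : p ∈ S <;> simp [annCoeff, h, mul_left_comm] }
    1 (fun ψ => by
      rw [one_mul]
      exact lp.norm_le_of_forall_sum_le (by norm_num) (norm_nonneg _) (sum_annCoeff_le p ψ))

/-- The creation operator `a_p^*`. -/
def cre (p : Mom) : Fock →L[ℂ] Fock := ContinuousLinearMap.adjoint (ann p)

/-! ### Number operators

The operator `a_p^* a_p` is diagonal, `a_p^* a_p e_S = 1_{p ∈ S} e_S` (`cre_ann_apply`), hence so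
are the number operators: `∑_{p ∈ G} a_p^* a_p` multiplies the coefficient `ψ S` by `|S ∩ G|`, and
products of number operators act by multiplication with the products of the multipliers. -/

theorem cre_ann_apply (p : Mom) (ψ : Fock) (S : Finset Mom) :
    cre p (ann p ψ) S = if p ∈ S then ψ S else 0 := by
  classical
  have h1 : ∀ φ : Fock, φ S = inner ℂ (lp.single 2 S (1 : ℂ) : Fock) φ := fun φ => by
    rw [lp.inner_single_left]
    simp
  have h2 : ann p (lp.single 2 S (1 : ℂ) : Fock)
      = if p ∈ S then (lp.single 2 (S.erase p) (jwSign p (S.erase p)) : Fock) else 0 := by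
    ext U
    have h3 : ann p (lp.single 2 S (1 : ℂ) : Fock) U
        = if p ∈ U then 0 else jwSign p U * (Pi.single S (1 : ℂ) : Finset Mom → ℂ) (insert p U) :=
      rfl
    rw [h3]
    by_cases hS : p ∈ S
    · by_cases hU : p ∈ U
      · have hne : U ≠ S.erase p := fun h => by simp [h] at hU
        simp [hS, hU, lp.single_apply, hne]
      · by_cases hUS : U = S.erase p
        · subst hUS
          simp [hS, lp.single_apply]
        · have hne : insert p U ≠ S := fun h => hUS (by rw [← h, Finset.erase_insert hU])
          simp [hS, hU, lp.single_apply, hUS, hne]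
    · have hne : insert p U ≠ S := fun h => hS (by rw [← h]; exact Finset.mem_insert_self p U)
      simp [hS, hne]
  have h4 : ∀ V : Finset Mom, ann p ψ V = if p ∈ V then 0 else jwSign p V * ψ (insert p V) :=
    fun _ => rfl
  rw [h1 (cre p (ann p ψ)), cre, ContinuousLinearMap.adjoint_inner_right, h2]
  by_cases hS : p ∈ S
  · rw [if_pos hS, if_pos hS, lp.inner_single_left, h4, if_neg (by simp), Finset.insert_erase hS]
    have h5 : jwSign p (S.erase p) * jwSign p (S.erase p) = 1 := by
      rw [jwSign, ← pow_add, ← two_mul, pow_mul]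
      simp
    have h6 : (starRingEnd ℂ) (jwSign p (S.erase p)) = jwSign p (S.erase p) := by
      simp [jwSign]
    simp only [RCLike.inner_apply, h6]
    rw [mul_right_comm, h5, one_mul]
  · simp [hS]

open Classical in
/-- The multiplier `|S ∩ G|` of the number operator `∑_{p ∈ G} a_p^* a_p`. -/
def cnt (G : Set Mom) (S : Finset Mom) : ℕ := (S.filter (fun p => p ∈ G)).card

/-- The multiplier `|S|` of the number operator `𝓝 = ∑_p a_p^* a_p`. -/
def nTot (S : Finset Mom) : ℕ := cnt Set.univ S

/-- The momenta at distance more than `g` from the Fermi sphere. -/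
def gapSet (kF g : ℝ) : Set Mom := {p | g < |‖toE3 p‖ - kF|}

/-- The multiplier of the gapped number operator
`∑_{p : ||p| - k_F| > θ N^{-δ}} a_p^* a_p`. -/
def nGap (kF δ θ : ℝ) (S : Finset Mom) : ℕ :=
  cnt (gapSet kF (θ * (numN kF : ℝ) ^ (-δ))) S

/-- The (in general unbounded) self-adjoint operator of multiplication by `w`, on its maximal
domain. -/
def mulOp (w : Finset Mom → ℕ) : Fock →ₗ.[ℂ] Fock where
  domain :=
    { carrier := {ψ | Memℓp (fun S => (w S : ℂ) * ψ S) 2}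
      add_mem' := fun {ψ φ} hψ hφ => by
        have h := Memℓp.add hψ hφ
        have e : (fun S => (w S : ℂ) * (ψ + φ) S)
            = (fun S => (w S : ℂ) * ψ S) + fun S => (w S : ℂ) * φ S := by
          funext S
          simp [mul_add]
        simpa only [Set.mem_ofPred_eq, e] using h
      zero_mem' := by
        have e : (fun S => (w S : ℂ) * (0 : Fock) S) = 0 := by
          funext S
          simp
        simpa only [Set.mem_ofPred_eq, e] using (zero_memℓp : Memℓp (0 : Finset Mom → ℂ) 2)
      smul_mem' := fun c ψ hψ => by
        have h := Memℓp.const_smul hψ c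
        have e : (fun S => (w S : ℂ) * (c • ψ) S) = c • fun S => (w S : ℂ) * ψ S := by
          funext S
          simp [mul_left_comm]
        simpa only [Set.mem_ofPred_eq, e] using h }
  toFun :=
    { toFun := fun ψ => ⟨fun S => (w S : ℂ) * ψ.1 S, ψ.2⟩
      map_add' := fun ψ φ => by
        ext S
        change (w S : ℂ) * (ψ.1 + φ.1) S = w S * ψ.1 S + w S * φ.1 S
        simp [mul_add]
      map_smul' := fun c ψ => by
        ext S
        change (w S : ℂ) * (c • ψ.1) S = c * (w S * ψ.1 S)
        simp [mul_left_comm] }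

/-- The quadratic form `⟨ψ, A ψ⟩ = ‖A^{1/2} ψ‖² ∈ [0, ∞]` of the non-negative self-adjoint operator
`A = mulOp w`; it is finite exactly on the form domain of `A`.  For operators `A, B` of this kind
and a unitary `U`, the operator inequality `U^* A U ≤ C B` means that
`⟨U ψ, A U ψ⟩ ≤ C ⟨ψ, B ψ⟩` in `[0, ∞]` for all `ψ`, that is, `U` maps the form domain of `B` into
that of `A`, and the inequality holds there. -/
def form (w : Finset Mom → ℕ) (ψ : Fock) : ℝ≥0∞ := ∑' S, (w S : ℝ≥0∞) * ‖ψ S‖ₑ ^ 2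

/-- The operator `U^* A U`, with domain `{ψ : U ψ ∈ D(A)}`. -/
def conjOp (U : Fock →L[ℂ] Fock) (A : Fock →ₗ.[ℂ] Fock) : Fock →ₗ.[ℂ] Fock where
  domain := A.domain.comap U.toLinearMap
  toFun := (ContinuousLinearMap.adjoint U).toLinearMap ∘ₗ A.toFun ∘ₗ
    (U.toLinearMap.restrict (fun _ h => h) : A.domain.comap U.toLinearMap →ₗ[ℂ] A.domain)

/-! ### Patches on the Fermi sphere -/

/-- The part of the shell `k_F - R ≤ |p| ≤ k_F + R` whose radial projection lies in the subset
`c` of the unit sphere. -/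
def shell (kF R : ℝ) (c : Set E3) : Set E3 :=
  {p | kF - R ≤ ‖p‖ ∧ ‖p‖ ≤ kF + R ∧ ‖p‖⁻¹ • p ∈ c}

/-- A decomposition of the shell of thickness `2R` around the Fermi sphere into `M = 2n` patches
`B_α`.  A patch is given by its radial projection `p_α = cap α` to the unit sphere and by its
normalized center `ω̂_α`.  The label `(i, true)` is a patch in a half sphere, `(i, false)` is its
reflection at the origin.  The `p_α` have diameter at most `C₀ M^{-1/2}` and area `4π / M` up to
corrections of order `(1 + R) N^{-1/3} M^{-1/2}`, and different patches
are separated by corridors larger than `R`. -/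
structure PatchDecomposition (kF R C₀ : ℝ) (n : ℕ) where
  cap : Fin n × Bool → Set E3
  center : Fin n × Bool → E3
  cap_subset : ∀ α, cap α ⊆ Metric.sphere 0 1
  measurable_cap : ∀ α, MeasurableSet (cap α)
  center_mem : ∀ α, center α ∈ cap α
  half : ∀ i, ∀ x ∈ cap (i, true), 0 ≤ x 2
  cap_mirror : ∀ i, ∀ x, x ∈ cap (i, false) ↔ -x ∈ cap (i, true)
  center_mirror : ∀ i, center (i, false) = -center (i, true)
  diam_le : ∀ α, ∀ x ∈ cap α, ∀ y ∈ cap α, dist x y ≤ C₀ * (2 * n : ℝ) ^ (-(1 / 2) : ℝ)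
  area : ∀ α,
    |((MeasureTheory.volume : MeasureTheory.Measure E3).toSphere
        {x : Metric.sphere (0 : E3) 1 | (x : E3) ∈ cap α}).toReal - 4 * Real.pi / (2 * n)|
      ≤ C₀ * (1 + R) * (numN kF : ℝ) ^ (-(1 / 3) : ℝ) * (2 * n : ℝ) ^ (-(1 / 2) : ℝ)
  corridor : ∀ α β, α ≠ β → ∀ p ∈ shell kF R (cap α), ∀ q ∈ shell kF R (cap β), R < dist p q

variable {kF R C₀ : ℝ} {n : ℕ}

namespace PatchDecomposition

/-- The patch `B_α`. -/
def patch (P : PatchDecomposition kF R C₀ n) (α : Fin n × Bool) : Set E3 :=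
  shell kF R (P.cap α)

open Classical in
/-- The `p ∈ B_F^c ∩ B_α` with `p - k ∈ B_F ∩ B_α`, as a finite set. -/
def pairs (P : PatchDecomposition kF R C₀ n) (α : Fin n × Bool) (k : Mom) : Finset Mom :=
  {p ∈ (fermiBall kF).image (fun h => h + k) |
    p ∉ fermiBall kF ∧ toE3 p ∈ P.patch α ∧ toE3 (p - k) ∈ P.patch α}

theorem mem_pairs (P : PatchDecomposition kF R C₀ n) (α : Fin n × Bool) (k p : Mom) :
    p ∈ P.pairs α k ↔ p ∉ fermiBall kF ∧ toE3 p ∈ P.patch α ∧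
      p - k ∈ fermiBall kF ∧ toE3 (p - k) ∈ P.patch α := by
  classical
  unfold pairs
  rw [Finset.mem_filter, Finset.mem_image]
  constructor
  · rintro ⟨⟨h, hh, rfl⟩, h1, h2, h3⟩
    exact ⟨h1, h2, by simpa using hh, h3⟩
  · rintro ⟨h1, h2, h3, h4⟩
    exact ⟨⟨p - k, h3, by simp⟩, h1, h2, h4⟩

/-- The normalization `n_α(k)`, the square root of the number of particle-hole pairs of relative
momentum `k` in `B_α`. -/
def nrm (P : PatchDecomposition kF R C₀ n) (α : Fin n × Bool) (k : Mom) : ℝ :=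
  √((P.pairs α k).card : ℝ)

/-- The pair creation operator `b_α^*(k)`. -/
def bStar (P : PatchDecomposition kF R C₀ n) (α : Fin n × Bool) (k : Mom) : Fock →L[ℂ] Fock :=
  (((P.nrm α k)⁻¹ : ℝ) : ℂ) • ∑ p ∈ P.pairs α k, cre p ∘L cre (p - k)

/-- The set `𝓘_k^+` of the `α` with `k · ω̂_α ≥ N^{-δ}`, as a type. -/
def IPlus (P : PatchDecomposition kF R C₀ n) (δ : ℝ) (k : Mom) : Type :=
  {α : Fin n × Bool // (numN kF : ℝ) ^ (-δ) ≤ inner ℝ (toE3 k) (P.center α)}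

instance (P : PatchDecomposition kF R C₀ n) (δ : ℝ) (k : Mom) : DecidableEq (P.IPlus δ k) :=
  Classical.decEq _

instance (P : PatchDecomposition kF R C₀ n) (δ : ℝ) (k : Mom) : Fintype (P.IPlus δ k) :=
  @Fintype.ofFinite _ (inferInstanceAs (Finite {_α : Fin n × Bool // _}))

/-- The index set `𝓘_k = 𝓘_k^+ ∪ 𝓘_k^-`.  Since `𝓘_k^-` consists of the reflections of the elements
of `𝓘_k^+`, it is written as two copies of `𝓘_k^+`: the index `inl α` stands for `α ∈ 𝓘_k^+`, and
`inr α` for the reflection of `α`, an element of `𝓘_k^-` (see `label`). -/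
abbrev I (P : PatchDecomposition kF R C₀ n) (δ : ℝ) (k : Mom) : Type :=
  P.IPlus δ k ⊕ P.IPlus δ k

section kernels

variable (P : PatchDecomposition kF R C₀ n) (Vhat : Mom → ℝ) (δ : ℝ) (k : Mom)

/-- The patch that an index in `𝓘_k` stands for. -/
def label : P.I δ k → Fin n × Bool
  | Sum.inl α => α.1
  | Sum.inr α => (α.1.1, !α.1.2)

/-- `k` for the indices in `𝓘_k^+`, and `-k` for those in `𝓘_k^-`. -/
def signedMom : P.I δ k → Mom
  | Sum.inl _ => k
  | Sum.inr _ => -k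

/-- `c_α^*(k)`, that is, `b_α^*(k)` for `α ∈ 𝓘_k^+` and `b_α^*(-k)` for `α ∈ 𝓘_k^-`. -/
def cStar (α : P.I δ k) : Fock →L[ℂ] Fock := P.bStar (P.label δ k α) (P.signedMom δ k α)

/-- `c_α(k)`. -/
def c (α : P.I δ k) : Fock →L[ℂ] Fock := ContinuousLinearMap.adjoint (P.cStar δ k α)

/-- `n_α(k)` for `α ∈ 𝓘_k` (with `-k` in place of `k` if `α ∈ 𝓘_k^-`). -/
def nI (α : P.I δ k) : ℝ := P.nrm (P.label δ k α) (P.signedMom δ k α)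

/-- `|k̂ · ω̂_α|`. -/
def cosAngle (α : Fin n × Bool) : ℝ := |inner ℝ (toE3 k) (P.center α)| / ‖toE3 k‖

/-- `D(k)_{α,β} = δ_{α,β} |k̂ · ω̂_α|`. -/
def D : Matrix (P.I δ k) (P.I δ k) ℝ :=
  Matrix.diagonal fun α => P.cosAngle k (P.label δ k α)

/-- `W(k)`: equal to `V̂(k) n_α(k) n_β(k) / (2 ħ κ N |k|)` if `α, β` are both in `𝓘_k^+` or both
in `𝓘_k^-`, and `0` otherwise. -/
def W : Matrix (P.I δ k) (P.I δ k) ℝ := fun α β =>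
  if α.isLeft = β.isLeft then
    Vhat k / (2 * hbar kF * kappa kF * numN kF * ‖toE3 k‖) * (P.nI δ k α * P.nI δ k β)
  else 0

/-- `W̃(k)`: equal to `V̂(k) n_α(k) n_β(k) / (2 ħ κ N |k|)` if one of `α, β` is in `𝓘_k^+` and the
other in `𝓘_k^-`, and `0` otherwise. -/
def Wt : Matrix (P.I δ k) (P.I δ k) ℝ := fun α β =>
  if α.isLeft = β.isLeft then 0
  else Vhat k / (2 * hbar kF * kappa kF * numN kF * ‖toE3 k‖) * (P.nI δ k α * P.nI δ k β)

end kernels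

end PatchDecomposition

/-! ### The Bogoliubov kernels -/

/-- The square root of a positive semidefinite real matrix. -/
def msqrt {ι : Type} [Fintype ι] [DecidableEq ι] (A : Matrix ι ι ℝ) : Matrix ι ι ℝ :=
  cfc Real.sqrt A

/-- The logarithm of a positive definite real matrix. -/
def mlog {ι : Type} [Fintype ι] [DecidableEq ι] (A : Matrix ι ι ℝ) : Matrix ι ι ℝ :=
  cfc Real.log A

/-- `|A| = (Aᵀ A)^{1/2}`. -/
def mabs {ι : Type} [Fintype ι] [DecidableEq ι] (A : Matrix ι ι ℝ) : Matrix ι ι ℝ :=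
  msqrt (A.transpose * A)

/-- The orthogonal factor `A |A|⁻¹` in the polar decomposition of an invertible real matrix. -/
def polarFactor {ι : Type} [Fintype ι] [DecidableEq ι] (A : Matrix ι ι ℝ) : Matrix ι ι ℝ :=
  A * (mabs A)⁻¹

/-- The branch of the complex logarithm with imaginary part in `(t - 2π, t]`; for `0 < t < 2π` its
value at `1` is `0`. -/
def branchLog (t : ℝ) (z : ℂ) : ℂ :=
  Complex.log (z * Complex.exp ((Real.pi - t : ℝ) * Complex.I)) - (Real.pi - t : ℝ) * Complex.I

open scoped Matrix.Norms.L2Operator in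
/-- The logarithm of an orthogonal matrix, for the branch `branchLog t`. -/
def orthLog {ι : Type} [Fintype ι] [DecidableEq ι] (t : ℝ) (Q : Matrix ι ι ℝ) : Matrix ι ι ℂ :=
  cfc (branchLog t) (Q.map (fun x => (x : ℂ)))

namespace PatchDecomposition

section kernels

variable (P : PatchDecomposition kF R C₀ n) (Vhat : Mom → ℝ) (δ : ℝ) (k : Mom)

/-- `E = [(D + W - W̃)^{1/2} (D + W + W̃) (D + W - W̃)^{1/2}]^{1/2}`. -/
def E : Matrix (P.I δ k) (P.I δ k) ℝ :=
  msqrt (msqrt (P.D δ k + P.W Vhat δ k - P.Wt Vhat δ k)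
    * (P.D δ k + P.W Vhat δ k + P.Wt Vhat δ k)
    * msqrt (P.D δ k + P.W Vhat δ k - P.Wt Vhat δ k))

/-- `S₁ = (D + W - W̃)^{1/2} E^{-1/2}`. -/
def S1 : Matrix (P.I δ k) (P.I δ k) ℝ :=
  msqrt (P.D δ k + P.W Vhat δ k - P.Wt Vhat δ k) * (msqrt (P.E Vhat δ k))⁻¹

/-- The Bogoliubov kernel `K(k) = log |S₁ᵀ|`. -/
def K : Matrix (P.I δ k) (P.I δ k) ℝ := mlog (mabs (P.S1 Vhat δ k).transpose)

/-- The orthogonal matrix `O(k)` in the polar decomposition `S₁ = O |S₁|`. -/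
def O : Matrix (P.I δ k) (P.I δ k) ℝ := polarFactor (P.S1 Vhat δ k)

/-- `d = diag(u_α²)` with `u_α² = |k̂ · ω̂_α|`, `α ∈ 𝓘_k^+`. -/
def d : Matrix (P.IPlus δ k) (P.IPlus δ k) ℝ := Matrix.diagonal fun α => P.cosAngle k α.1

/-- `v_α = ħ n_α(k) / (κ |k|^{1/2})`, `α ∈ 𝓘_k^+`. -/
def v : P.IPlus δ k → ℝ := fun α => hbar kF / (kappa kF * √‖toE3 k‖) * P.nrm α.1 k

/-- `b = g |v⟩⟨v|` with `g = κ V̂(k) / 2`. -/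
def b : Matrix (P.IPlus δ k) (P.IPlus δ k) ℝ :=
  (kappa kF / 2 * Vhat k) • Matrix.vecMulVec (P.v δ k) (P.v δ k)

/-- The orthogonal matrix `A` in the polar decomposition of `X = (d + 2b)^{1/2} d^{1/2}`. -/
def A : Matrix (P.IPlus δ k) (P.IPlus δ k) ℝ :=
  polarFactor (msqrt (P.d δ k + (2 : ℝ) • P.b Vhat δ k) * msqrt (P.d δ k))

/-- `U = 2^{-1/2} ((1, 1), (1, -1))`, with respect to `𝓘_k = 𝓘_k^+ ∪ 𝓘_k^-`. -/
def U : Matrix (P.I δ k) (P.I δ k) ℝ := (√2)⁻¹ • Matrix.fromBlocks 1 1 1 (-1)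

/-- `Õ = U ((1, 0), (0, A)) Uᵀ`. -/
def Ot : Matrix (P.I δ k) (P.I δ k) ℝ :=
  P.U δ k * Matrix.fromBlocks 1 0 0 (P.A Vhat δ k) * (P.U δ k).transpose

/-- `L(k) = log (O(k) Õ(k))`, for the branch of the logarithm given by `t`. -/
def L (t : ℝ) : Matrix (P.I δ k) (P.I δ k) ℂ := orthLog t (P.O Vhat δ k * P.Ot Vhat δ k)

end kernels

end PatchDecomposition

/-! ### The approximate Bogoliubov transformations -/

open Classical in
/-- `Γ^nor`: half of the lattice points `k ≠ 0` with `|k| < R` (the coordinates `k₁, k₂, k₃` are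
`k 0, k 1, k 2`). -/
def gammaNor (R : ℝ) : Finset Mom :=
  {k ∈ box R | ‖toE3 k‖ < R ∧
    (0 < k 2 ∨ (k 2 = 0 ∧ 0 < k 1) ∨ (k 2 = 0 ∧ k 1 = 0 ∧ 0 < k 0))}

namespace PatchDecomposition

variable (P : PatchDecomposition kF R C₀ n) (Vhat : Mom → ℝ) (δ : ℝ)

/-- `½ ∑_{k ∈ Γ^nor} ∑_{α,β ∈ 𝓘_k} K(k)_{α,β} c_α^*(k) c_β^*(k)`. -/
def expT : Fock →L[ℂ] Fock :=
  (1 / 2 : ℂ) • ∑ k ∈ gammaNor R, ∑ α : P.I δ k, ∑ β : P.I δ k,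
    (P.K Vhat δ k α β : ℂ) • (P.cStar δ k α ∘L P.cStar δ k β)

/-- `T_λ`. -/
def T (lam : ℝ) : Fock →L[ℂ] Fock :=
  NormedSpace.exp ((lam : ℂ) •
    (P.expT Vhat δ - ContinuousLinearMap.adjoint (P.expT Vhat δ)))

/-- `∑_{k ∈ Γ^nor} ∑_{α,β ∈ 𝓘_k} L(k)_{α,β} c_α^*(k) c_β(k)`. -/
def expZ (t : ℝ) : Fock →L[ℂ] Fock :=
  ∑ k ∈ gammaNor R, ∑ α : P.I δ k, ∑ β : P.I δ k,
    P.L Vhat δ k t α β • (P.cStar δ k α ∘L P.c δ k β)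

/-- `Z_λ`. -/
def Z (t lam : ℝ) : Fock →L[ℂ] Fock := NormedSpace.exp ((lam : ℂ) • P.expZ Vhat δ t)

end PatchDecomposition

end

end RPA

/-!
For a weight `w` of the occupied set, Grönwall's inequality bounds `⟨e^{λX} ψ, w e^{λX} ψ⟩` as soon
as the commutator of `w` with the skew-adjoint generator `X` is bounded by `w` as a form; this is
applied to bounded truncations of `w`, which are removed by monotone convergence.

A term of the generator of `T` creates or annihilates four particles, which changes the weights in
question by at most a constant times `w / (N_δ + 1)`. Every pair in a patch that contributes to
`k` has at least one gapped member, since `k · ω_α ≥ N^{-δ}` moves it away from the Fermi surface;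
hence the pairs available in an occupied set are at most as many as its gapped particles, and the
commutator is bounded by `w` times the Hilbert-Schmidt norm of `K(k)`. The generator of `Z`
preserves the number of particles, so that only `N_δ` has to be commuted through it, with `L(k)`
in place of `K(k)`.

Both Hilbert-Schmidt norms are at most a multiple of `V̂(k)`, uniformly in `k_F`, `R` and the
patches. In block form the perturbation of `D` is `2 b`, of rank one, and the norms are controlled
by `tr (d⁻¹ 2 b)`, which is `V̂(k)` times the sum of `n_α(k)² / |k · ω_α|` over the patches in units
of `k_F²`. Replacing `k · ω_α` by `k · p / |p|`, this is a sum over the lattice points which leave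
the Fermi ball under translation by `k`, taken line by line in the direction of `k`.
-/

namespace RPA

/-! ### Lattice points leaving a ball -/

section LatticeSums

theorem sum_one_div_sqrt_le (n : ℕ) :
    ∑ i ∈ Finset.range n, 1 / √((i : ℝ) + 1) ≤ 2 * √(n : ℝ) := by
  induction n with
  | zero => simp
  | succ n ih =>
    have hpos : 0 < √((n : ℝ) + 1) := Real.sqrt_pos.mpr (by positivity)
    have hstep : 1 / √((n : ℝ) + 1) ≤ 2 * √((n : ℝ) + 1) - 2 * √(n : ℝ) := by
      rw [div_le_iff₀ hpos]
      nlinarith [sq_nonneg (√((n : ℝ) + 1) - √(n : ℝ)), Real.sq_sqrt (Nat.cast_nonneg (α := ℝ) n),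
        Real.sq_sqrt (show (0 : ℝ) ≤ n + 1 by positivity)]
    rw [Finset.sum_range_succ]
    push_cast
    linarith

theorem sum_one_div_le_of_injOn {ι : Type*} {s : Finset ι} {f : ι → ℕ} (hf : Set.InjOn f s)
    {g : ι → ℝ} {μ : ℝ} (hμ : 0 < μ) (hgμ : ∀ i ∈ s, μ ≤ g i) {m : ℕ} (hfm : ∀ i ∈ s, f i ≤ m)
    (hg : ∀ i ∈ s, (m * f i : ℝ) ≤ 2 * g i ^ 2) :
    ∑ i ∈ s, 1 / g i ≤ 1 / μ + 2 * √2 := by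
  classical
  set F : ℕ → ℝ := fun j => if j = 0 then 1 / μ else √2 / √m * (1 / √j) with hF
  have hF_nonneg : ∀ j, 0 ≤ F j := fun j => by simp only [hF]; split_ifs <;> positivity
  have hle : ∀ i ∈ s, 1 / g i ≤ F (f i) := by
    intro i hi
    have hgi : 0 < g i := hμ.trans_le (hgμ i hi)
    by_cases h0 : f i = 0
    · simpa only [hF, h0, if_true] using one_div_le_one_div_of_le hμ (hgμ i hi)
    · have hfi : (0 : ℝ) < f i := by exact_mod_cast Nat.pos_of_ne_zero h0
      have hm : (0 : ℝ) < m := hfi.trans_le (by exact_mod_cast hfm i hi)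
      have hsqrt : √m * √(f i) ≤ √2 * g i := by
        rw [← Real.sqrt_mul hm.le, ← Real.sqrt_sq hgi.le, ← Real.sqrt_mul zero_le_two]
        exact Real.sqrt_le_sqrt (hg i hi)
      simp only [hF, h0, if_false]
      rw [div_mul_div_comm, mul_one, div_le_div_iff₀ hgi (by positivity), one_mul]
      exact hsqrt
  calc ∑ i ∈ s, 1 / g i ≤ ∑ i ∈ s, F (f i) := Finset.sum_le_sum hle
    _ = ∑ j ∈ s.image f, F j := (Finset.sum_image hf).symm
    _ ≤ ∑ j ∈ Finset.range (m + 1), F j :=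
        Finset.sum_le_sum_of_subset_of_nonneg
          (Finset.image_subset_iff.mpr fun i hi =>
            Finset.mem_range.mpr (Nat.lt_succ_of_le (hfm i hi)))
          fun j _ _ => hF_nonneg j
    _ = √2 / √m * ∑ j ∈ Finset.range m, 1 / √((j : ℝ) + 1) + 1 / μ := by
        rw [Finset.sum_range_succ', Finset.mul_sum]
        simp [hF]
    _ ≤ √2 / √m * (2 * √m) + 1 / μ := by gcongr; exact sum_one_div_sqrt_le m
    _ ≤ 1 / μ + 2 * √2 := by
        have hcancel : √2 * (√m / √m) ≤ √2 :=
          mul_le_of_le_one_right (Real.sqrt_nonneg 2) (div_self_le_one _)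
        linarith [mul_div_right_comm √2 √m √m, mul_div_assoc √2 √m √m]

theorem sum_one_div_le_of_quadratic_of_le {ι : Type*} {s : Finset ι} {y : ι → ℤ}
    (hy : Set.InjOn y s) {g : ι → ℝ} {r α y₀ μ : ℝ} (hμ : 0 < μ) (hα : 1 / 2 ≤ α)
    (hgμ : ∀ i ∈ s, μ ≤ g i) (hr : ∀ i ∈ s, α * (y i - y₀) ^ 2 ≤ r)
    (hg : ∀ i ∈ s, r - α * (y i - y₀) ^ 2 ≤ g i ^ 2) (hy₀ : ∀ i ∈ s, y₀ ≤ y i) :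
    ∑ i ∈ s, 1 / g i ≤ 1 / μ + 2 * √2 := by
  have hα0 : 0 < α := by linarith
  set ρ := √(r / α)
  have hρ : 0 ≤ ρ := Real.sqrt_nonneg _
  have hr_eq : ∀ i ∈ s, r = α * ρ ^ 2 := fun i hi => by
    have : 0 ≤ r := le_trans (by positivity) (hr i hi)
    rw [Real.sq_sqrt (by positivity)]
    field_simp
  have hdist : ∀ i ∈ s, 0 ≤ ρ + y₀ - y i := fun i hi => by
    have : y i - y₀ ≤ ρ := Real.le_sqrt_of_sq_le <| by
      rw [le_div_iff₀ hα0, mul_comm]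
      exact hr i hi
    linarith
  refine sum_one_div_le_of_injOn (f := fun i => ⌊ρ + y₀ - y i⌋₊) (m := ⌊ρ⌋₊) ?_ hμ hgμ
    (fun i hi => Nat.floor_mono (by linarith [hy₀ i hi])) fun i hi => ?_
  · intro i hi j hj hij
    have hfloor : ⌊ρ + y₀ - y i⌋ = ⌊ρ + y₀ - y j⌋ := by
      rw [← Int.natCast_floor_eq_floor (hdist i hi), ← Int.natCast_floor_eq_floor (hdist j hj)]
      exact_mod_cast hij
    simp only [Int.floor_sub_intCast, sub_right_inj] at hfloor
    exact hy hi hj hfloor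
  · have h := hg i hi
    rw [hr_eq i hi] at h
    have hfl := mul_le_mul (Nat.floor_le hρ) (Nat.floor_le (hdist i hi)) (Nat.cast_nonneg _) hρ
    have hsq : ρ * (ρ + y₀ - y i) ≤ ρ ^ 2 - (y i - y₀) ^ 2 := by
      nlinarith [hdist i hi, hy₀ i hi]
    have h_nonneg : 0 ≤ ρ * (ρ + y₀ - y i) := mul_nonneg hρ (hdist i hi)
    nlinarith

theorem sum_one_div_le_of_quadratic {ι : Type*} {s : Finset ι} {y : ι → ℤ}
    (hy : Set.InjOn y s) {g : ι → ℝ} {r α y₀ μ : ℝ} (hμ : 0 < μ) (hα : 1 / 2 ≤ α)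
    (hgμ : ∀ i ∈ s, μ ≤ g i) (hr : ∀ i ∈ s, α * (y i - y₀) ^ 2 ≤ r)
    (hg : ∀ i ∈ s, r - α * (y i - y₀) ^ 2 ≤ g i ^ 2) :
    ∑ i ∈ s, 1 / g i ≤ 2 / μ + 6 := by
  have hright : ∑ i ∈ s with y₀ ≤ y i, 1 / g i ≤ 1 / μ + 2 * √2 :=
    sum_one_div_le_of_quadratic_of_le (hy.mono (Finset.filter_subset _ s)) hμ hα
      (fun i hi => hgμ i (Finset.mem_filter.mp hi).1) (fun i hi => hr i (Finset.mem_filter.mp hi).1)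
      (fun i hi => hg i (Finset.mem_filter.mp hi).1) fun i hi => (Finset.mem_filter.mp hi).2
  have hsq : ∀ i, (((-y i : ℤ) : ℝ) - -y₀) ^ 2 = (y i - y₀) ^ 2 := fun i => by push_cast; ring
  have hleft : ∑ i ∈ s with ¬ y₀ ≤ y i, 1 / g i ≤ 1 / μ + 2 * √2 := by
    refine sum_one_div_le_of_quadratic_of_le (y := fun i => -y i) (y₀ := -y₀) (r := r)
      (neg_injective.comp_injOn (hy.mono (Finset.filter_subset _ s))) hμ hα
      (fun i hi => hgμ i (Finset.mem_filter.mp hi).1) (fun i hi => ?_) (fun i hi => ?_)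
      fun i hi => ?_
    · simpa only [hsq] using hr i (Finset.mem_filter.mp hi).1
    · simpa only [hsq] using hg i (Finset.mem_filter.mp hi).1
    · push_cast
      linarith [(Finset.mem_filter.mp hi).2]
  have h2 : √(2 : ℝ) ≤ 3 / 2 := Real.sqrt_le_iff.mpr ⟨by norm_num, by norm_num⟩
  calc ∑ i ∈ s, 1 / g i
      = ∑ i ∈ s with y₀ ≤ y i, 1 / g i + ∑ i ∈ s with ¬ y₀ ≤ y i, 1 / g i :=
        (Finset.sum_filter_add_sum_filter_not _ _ _).symm
    _ ≤ (1 / μ + 2 * √2) + (1 / μ + 2 * √2) := add_le_add hright hleft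
    _ ≤ 2 / μ + 6 := by
        have : 2 / μ = 1 / μ + 1 / μ := by ring
        linarith

end LatticeSums

section Exit

variable {E : Type*} [NormedAddCommGroup E]

/-- The translation by `k` moves `x - k` out of the closed ball of radius `r`, to `x`.  For lattice
points and the Fermi ball, these are the particles `x` with a hole at `x - k`. -/
def IsExit (r : ℝ) (k x : E) : Prop := r < ‖x‖ ∧ ‖x - k‖ ≤ r

theorem IsExit.norm_le {r : ℝ} {k x : E} (h : IsExit r k x) : ‖x‖ ≤ r + ‖k‖ := by
  linarith [h.2, norm_le_norm_add_norm_sub' x k, norm_sub_norm_le x k]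

theorem IsExit.eq_of_eq_add_zsmul [NormedSpace ℝ E] {r : ℝ} {k x x' : E} (hx : IsExit r k x)
    (hx' : IsExit r k x') (m : ℤ) (h : x' = x + (m : ℝ) • k) : m = 0 := by
  have not_pos : ∀ {x x' : E} {m : ℤ}, IsExit r k x → IsExit r k x' → x' = x + (m : ℝ) • k →
      ¬ 0 < m := by
    rintro x x' m hx hx' rfl hm
    have hm1 : (1 : ℝ) ≤ m := by exact_mod_cast hm
    have hconv : x = (1 - (m : ℝ)⁻¹) • (x - k) + (m : ℝ)⁻¹ • (x + (m : ℝ) • k - k) := by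
      match_scalars <;> field_simp <;> ring
    have hmem : x ∈ Metric.closedBall (0 : E) r := by
      rw [hconv]
      exact convex_closedBall (0 : E) r (mem_closedBall_zero_iff.mpr hx.2)
        (mem_closedBall_zero_iff.mpr hx'.2) (sub_nonneg.mpr (inv_le_one_of_one_le₀ hm1))
        (by positivity) (by ring)
    exact (mem_closedBall_zero_iff.mp hmem).not_gt hx.1
  have hle : m ≤ 0 := not_lt.mp (not_pos hx hx' h)
  have hge : -m ≤ 0 := not_lt.mp (not_pos hx' hx (m := -m) (by rw [h]; simp))
  omega

end Exit

section Line

variable {E : Type*} [NormedAddCommGroup E] [InnerProductSpace ℝ E]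

theorem norm_sq_starProjection_orthogonal_singleton (k x : E) :
    ‖(ℝ ∙ k)ᗮ.starProjection x‖ ^ 2 = ‖x‖ ^ 2 - (inner ℝ k x / ‖k‖) ^ 2 := by
  rw [Submodule.norm_sq_eq_add_norm_sq_starProjection x (ℝ ∙ k), Submodule.starProjection_singleton,
    norm_smul, mul_pow, Real.norm_eq_abs, sq_abs, RCLike.ofReal_real_eq_id, id]
  rcases eq_or_ne k 0 with rfl | hk
  · simp
  · have := norm_ne_zero_iff.mpr hk
    field_simp
    ring

theorem norm_sq_add_smul_eq (a : E) {b : E} (hb : b ≠ 0) (y : ℝ) :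
    ‖a + y • b‖ ^ 2 = ‖b‖ ^ 2 * (y - -inner ℝ a b / ‖b‖ ^ 2) ^ 2
      + (‖a‖ ^ 2 - inner ℝ a b ^ 2 / ‖b‖ ^ 2) := by
  have := norm_ne_zero_iff.mpr hb
  rw [norm_add_sq_real, inner_smul_right, norm_smul, mul_pow, Real.norm_eq_abs, sq_abs]
  field_simp
  ring

/-- On a row of parallel lines `x₀ + y u + ℝ k`, `y ∈ ℤ`, the squared distance to the axis `ℝ k` is
a quadratic polynomial in `y`, and it bounds `⟪k, x⟫ ^ 2` from below at an exit point `x`. -/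
theorem sum_one_div_inner_le_of_row {k u : E} (hu : 1 / 2 ≤ ‖(ℝ ∙ k)ᗮ.starProjection u‖ ^ 2)
    (hk : k ≠ 0) (x₀ : E) {ι : Type*} {s : Finset ι} {x : ι → E} {y : ι → ℤ} (hy : Set.InjOn y s)
    {w : ι → ℝ} (hx : ∀ i ∈ s, x i = x₀ + (y i : ℝ) • u + w i • k) {r J : ℝ} (hJ : 0 < J)
    (hexit : ∀ i ∈ s, IsExit r k (x i)) (hxJ : ∀ i ∈ s, J ≤ inner ℝ k (x i)) :
    ∑ i ∈ s, 1 / inner ℝ k (x i) ≤ 2 / J + 6 / ‖k‖ := by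
  have hκ : ‖k‖ ≠ 0 := norm_ne_zero_iff.mpr hk
  set p := (ℝ ∙ k)ᗮ.starProjection with hp
  have hpu : p u ≠ 0 := fun h => by norm_num [h] at hu
  have hpk : p k = 0 := by
    rw [hp, Submodule.starProjection_orthogonal', sub_apply,
      Submodule.starProjection_eq_self_iff.mpr (Submodule.mem_span_singleton_self k)]
    exact sub_self k
  have hpx : ∀ i ∈ s, p (x i) = p x₀ + (y i : ℝ) • p u := fun i hi => by simp [hx i hi, hpk]
  have hpxk : ∀ i ∈ s, p (x i - k) = p x₀ + (y i : ℝ) • p u := fun i hi => by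
    rw [map_sub, hpk, sub_zero, hpx i hi]
  have hnorm : ∀ i ∈ s, ‖p (x i)‖ ^ 2 ≤ r ^ 2 := fun i hi => by
    rw [hpx i hi, ← hpxk i hi, norm_sq_starProjection_orthogonal_singleton]
    have hsq : ‖x i - k‖ ^ 2 ≤ r ^ 2 := by gcongr; exact (hexit i hi).2
    linarith [sq_nonneg (inner ℝ k (x i - k) / ‖k‖)]
  have hinner : ∀ i ∈ s, r ^ 2 - ‖p (x i)‖ ^ 2 ≤ (inner ℝ k (x i) / ‖k‖) ^ 2 := fun i hi => by
    rw [norm_sq_starProjection_orthogonal_singleton]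
    have hr : 0 ≤ r := (norm_nonneg _).trans (hexit i hi).2
    have hsq : r ^ 2 ≤ ‖x i‖ ^ 2 := by gcongr; exact (hexit i hi).1.le
    linarith
  have hsum : ∑ i ∈ s, 1 / (inner ℝ k (x i) / ‖k‖) ≤ 2 / (J / ‖k‖) + 6 := by
    refine sum_one_div_le_of_quadratic hy (y₀ := -inner ℝ (p x₀) (p u) / ‖p u‖ ^ 2)
      (r := r ^ 2 - (‖p x₀‖ ^ 2 - inner ℝ (p x₀) (p u) ^ 2 / ‖p u‖ ^ 2)) (by positivity) hu
      (fun i hi => by gcongr; exact hxJ i hi) (fun i hi => ?_) (fun i hi => ?_)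
    · have := hnorm i hi
      rw [hpx i hi, norm_sq_add_smul_eq _ hpu] at this
      linarith
    · have := hinner i hi
      rw [hpx i hi, norm_sq_add_smul_eq _ hpu] at this
      linarith
  calc ∑ i ∈ s, 1 / inner ℝ k (x i) = (∑ i ∈ s, 1 / (inner ℝ k (x i) / ‖k‖)) / ‖k‖ := by
        rw [Finset.sum_div]
        exact Finset.sum_congr rfl fun i _ => by field_simp
    _ ≤ (2 / (J / ‖k‖) + 6) / ‖k‖ := by gcongr
    _ = 2 / J + 6 / ‖k‖ := by field_simp

end Line

section Lattice

theorem toE3_add (p q : Mom) : toE3 (p + q) = toE3 p + toE3 q := by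
  ext i; simp [toE3]

theorem toE3_sub (p q : Mom) : toE3 (p - q) = toE3 p - toE3 q := by
  ext i; simp [toE3]

theorem toE3_neg (p : Mom) : toE3 (-p) = -toE3 p := by
  ext i; simp [toE3]

theorem toE3_zsmul (m : ℤ) (p : Mom) : toE3 (m • p) = (m : ℝ) • toE3 p := by
  ext i; simp [toE3]

theorem abs_apply_le_norm (p : Mom) (i : Fin 3) : |(p i : ℝ)| ≤ ‖toE3 p‖ := by
  simpa [toE3] using PiLp.norm_apply_le (toE3 p) i

theorem one_le_norm_toE3 {k : Mom} (hk : k ≠ 0) : 1 ≤ ‖toE3 k‖ := by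
  obtain ⟨i, hi⟩ := Function.ne_iff.mp hk
  refine le_trans ?_ (abs_apply_le_norm k i)
  exact_mod_cast Int.one_le_abs hi

theorem toE3_ne_zero {k : Mom} (hk : k ≠ 0) : toE3 k ≠ 0 :=
  norm_pos_iff.mp (zero_lt_one.trans_le (one_le_norm_toE3 hk))

/-- The point of the lattice line `p + ℤ k` whose `i`-th coordinate lies in `[0, |k i|)`; it serves
as a label of that line. -/
def lineRep (k : Mom) (i : Fin 3) (p : Mom) : Mom := p - (p i / k i) • k

theorem toE3_eq_lineRep_add (k : Mom) (i : Fin 3) (p : Mom) :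
    toE3 p = toE3 (lineRep k i p) + ((p i / k i : ℤ) : ℝ) • toE3 k := by
  rw [lineRep, toE3_sub, toE3_zsmul, sub_add_cancel]

theorem lineRep_apply_self (k : Mom) (i : Fin 3) (p : Mom) : lineRep k i p i = p i % k i := by
  simp only [lineRep, Pi.sub_apply, Pi.smul_apply, smul_eq_mul]
  linarith [Int.mul_ediv_add_emod (p i) (k i)]

theorem abs_lineRep_apply_le {k : Mom} {i : Fin 3} (hki : k i ≠ 0) {j : Fin 3}
    (hji : |k j| ≤ |k i|) (p : Mom) : |lineRep k i p j| ≤ |p j| + |p i| + |k i| := by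
  have hemod : |p i % k i| ≤ |k i| := by
    rw [abs_of_nonneg (Int.emod_nonneg _ hki)]
    exact (Int.emod_lt_abs _ hki).le
  have hquot : |(p i / k i) * k j| ≤ |p i| + |k i| :=
    calc |(p i / k i) * k j| = |p i / k i| * |k j| := abs_mul _ _
      _ ≤ |p i / k i| * |k i| := by gcongr
      _ = |p i - p i % k i| := by
          rw [← abs_mul, mul_comm, eq_sub_of_add_eq (Int.mul_ediv_add_emod (p i) (k i))]
      _ ≤ |p i| + |k i| := by linarith [abs_sub (p i) (p i % k i)]
  calc |lineRep k i p j| ≤ |p j| + |(p i / k i) * k j| := abs_sub _ _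
    _ ≤ |p j| + |p i| + |k i| := by linarith

theorem injOn_lineRep {r : ℝ} {k : Mom} (i : Fin 3) :
    Set.InjOn (lineRep k i) {p | IsExit r (toE3 k) (toE3 p)} := by
  intro p hp p' hp' h
  have hadd : p' = p + (p' i / k i - p i / k i) • k := by
    rw [sub_smul, ← sub_eq_zero]
    rw [lineRep, lineRep, ← sub_eq_zero] at h
    rw [← neg_eq_zero, ← h]
    abel
  have hzero := IsExit.eq_of_eq_add_zsmul hp hp' (p' i / k i - p i / k i) <| by
    rw [← toE3_zsmul, ← toE3_add, ← hadd]
  rw [hadd, hzero, zero_smul, add_zero]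

theorem eq_smul_single_add (i : Fin 3) (x : E3) :
    x = x i • EuclideanSpace.single i 1 + x (i + 1) • EuclideanSpace.single (i + 1) 1
      + x (i + 2) • EuclideanSpace.single (i + 2) 1 := by
  ext j
  fin_cases i <;> fin_cases j <;> simp

theorem norm_sq_starProjection_single {k : E3} (hk : k ≠ 0) {i j : Fin 3} (hij : i ≠ j)
    (hji : |k j| ≤ |k i|) :
    1 / 2 ≤ ‖(ℝ ∙ k)ᗮ.starProjection (EuclideanSpace.single j (1 : ℝ))‖ ^ 2 := by
  have hsum : 2 * k j ^ 2 ≤ ‖k‖ ^ 2 := by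
    rw [EuclideanSpace.norm_sq_eq]
    calc 2 * k j ^ 2 ≤ k i ^ 2 + k j ^ 2 := by linarith [sq_le_sq.mpr hji]
      _ = ∑ l ∈ {i, j}, ‖k l‖ ^ 2 := by
          rw [Finset.sum_pair hij, Real.norm_eq_abs, Real.norm_eq_abs, sq_abs, sq_abs]
      _ ≤ ∑ l, ‖k l‖ ^ 2 :=
          Finset.sum_le_sum_of_subset_of_nonneg (Finset.subset_univ _) fun _ _ _ => by positivity
  have hdiv : k j ^ 2 / ‖k‖ ^ 2 ≤ 1 / 2 := by
    rw [div_le_iff₀ (by positivity)]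
    linarith
  rw [norm_sq_starProjection_orthogonal_singleton, EuclideanSpace.inner_single_right]
  simp only [PiLp.norm_single, norm_one, conj_trivial, one_mul, div_pow]
  linarith

variable {r J : ℝ} {k : Mom} {s : Finset Mom} {i : Fin 3}

theorem sum_one_div_inner_le_of_lineRep_eq (hk : k ≠ 0) (hi : ∀ j, |k j| ≤ |k i|) (hJ : 0 < J)
    (hexit : ∀ p ∈ s, IsExit r (toE3 k) (toE3 p))
    (hinner : ∀ p ∈ s, J ≤ inner ℝ (toE3 k) (toE3 p)) {u : ℤ × ℤ}
    (hrep : ∀ p ∈ s, (lineRep k i p i, lineRep k i p (i + 1)) = u) :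
    ∑ p ∈ s, 1 / inner ℝ (toE3 k) (toE3 p) ≤ 2 / J + 6 / ‖toE3 k‖ := by
  have hi2 : i ≠ i + 2 := (by decide : ∀ i : Fin 3, i ≠ i + 2) i
  refine sum_one_div_inner_le_of_row (u := EuclideanSpace.single (i + 2) (1 : ℝ))
    (norm_sq_starProjection_single (toE3_ne_zero hk) hi2 ?_) (toE3_ne_zero hk)
    ((u.1 : ℝ) • EuclideanSpace.single i 1 + (u.2 : ℝ) • EuclideanSpace.single (i + 1) 1)
    (y := fun p => lineRep k i p (i + 2)) ?_
    (w := fun p => ((p i / k i : ℤ) : ℝ)) (fun p hp => ?_) hJ hexit hinner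
  · simp only [toE3]
    exact_mod_cast hi (i + 2)
  · intro p hp q hq hpq
    have hpq' := Prod.ext_iff.mp ((hrep p hp).trans (hrep q hq).symm)
    refine injOn_lineRep i (hexit p hp) (hexit q hq) (funext fun j => ?_)
    have hj := (by decide : ∀ i j : Fin 3, j = i ∨ j = i + 1 ∨ j = i + 2) i j
    rcases hj with rfl | rfl | rfl
    exacts [hpq'.1, hpq'.2, hpq]
  · rw [toE3_eq_lineRep_add k i p, eq_smul_single_add i (toE3 (lineRep k i p)), ← hrep p hp]
    rfl

theorem lineRep_mem_box {p : Mom} (hk : k i ≠ 0) (hi : ∀ j, |k j| ≤ |k i|) (hkr : ‖toE3 k‖ ≤ r)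
    (hp : IsExit r (toE3 k) (toE3 p)) :
    (lineRep k i p i, lineRep k i p (i + 1))
      ∈ Finset.Ico 0 |k i| ×ˢ Finset.Icc (-⌊5 * r⌋) ⌊5 * r⌋ := by
  have hlabel : (|lineRep k i p (i + 1)| : ℝ) ≤ 5 * r :=
    calc (|lineRep k i p (i + 1)| : ℝ) ≤ |(p (i + 1) : ℝ)| + |(p i : ℝ)| + |(k i : ℝ)| := by
          exact_mod_cast abs_lineRep_apply_le hk (hi (i + 1)) p
      _ ≤ ‖toE3 p‖ + ‖toE3 p‖ + ‖toE3 k‖ := by gcongr <;> exact abs_apply_le_norm _ _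
      _ ≤ 5 * r := by linarith [hp.norm_le]
  rw [Finset.mem_product, Finset.mem_Ico, Finset.mem_Icc, lineRep_apply_self]
  exact ⟨⟨Int.emod_nonneg _ hk, Int.emod_lt_abs _ hk⟩,
    abs_le.mp (Int.le_floor.mpr (by exact_mod_cast hlabel))⟩

theorem sum_one_div_inner_le_of_isExit (hk : k ≠ 0) (hkr : ‖toE3 k‖ ≤ r) (hJ : 0 < J)
    (hexit : ∀ p ∈ s, IsExit r (toE3 k) (toE3 p))
    (hinner : ∀ p ∈ s, J ≤ inner ℝ (toE3 k) (toE3 p)) :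
    ∑ p ∈ s, 1 / inner ℝ (toE3 k) (toE3 p) ≤ 11 * r * (2 * ‖toE3 k‖ / J + 6) := by
  obtain ⟨i, -, hi⟩ :=
    Finset.exists_max_image Finset.univ (fun i => |k i|) Finset.univ_nonempty
  replace hi : ∀ j, |k j| ≤ |k i| := fun j => hi j (Finset.mem_univ j)
  have hki : k i ≠ 0 := fun h => hk <| funext fun j => abs_nonpos_iff.mp <| by
    simpa [h] using hi j
  have hκ : 0 < ‖toE3 k‖ := norm_pos_iff.mpr (toE3_ne_zero hk)
  have hr : 1 ≤ r := (one_le_norm_toE3 hk).trans hkr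
  set B := Finset.Ico 0 |k i| ×ˢ Finset.Icc (-⌊5 * r⌋) ⌊5 * r⌋ with hB
  have hcard : (B.card : ℝ) ≤ ‖toE3 k‖ * (11 * r) := by
    have hfloor : 0 ≤ ⌊5 * r⌋ := Int.floor_nonneg.mpr (by positivity)
    have hIco : ((|k i| - 0).toNat : ℝ) = |(k i : ℝ)| := by
      rw [sub_zero, ← Int.cast_natCast, Int.toNat_of_nonneg (abs_nonneg _), Int.cast_abs]
    have hIcc : ((⌊5 * r⌋ + 1 - -⌊5 * r⌋).toNat : ℝ) = 2 * ⌊5 * r⌋ + 1 := by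
      rw [← Int.cast_natCast, Int.toNat_of_nonneg (by omega)]
      push_cast
      ring
    rw [hB, Finset.card_product, Int.card_Ico, Int.card_Icc, Nat.cast_mul, hIco, hIcc]
    gcongr
    · exact abs_apply_le_norm k i
    · linarith [Int.floor_le (5 * r)]
  calc ∑ p ∈ s, 1 / inner ℝ (toE3 k) (toE3 p)
      = ∑ u ∈ B, ∑ p ∈ s with (lineRep k i p i, lineRep k i p (i + 1)) = u,
          1 / inner ℝ (toE3 k) (toE3 p) :=
        (Finset.sum_fiberwise_of_maps_to
          (fun p hp => lineRep_mem_box hki hi hkr (hexit p hp)) _).symm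
    _ ≤ ∑ _u ∈ B, (2 / J + 6 / ‖toE3 k‖) := Finset.sum_le_sum fun u _ =>
        sum_one_div_inner_le_of_lineRep_eq hk hi hJ
          (fun p hp => hexit p (Finset.mem_filter.mp hp).1)
          (fun p hp => hinner p (Finset.mem_filter.mp hp).1) fun p hp => (Finset.mem_filter.mp hp).2
    _ = B.card * (2 / J + 6 / ‖toE3 k‖) := by rw [Finset.sum_const, nsmul_eq_mul]
    _ ≤ ‖toE3 k‖ * (11 * r) * (2 / J + 6 / ‖toE3 k‖) := by gcongr
    _ = 11 * r * (2 * ‖toE3 k‖ / J + 6) := by field_simp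

end Lattice

/-! ### Patches and their pairs -/

section Packing

open MeasureTheory in
/-- The disjoint balls of radius `r` around points at distance `s` from the origin lie in the shell
`s - r < |x| < s + r`. -/
theorem card_mul_pow_add_le_of_dist_le {E : Type*} [NormedAddCommGroup E] [NormedSpace ℝ E]
    [FiniteDimensional ℝ E] {ι : Type*} [Fintype ι] {x : ι → E} {r s : ℝ} (hr : 0 < r)
    (hrs : r ≤ s) (hxs : ∀ i, ‖x i‖ = s) (hx : Pairwise fun i j => 2 * r ≤ dist (x i) (x j)) :
    Fintype.card ι * r ^ Module.finrank ℝ E + (s - r) ^ Module.finrank ℝ E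
      ≤ (s + r) ^ Module.finrank ℝ E := by
  let : MeasurableSpace E := borel E
  have : BorelSpace E := ⟨rfl⟩
  set μ : Measure E := Measure.addHaar
  set u := μ.real (Metric.ball 0 1)
  have hu : 0 < u :=
    ENNReal.toReal_pos (Metric.measure_ball_pos μ _ one_pos).ne' measure_ball_lt_top.ne
  have hball : ∀ i, μ.real (Metric.ball (x i) r) = r ^ Module.finrank ℝ E * u := fun i => by
    rw [measureReal_def, Measure.addHaar_ball_of_pos μ (x i) hr, ENNReal.toReal_mul,
      ENNReal.toReal_ofReal (by positivity)]
    rfl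
  have hdisj : Pairwise (Function.onFun Disjoint fun i => Metric.ball (x i) r) := fun i j hij =>
    Metric.ball_disjoint_ball (by linarith [hx hij])
  have hcore : Disjoint (⋃ i, Metric.ball (x i) r) (Metric.closedBall 0 (s - r)) :=
    Set.disjoint_iUnion_left.mpr fun i => (Metric.closedBall_disjoint_ball <| by
      rw [dist_zero_left, hxs, sub_add_cancel]).symm
  have hsub : (⋃ i, Metric.ball (x i) r) ∪ Metric.closedBall 0 (s - r)
      ⊆ Metric.closedBall 0 (s + r) := by
    refine Set.union_subset (Set.iUnion_subset fun i => ?_)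
      (Metric.closedBall_subset_closedBall (by linarith))
    refine Metric.ball_subset_closedBall.trans (Metric.closedBall_subset_closedBall' ?_)
    rw [dist_zero_right, hxs, add_comm]
  have hvol := measureReal_mono (μ := μ) hsub measure_closedBall_lt_top.ne
  rw [measureReal_union hcore Metric.isClosed_closedBall.measurableSet
      ((measure_mono (Set.subset_union_left.trans hsub)).trans_lt measure_closedBall_lt_top).ne
      measure_closedBall_lt_top.ne,
    measureReal_iUnion_fintype hdisj (fun _ => Metric.isOpen_ball.measurableSet)
      (fun _ => measure_ball_lt_top.ne),
    Finset.sum_congr rfl fun i _ => hball i, Finset.sum_const, nsmul_eq_mul, Finset.card_univ,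
    Measure.addHaar_real_closedBall μ _ (sub_nonneg.mpr hrs),
    Measure.addHaar_real_closedBall μ _ (by linarith), ← mul_assoc, ← add_mul] at hvol
  exact le_of_mul_le_mul_right hvol hu

end Packing

section FermiBall

theorem numN_pos {kF : ℝ} (hkF : 0 < kF) : 0 < numN kF := by
  refine Finset.card_pos.mpr ⟨0, mem_fermiBall.mpr ?_⟩
  have : toE3 0 = 0 := by ext i; simp [toE3]
  rw [this, norm_zero]
  exact hkF.le

theorem numN_rpow_pos {kF : ℝ} (hkF : 0 < kF) (s : ℝ) : 0 < (numN kF : ℝ) ^ s :=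
  Real.rpow_pos_of_pos (Nat.cast_pos.mpr (numN_pos hkF)) s

theorem card_cube_le_numN {kF : ℝ} {m : ℕ} (hm : 2 * m ≤ kF) : (2 * m + 1) ^ 3 ≤ numN kF := by
  have hsub : (Finset.Icc (fun _ => -(m : ℤ)) (fun _ => (m : ℤ)) : Finset Mom)
      ⊆ fermiBall kF := by
    intro p hp
    obtain ⟨hlow, hupp⟩ := Finset.mem_Icc.mp hp
    have hcoord : ∀ i, (p i : ℝ) ^ 2 ≤ (m : ℝ) ^ 2 := fun i => by
      exact_mod_cast sq_le_sq' (hlow i) (hupp i)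
    refine mem_fermiBall.mpr (le_trans ?_ hm)
    rw [← sq_le_sq₀ (norm_nonneg _) (by positivity), EuclideanSpace.norm_sq_eq]
    calc ∑ i, ‖toE3 p i‖ ^ 2 = ∑ i, (p i : ℝ) ^ 2 := by simp [toE3]
      _ ≤ ∑ _i : Fin 3, (m : ℝ) ^ 2 := Finset.sum_le_sum fun i _ => hcoord i
      _ ≤ (2 * m) ^ 2 := by
          rw [Finset.sum_const, Finset.card_univ, Fintype.card_fin, nsmul_eq_mul]
          push_cast
          nlinarith [sq_nonneg (m : ℝ)]
  have hside : ((m : ℤ) + 1 - -m).toNat = 2 * m + 1 := by omega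
  have hcard : _ ≤ numN kF := Finset.card_le_card hsub
  simpa only [Pi.card_Icc, Int.card_Icc, hside, Finset.prod_const, Finset.card_univ,
    Fintype.card_fin] using hcard

theorem half_le_numN_rpow {kF : ℝ} (hkF : 0 < kF) : kF / 2 ≤ (numN kF : ℝ) ^ (1 / 3 : ℝ) := by
  set m : ℕ := ⌊kF / 2⌋₊
  have hm : (m : ℝ) ≤ kF / 2 := Nat.floor_le (by positivity)
  have hcube : (kF / 2) ^ (3 : ℕ) ≤ (numN kF : ℝ) :=
    calc (kF / 2) ^ (3 : ℕ) ≤ (2 * (m : ℝ) + 1) ^ (3 : ℕ) := by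
          gcongr
          linarith [Nat.lt_floor_add_one (kF / 2), (Nat.cast_nonneg m : (0 : ℝ) ≤ m)]
      _ ≤ (numN kF : ℝ) := by
          exact_mod_cast card_cube_le_numN (by linarith : 2 * (m : ℝ) ≤ kF)
  calc kF / 2 = ((kF / 2) ^ (3 : ℕ)) ^ (1 / 3 : ℝ) := by
        rw [← Real.rpow_natCast, ← Real.rpow_mul (by positivity)]
        norm_num
    _ ≤ (numN kF : ℝ) ^ (1 / 3 : ℝ) := Real.rpow_le_rpow (by positivity) hcube (by norm_num)

theorem ne_zero_of_mem_gammaNor {R : ℝ} {k : Mom} (hk : k ∈ gammaNor R) : k ≠ 0 := by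
  rintro rfl
  simp [gammaNor] at hk

theorem norm_lt_of_mem_gammaNor {R : ℝ} {k : Mom} (hk : k ∈ gammaNor R) : ‖toE3 k‖ < R :=
  (Finset.mem_filter.mp hk).2.1

end FermiBall

namespace PatchDecomposition

variable {kF R C₀ : ℝ} {n : ℕ}

section Geometry

variable (P : PatchDecomposition kF R C₀ n)

theorem norm_center (α : Fin n × Bool) : ‖P.center α‖ = 1 := by
  simpa using P.cap_subset α (P.center_mem α)

theorem smul_center_mem_patch (α : Fin n × Bool) {r : ℝ} (hr : 0 < r) (hlow : kF - R ≤ r)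
    (hupp : r ≤ kF + R) : r • P.center α ∈ P.patch α := by
  have hnorm : ‖r • P.center α‖ = r := by
    rw [norm_smul, P.norm_center, mul_one, Real.norm_of_nonneg hr.le]
  refine ⟨by rwa [hnorm], by rwa [hnorm], ?_⟩
  rw [hnorm, smul_smul, inv_mul_cancel₀ hr.ne', one_smul]
  exact P.center_mem α

include P in
/-- Otherwise two different patches would reach points of norm `R / 4`. -/
theorem R_lt_kF (hn : 0 < n) (hkF : 0 < kF) (hR : 0 < R) : R < kF := by
  by_contra! hle
  have hr : 0 < R / 4 := by positivity
  have hsep := P.corridor (⟨0, hn⟩, true) (⟨0, hn⟩, false) (by simp) _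
    (P.smul_center_mem_patch _ hr (by linarith) (by linarith)) _
    (P.smul_center_mem_patch _ hr (by linarith) (by linarith))
  have hnorm : ∀ α, ‖(R / 4) • P.center α‖ = R / 4 := fun α => by
    rw [norm_smul, P.norm_center, mul_one, Real.norm_of_nonneg hr.le]
  have hclose := dist_le_norm_add_norm ((R / 4) • P.center (⟨0, hn⟩, true))
    ((R / 4) • P.center (⟨0, hn⟩, false))
  rw [hnorm, hnorm] at hclose
  linarith

theorem eq_of_mem_patch (hR : 0 < R) {α β : Fin n × Bool} {x : E3} (hα : x ∈ P.patch α)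
    (hβ : x ∈ P.patch β) : α = β := by
  by_contra hne
  have hsep := P.corridor α β hne x hα x hβ
  rw [dist_self] at hsep
  linarith

include P in
theorem card_mul_sq_le (hR : 0 < R) (hRk : R < kF) : (2 * n : ℝ) * R ^ 2 ≤ 32 * kF ^ 2 := by
  have hkF : 0 < kF := hR.trans hRk
  have hvol := card_mul_pow_add_le_of_dist_le (x := fun α => kF • P.center α) (r := R / 2)
    (s := kF) (by positivity) (by linarith)
    (fun α => by rw [norm_smul, P.norm_center, mul_one, Real.norm_of_nonneg hkF.le])
    fun α β hαβ => by
      linarith [P.corridor α β hαβ _ (P.smul_center_mem_patch α hkF (by linarith) (by linarith)) _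
        (P.smul_center_mem_patch β hkF (by linarith) (by linarith))]
  rw [finrank_euclideanSpace_fin, Fintype.card_prod, Fintype.card_fin, Fintype.card_bool] at hvol
  push_cast at hvol
  have hRk2 : R ^ 2 * R ≤ kF ^ 2 * R := by gcongr
  refine le_of_mul_le_mul_right ?_ hR
  linarith [mul_nonneg (sq_nonneg kF) hR.le,
    (by ring : (kF + R / 2) ^ 3 - (kF - R / 2) ^ 3 = 3 * (kF ^ 2 * R) + R ^ 2 * R / 4)]

theorem isExit_of_mem_pairs {P : PatchDecomposition kF R C₀ n} {α : Fin n × Bool} {k p : Mom}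
    (hp : p ∈ P.pairs α k) : IsExit kF (toE3 k) (toE3 p) := by
  obtain ⟨hout, -, hin, -⟩ := (P.mem_pairs α k p).mp hp
  rw [mem_fermiBall] at hout hin
  exact ⟨not_le.mp hout, by rwa [← toE3_sub]⟩

end Geometry

/-- The patches are fine in comparison with the cutoff `N ^ (-δ)`: up to the small factor `ε`, the
cutoff dominates the variation of `k · x / |x|` over a patch and `R ^ 2 / k_F`, for `|k| < R`. -/
structure IsFine (P : PatchDecomposition kF R C₀ n) (δ ε : ℝ) : Prop where
  R_pos : 0 < R
  R_lt_kF : R < kF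
  diam_le : C₀ * (2 * n : ℝ) ^ (-(1 / 2) : ℝ) * R ≤ ε * (numN kF : ℝ) ^ (-δ)
  sq_le : R ^ 2 ≤ ε * kF * (numN kF : ℝ) ^ (-δ)

theorem isFine_of_le (P : PatchDecomposition kF R C₀ n) {δ ε : ℝ} (hε : 0 < ε) (hkF : 0 < kF)
    (hR : 0 < R)
    (hM : (C₀ ^ 2 + 32) / ε ^ 2 * ((numN kF : ℝ) ^ (2 * δ) * R ^ 2) ≤ 2 * n) :
    P.IsFine δ ε := by
  set x := (numN kF : ℝ) ^ δ
  have hx : 0 < x := numN_rpow_pos hkF δ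
  have hx_neg : (numN kF : ℝ) ^ (-δ) = x⁻¹ := Real.rpow_neg (Nat.cast_nonneg _) δ
  have hx_sq : (numN kF : ℝ) ^ (2 * δ) = x ^ 2 := by
    rw [mul_comm, Real.rpow_mul (Nat.cast_nonneg _), Real.rpow_two]
  rw [hx_sq] at hM
  have hM_pos : (0 : ℝ) < 2 * n := lt_of_lt_of_le (by positivity) hM
  have hRk : R < kF := P.R_lt_kF (by exact_mod_cast pos_of_mul_pos_right hM_pos zero_le_two) hkF hR
  have hpack := P.card_mul_sq_le hR hRk
  rw [div_mul_eq_mul_div, div_le_iff₀ (by positivity)] at hM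
  refine ⟨hR, hRk, ?_, ?_⟩
  · rw [Real.rpow_neg hM_pos.le, ← Real.sqrt_eq_rpow, hx_neg, ← div_eq_mul_inv, ← div_eq_mul_inv,
      div_mul_eq_mul_div, div_le_div_iff₀ (Real.sqrt_pos.mpr hM_pos) hx]
    refine le_of_abs_le (abs_le_of_sq_le_sq ?_ (by positivity))
    rw [mul_pow ε, Real.sq_sqrt hM_pos.le]
    nlinarith [sq_nonneg (x * R)]
  · rw [hx_neg, ← div_eq_mul_inv, le_div_iff₀ hx]
    refine le_of_abs_le (abs_le_of_sq_le_sq ?_ (by positivity))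
    have hM' : 32 * (x ^ 2 * R ^ 2) ≤ ε ^ 2 * (2 * n) := by nlinarith [sq_nonneg (C₀ * (x * R))]
    have hM_sq := mul_le_mul_of_nonneg_right hM' (sq_nonneg R)
    have hpack_sq := mul_le_mul_of_nonneg_left hpack (sq_nonneg ε)
    nlinarith

namespace IsFine

variable {P : PatchDecomposition kF R C₀ n} {δ ε : ℝ}

theorem kF_pos (hP : P.IsFine δ ε) : 0 < kF := hP.R_pos.trans hP.R_lt_kF

theorem eps_pos (hP : P.IsFine δ ε) : 0 < ε := by
  have hpos : 0 < ε * (kF * (numN kF : ℝ) ^ (-δ)) := by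
    rw [← mul_assoc]
    exact (pow_pos hP.R_pos 2).trans_le hP.sq_le
  exact pos_of_mul_pos_left hpos (mul_pos hP.kF_pos (numN_rpow_pos hP.kF_pos _)).le

theorem abs_inner_sub_le (hP : P.IsFine δ ε) {α : Fin n × Bool} {k : Mom} (hkR : ‖toE3 k‖ ≤ R)
    {x : E3} (hx : x ∈ P.patch α) :
    |inner ℝ (toE3 k) x - ‖x‖ * inner ℝ (toE3 k) (P.center α)|
      ≤ ‖x‖ * (ε * (numN kF : ℝ) ^ (-δ)) := by
  rcases eq_or_ne x 0 with rfl | hx0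
  · simp
  have hdecomp : inner ℝ (toE3 k) x - ‖x‖ * inner ℝ (toE3 k) (P.center α)
      = ‖x‖ * inner ℝ (toE3 k) (‖x‖⁻¹ • x - P.center α) := by
    have := norm_ne_zero_iff.mpr hx0
    rw [inner_sub_right, inner_smul_right]
    field_simp
  have hdiam := P.diam_le α _ hx.2.2 _ (P.center_mem α)
  rw [hdecomp, abs_mul, abs_norm]
  gcongr
  calc |inner ℝ (toE3 k) (‖x‖⁻¹ • x - P.center α)|
      ≤ ‖toE3 k‖ * ‖‖x‖⁻¹ • x - P.center α‖ := abs_real_inner_le_norm _ _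
    _ ≤ R * (C₀ * (2 * n : ℝ) ^ (-(1 / 2) : ℝ)) :=
        mul_le_mul hkR (by rwa [← dist_eq_norm]) (norm_nonneg _) hP.R_pos.le
    _ = C₀ * (2 * n : ℝ) ^ (-(1 / 2) : ℝ) * R := by ring
    _ ≤ ε * (numN kF : ℝ) ^ (-δ) := hP.diam_le

variable {k : Mom} {α : Fin n × Bool} {p : Mom}

theorem abs_inner_sub_le_half (hP : P.IsFine δ ε) (hε : ε ≤ 1 / 2) (hkR : ‖toE3 k‖ ≤ R)
    (hα : (numN kF : ℝ) ^ (-δ) ≤ inner ℝ (toE3 k) (P.center α)) (hp : p ∈ P.pairs α k) :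
    |inner ℝ (toE3 k) (toE3 p) - ‖toE3 p‖ * inner ℝ (toE3 k) (P.center α)|
      ≤ ‖toE3 p‖ * inner ℝ (toE3 k) (P.center α) / 2 := by
  have hcut : ε * (numN kF : ℝ) ^ (-δ) ≤ 1 / 2 * inner ℝ (toE3 k) (P.center α) :=
    mul_le_mul hε hα (numN_rpow_pos hP.kF_pos _).le (by norm_num)
  have hle := hP.abs_inner_sub_le hkR ((P.mem_pairs α k p).mp hp).2.1
  linarith [mul_le_mul_of_nonneg_left hcut (norm_nonneg (toE3 p))]

theorem le_inner_of_mem_pairs (hP : P.IsFine δ ε) (hε : ε ≤ 1 / 2) (hkR : ‖toE3 k‖ ≤ R)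
    (hα : (numN kF : ℝ) ^ (-δ) ≤ inner ℝ (toE3 k) (P.center α)) (hp : p ∈ P.pairs α k) :
    kF * (numN kF : ℝ) ^ (-δ) / 2 ≤ inner ℝ (toE3 k) (toE3 p) := by
  have hmul : kF * (numN kF : ℝ) ^ (-δ) ≤ ‖toE3 p‖ * inner ℝ (toE3 k) (P.center α) :=
    mul_le_mul (isExit_of_mem_pairs hp).1.le hα (numN_rpow_pos hP.kF_pos _).le (norm_nonneg _)
  linarith [(abs_le.mp (hP.abs_inner_sub_le_half hε hkR hα hp)).1]

theorem inv_inner_center_le (hP : P.IsFine δ ε) (hε : ε ≤ 1 / 2) (hkR : ‖toE3 k‖ ≤ R)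
    (hα : (numN kF : ℝ) ^ (-δ) ≤ inner ℝ (toE3 k) (P.center α)) (hp : p ∈ P.pairs α k) :
    1 / inner ℝ (toE3 k) (P.center α) ≤ 4 * kF * (1 / inner ℝ (toE3 k) (toE3 p)) := by
  have hcut : 0 < (numN kF : ℝ) ^ (-δ) := numN_rpow_pos hP.kF_pos _
  have hcenter : 0 < inner ℝ (toE3 k) (P.center α) := hcut.trans_le hα
  have hinner : 0 < inner ℝ (toE3 k) (toE3 p) :=
    (half_pos (mul_pos hP.kF_pos hcut)).trans_le (hP.le_inner_of_mem_pairs hε hkR hα hp)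
  have hnorm : ‖toE3 p‖ * inner ℝ (toE3 k) (P.center α)
      ≤ 2 * kF * inner ℝ (toE3 k) (P.center α) := by
    gcongr
    linarith [(isExit_of_mem_pairs hp).norm_le, hP.R_lt_kF]
  rw [mul_one_div, div_le_div_iff₀ hcenter hinner, one_mul]
  linarith [(abs_le.mp (hP.abs_inner_sub_le_half hε hkR hα hp)).2, mul_pos hP.kF_pos hcenter]

theorem sum_card_pairs_le (hP : P.IsFine δ ε) (hε : ε ≤ 1 / 2) (hk0 : k ≠ 0)
    (hkR : ‖toE3 k‖ ≤ R) :
    ∑ α : P.IPlus δ k, ((P.pairs α.1 k).card : ℝ) / inner ℝ (toE3 k) (P.center α.1)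
      ≤ 352 * kF ^ 2 := by
  have hkF := hP.kF_pos
  set x := (numN kF : ℝ) ^ (-δ)
  have hx : 0 < x := numN_rpow_pos hkF _
  have hdisj : Set.PairwiseDisjoint ((Finset.univ : Finset (P.IPlus δ k)) : Set (P.IPlus δ k))
      (fun α => P.pairs α.1 k) := fun α _ β _ hαβ => Finset.disjoint_left.mpr fun p hp hp' =>
    hαβ <| Subtype.ext <| P.eq_of_mem_patch hP.R_pos ((P.mem_pairs _ _ _).mp hp).2.1
      ((P.mem_pairs _ _ _).mp hp').2.1
  have hcount : ∑ α : P.IPlus δ k, ∑ p ∈ P.pairs α.1 k, 1 / inner ℝ (toE3 k) (toE3 p)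
      ≤ 11 * kF * (2 * ‖toE3 k‖ / (kF * x / 2) + 6) := by
    rw [← Finset.sum_biUnion hdisj]
    refine sum_one_div_inner_le_of_isExit hk0 (hkR.trans hP.R_lt_kF.le) (by positivity) ?_ ?_ <;>
      simp only [Finset.mem_biUnion, Finset.mem_univ, true_and, forall_exists_index]
    · exact fun p α hp => isExit_of_mem_pairs hp
    · exact fun p α hp => hP.le_inner_of_mem_pairs hε hkR α.2 hp
  have hcutoff : 2 * ‖toE3 k‖ / (kF * x / 2) ≤ 2 := by
    rw [div_le_iff₀ (by positivity)]
    have hksq : ‖toE3 k‖ ≤ R ^ 2 := by nlinarith [one_le_norm_toE3 hk0]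
    have hsmall : ε * kF * x ≤ 1 / 2 * kF * x := by gcongr
    linarith [hP.sq_le]
  calc ∑ α : P.IPlus δ k, ((P.pairs α.1 k).card : ℝ) / inner ℝ (toE3 k) (P.center α.1)
      ≤ ∑ α : P.IPlus δ k, ∑ p ∈ P.pairs α.1 k, 4 * kF * (1 / inner ℝ (toE3 k) (toE3 p)) := by
        refine Finset.sum_le_sum fun α _ => ?_
        rw [div_eq_mul_one_div, ← nsmul_eq_mul, ← Finset.sum_const]
        exact Finset.sum_le_sum fun p hp => hP.inv_inner_center_le hε hkR α.2 hp
    _ = 4 * kF * ∑ α : P.IPlus δ k, ∑ p ∈ P.pairs α.1 k, 1 / inner ℝ (toE3 k) (toE3 p) := by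
        simp only [Finset.mul_sum]
    _ ≤ 4 * kF * (11 * kF * (2 * ‖toE3 k‖ / (kF * x / 2) + 6)) := by gcongr
    _ ≤ 4 * kF * (11 * kF * (2 + 6)) := by gcongr
    _ = 352 * kF ^ 2 := by ring

theorem lt_norm_sub_norm_of_mem_pairs (hP : P.IsFine δ ε) (hkR : ‖toE3 k‖ ≤ R)
    (hα : (numN kF : ℝ) ^ (-δ) ≤ inner ℝ (toE3 k) (P.center α)) (hp : p ∈ P.pairs α k) :
    (1 - 2 * ε) * (numN kF : ℝ) ^ (-δ) < ‖toE3 p‖ - ‖toE3 (p - k)‖ := by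
  set x := (numN kF : ℝ) ^ (-δ)
  obtain ⟨hout, hin⟩ := isExit_of_mem_pairs hp
  have hnorm_sq : ‖toE3 (p - k)‖ ^ 2
      = ‖toE3 p‖ ^ 2 - 2 * inner ℝ (toE3 k) (toE3 p) + ‖toE3 k‖ ^ 2 := by
    rw [toE3_sub, norm_sub_sq_real, real_inner_comm]
  rw [← toE3_sub] at hin
  set a := ‖toE3 p‖
  set b := ‖toE3 (p - k)‖
  have ha : 0 < a := hP.kF_pos.trans hout
  have hax : 0 < ε * (a * x) := mul_pos hP.eps_pos (mul_pos ha (numN_rpow_pos hP.kF_pos _))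
  have hinner : a * x - a * (ε * x) ≤ inner ℝ (toE3 k) (toE3 p) := by
    linarith [(abs_le.mp (hP.abs_inner_sub_le hkR ((P.mem_pairs α k p).mp hp).2.1)).1,
      mul_le_mul_of_nonneg_left hα ha.le]
  have hk_sq : ‖toE3 k‖ ^ 2 ≤ ε * a * x :=
    calc ‖toE3 k‖ ^ 2 ≤ R ^ 2 := by gcongr
      _ ≤ ε * kF * x := hP.sq_le
      _ ≤ ε * a * x := by
          have := hP.eps_pos.le
          have := (numN_rpow_pos hP.kF_pos (-δ)).le
          gcongr
  refine lt_of_mul_lt_mul_right (a := 2 * a) ?_ (by positivity)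
  have hprod : (a - b) * (a + b) ≤ (a - b) * (2 * a) :=
    mul_le_mul_of_nonneg_left (by linarith) (by linarith)
  nlinarith

theorem mem_gapSet_or_of_mem_pairs {θ : ℝ} (hP : P.IsFine δ ε) (hεθ : 2 * ε ≤ 1 - 2 * θ)
    (hkR : ‖toE3 k‖ ≤ R) (hα : (numN kF : ℝ) ^ (-δ) ≤ inner ℝ (toE3 k) (P.center α))
    (hp : p ∈ P.pairs α k) :
    p ∈ gapSet kF (θ * (numN kF : ℝ) ^ (-δ)) ∨ p - k ∈ gapSet kF (θ * (numN kF : ℝ) ^ (-δ)) := by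
  set x := (numN kF : ℝ) ^ (-δ)
  have hx : 0 < x := numN_rpow_pos hP.kF_pos _
  have hdiff := hP.lt_norm_sub_norm_of_mem_pairs hkR hα hp
  have hθ : 2 * θ * x ≤ (1 - 2 * ε) * x := by gcongr; linarith
  by_contra! hcon
  simp only [gapSet, Set.mem_ofPred_eq, not_lt, abs_le] at hcon
  linarith [hcon.1.2, hcon.2.1]

end IsFine

section Labels

variable (P : PatchDecomposition kF R C₀ n) (δ : ℝ) (k : Mom)

theorem center_not (α : Fin n × Bool) : P.center (α.1, !α.2) = -P.center α := by
  rcases α with ⟨i, _ | _⟩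
  · rw [P.center_mirror, neg_neg, Bool.not_false]
  · rw [← P.center_mirror, Bool.not_true]

theorem le_inner_label (j : P.I δ k) :
    (numN kF : ℝ) ^ (-δ) ≤ inner ℝ (toE3 (P.signedMom δ k j)) (P.center (P.label δ k j)) := by
  rcases j with α | α
  · exact α.2
  · simp only [label, signedMom, P.center_not, toE3_neg, inner_neg_neg]
    exact α.2

theorem label_injective (hkF : 0 < kF) : Function.Injective (P.label δ k) := by
  have hcut : 0 < (numN kF : ℝ) ^ (-δ) := numN_rpow_pos hkF _
  intro i j hij
  have hi := P.le_inner_label δ k i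
  have hj := P.le_inner_label δ k j
  rw [hij] at hi
  rcases i with α | α <;> rcases j with β | β
  · exact congrArg _ (Subtype.ext hij)
  · simp only [signedMom, toE3_neg, inner_neg_left] at hi hj
    linarith
  · simp only [signedMom, toE3_neg, inner_neg_left] at hi hj
    linarith
  · simp only [label, Prod.mk.injEq, Bool.not_inj_iff] at hij
    exact congrArg _ (Subtype.ext (Prod.ext hij.1 hij.2))

theorem norm_signedMom (j : P.I δ k) : ‖toE3 (P.signedMom δ k j)‖ = ‖toE3 k‖ := by
  rcases j with α | α
  · rfl
  · simp only [signedMom, toE3_neg, norm_neg]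

end Labels

namespace IsFine

variable {P : PatchDecomposition kF R C₀ n} {δ ε θ : ℝ} {k : Mom}

open Classical in
/-- Of each pair one chooses a gapped member: two pairs of the same patch cannot share it, the
particle of one being outside and the hole of the other inside the Fermi ball. -/
theorem card_filter_pairs_le (hP : P.IsFine δ ε) (hεθ : 2 * ε ≤ 1 - 2 * θ) (hkR : ‖toE3 k‖ ≤ R)
    {α : Fin n × Bool} (hα : (numN kF : ℝ) ^ (-δ) ≤ inner ℝ (toE3 k) (P.center α))
    (S : Finset Mom) :
    {p ∈ P.pairs α k | p ∈ S ∧ p - k ∈ S}.card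
      ≤ {q ∈ S | q ∈ gapSet kF (θ * (numN kF : ℝ) ^ (-δ)) ∧ toE3 q ∈ P.patch α}.card := by
  set G := gapSet kF (θ * (numN kF : ℝ) ^ (-δ))
  refine Finset.card_le_card_of_injOn (fun p => if p ∈ G then p else p - k) ?_ ?_
  · intro p hp
    obtain ⟨hpα, hpS, hpkS⟩ := Finset.mem_filter.mp hp
    obtain ⟨-, hpatch, -, hpatch'⟩ := (P.mem_pairs _ _ _).mp hpα
    rw [Finset.mem_coe, Finset.mem_filter]
    by_cases hG : p ∈ G
    · simp only [hG, if_true]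
      exact ⟨hpS, trivial, hpatch⟩
    · simp only [hG, if_false]
      exact ⟨hpkS, (hP.mem_gapSet_or_of_mem_pairs hεθ hkR hα hpα).resolve_left hG, hpatch'⟩
  · intro p hp q hq hpq
    obtain ⟨hp_out, -, hp_in, -⟩ := (P.mem_pairs _ _ _).mp (Finset.mem_filter.mp hp).1
    obtain ⟨hq_out, -, hq_in, -⟩ := (P.mem_pairs _ _ _).mp (Finset.mem_filter.mp hq).1
    dsimp only at hpq
    split_ifs at hpq
    · exact hpq
    · exact absurd (hpq ▸ hq_in) hp_out
    · exact absurd (hpq ▸ hp_in) hq_out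
    · exact sub_left_injective hpq

open Classical in
theorem sum_card_filter_pairs_le (hP : P.IsFine δ ε) (hεθ : 2 * ε ≤ 1 - 2 * θ)
    (hkR : ‖toE3 k‖ ≤ R) (S : Finset Mom) :
    ∑ j : P.I δ k, {p ∈ P.pairs (P.label δ k j) (P.signedMom δ k j) |
      p ∈ S ∧ p - P.signedMom δ k j ∈ S}.card ≤ nGap kF δ θ S := by
  set G := gapSet kF (θ * (numN kF : ℝ) ^ (-δ))
  calc ∑ j : P.I δ k, {p ∈ P.pairs (P.label δ k j) (P.signedMom δ k j) |
        p ∈ S ∧ p - P.signedMom δ k j ∈ S}.card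
      ≤ ∑ j : P.I δ k, {q ∈ S | q ∈ G ∧ toE3 q ∈ P.patch (P.label δ k j)}.card :=
        Finset.sum_le_sum fun j _ => hP.card_filter_pairs_le hεθ
          ((P.norm_signedMom δ k j).trans_le hkR) (P.le_inner_label δ k j) S
    _ = (Finset.univ.biUnion fun j : P.I δ k =>
          {q ∈ S | q ∈ G ∧ toE3 q ∈ P.patch (P.label δ k j)}).card := by
        refine (Finset.card_biUnion fun i _ j _ hij =>
          Finset.disjoint_left.mpr fun q hi hj => ?_).symm
        exact hij <| P.label_injective δ k hP.kF_pos <| P.eq_of_mem_patch hP.R_pos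
          (Finset.mem_filter.mp hi).2.2 (Finset.mem_filter.mp hj).2.2
    _ ≤ nGap kF δ θ S := by
        refine Finset.card_le_card (Finset.biUnion_subset.mpr fun j _ q hq => ?_)
        obtain ⟨hqS, hqG, -⟩ := Finset.mem_filter.mp hq
        exact Finset.mem_filter.mpr ⟨hqS, hqG⟩

end IsFine

end PatchDecomposition

/-! ### Square roots, polar decomposition and logarithm in the Hilbert-Schmidt norm -/

section HilbertSchmidt

open Matrix

variable {m n : Type*}

theorem posSemidef_transpose_mul_self [Fintype m] [Finite n] (A : Matrix m n ℝ) :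
    (Aᵀ * A).PosSemidef := by
  simpa only [conjTranspose_eq_transpose_of_trivial] using posSemidef_conjTranspose_mul_self A

theorem transpose_eq_of_posSemidef {A : Matrix n n ℝ} (hA : A.PosSemidef) : Aᵀ = A := by
  rw [← conjTranspose_eq_transpose_of_trivial, hA.isHermitian.eq]

variable [Fintype n]

theorem posSemidef_mul_mul_transpose [Finite m] {A : Matrix n n ℝ} (hA : A.PosSemidef)
    (B : Matrix m n ℝ) : (B * A * Bᵀ).PosSemidef := by
  simpa only [conjTranspose_eq_transpose_of_trivial] using hA.mul_mul_conjTranspose_same B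

theorem posSemidef_mul_mul_self {A S : Matrix n n ℝ} (hA : A.PosSemidef) (hS : Sᵀ = S) :
    (S * A * S).PosSemidef := by
  simpa only [hS] using posSemidef_mul_mul_transpose hA S

open scoped MatrixOrder Matrix.Norms.L2Operator in
theorem exists_eq_transpose_mul_self {A : Matrix n n ℝ} (hA : A.PosSemidef) :
    ∃ B : Matrix n n ℝ, A = Bᵀ * B := by
  classical
  obtain ⟨B, hB⟩ := (CStarAlgebra.nonneg_iff_eq_star_mul_self (a := A)).mp hA.nonneg
  exact ⟨B, hB⟩

theorem trace_mul_nonneg_of_posSemidef {A B : Matrix n n ℝ} (hA : A.PosSemidef)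
    (hB : B.PosSemidef) : 0 ≤ (A * B).trace := by
  obtain ⟨C, rfl⟩ := exists_eq_transpose_mul_self hB
  rw [← mul_assoc, trace_mul_comm, ← mul_assoc]
  exact (posSemidef_mul_mul_transpose hA C).trace_nonneg

/-- On an eigenvector `v` of `A - B` with eigenvalue `l`, the form of `A ^ 2 - B ^ 2` is `l` times
that of `A + B`. -/
theorem posSemidef_sub_of_posSemidef_mul_self_sub {A B : Matrix n n ℝ} (hA : A.PosSemidef)
    (hB : B.PosDef) (hAB : (A * A - B * B).PosSemidef) : (A - B).PosSemidef := by
  classical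
  have hM : (A - B).IsHermitian := hA.isHermitian.sub hB.isHermitian
  refine hM.posSemidef_iff_eigenvalues_nonneg.mpr fun i => ?_
  set v : n → ℝ := ⇑(hM.eigenvectorBasis i)
  set l := hM.eigenvalues i
  have heigen : (A - B) *ᵥ v = l • v := hM.mulVec_eigenvectorBasis i
  have heigen' : v ᵥ* (A - B) = l • v := by
    rw [← mulVec_transpose, ← conjTranspose_eq_transpose_of_trivial, hM.eq, heigen]
  have hv : v ≠ 0 := fun hv => hM.eigenvectorBasis.toBasis.ne_zero i <| by
    ext j
    exact congrFun hv j
  have hform : v ⬝ᵥ ((A * A - B * B) *ᵥ v) = l * (v ⬝ᵥ ((A + B) *ᵥ v)) := by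
    have hfactor : A * A - B * B = (A - B) * A + B * (A - B) := by noncomm_ring
    rw [hfactor, add_mulVec, ← mulVec_mulVec, ← mulVec_mulVec, heigen, dotProduct_add,
      dotProduct_mulVec, heigen', mulVec_smul, dotProduct_smul, smul_dotProduct, add_mulVec,
      dotProduct_add, smul_eq_mul, smul_eq_mul, mul_add]
  have hpos : 0 < v ⬝ᵥ ((A + B) *ᵥ v) := (hB.posSemidef_add hA).dotProduct_mulVec_pos hv
  exact nonneg_of_mul_nonneg_left (hform ▸ hAB.dotProduct_mulVec_nonneg v) hpos

variable [Fintype m]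

/-- The square of the Hilbert-Schmidt norm. -/
def hsNormSq {𝕜 : Type*} [Norm 𝕜] (A : Matrix m n 𝕜) : ℝ := ∑ i, ∑ j, ‖A i j‖ ^ 2

theorem hsNormSq_nonneg {𝕜 : Type*} [Norm 𝕜] (A : Matrix m n 𝕜) : 0 ≤ hsNormSq A :=
  Finset.sum_nonneg fun _ _ => Finset.sum_nonneg fun _ _ => sq_nonneg _

theorem trace_conjTranspose_mul_self {𝕜 : Type*} [RCLike 𝕜] (A : Matrix m n 𝕜) :
    (Aᴴ * A).trace = (hsNormSq A : 𝕜) := by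
  simp only [hsNormSq, trace, diag_apply, mul_apply, conjTranspose_apply, RCLike.star_def,
    RCLike.conj_mul]
  rw [Finset.sum_comm]
  push_cast
  rfl

theorem hsNormSq_map_ofReal (A : Matrix m n ℝ) :
    hsNormSq (A.map fun x => (x : ℂ)) = hsNormSq A := by
  simp only [hsNormSq, map_apply, Complex.norm_real]

theorem hsNormSq_eq_trace (A : Matrix m n ℝ) : hsNormSq A = (Aᵀ * A).trace := by
  rw [← conjTranspose_eq_transpose_of_trivial, trace_conjTranspose_mul_self,
    RCLike.ofReal_real_eq_id, id]

theorem hsNormSq_transpose (A : Matrix m n ℝ) : hsNormSq Aᵀ = hsNormSq A :=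
  Finset.sum_comm

theorem hsNormSq_sub_le (A B : Matrix m n ℝ) :
    hsNormSq (A - B) ≤ 2 * hsNormSq A + 2 * hsNormSq B := by
  simp only [hsNormSq, Finset.mul_sum, ← Finset.sum_add_distrib, Matrix.sub_apply, Real.norm_eq_abs,
    sq_abs]
  gcongr with i _ j _
  linarith [sq_nonneg (A i j + B i j)]

theorem hsNormSq_le_trace_sq {X : Matrix n n ℝ} (hX : X.PosSemidef) :
    hsNormSq X ≤ X.trace ^ 2 := by
  obtain ⟨Y, hY⟩ := exists_eq_transpose_mul_self hX
  have hX_apply : ∀ i j, X i j = ∑ l, Y l i * Y l j := fun i j => by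
    rw [hY, mul_apply]
    rfl
  have hminor : ∀ i j, ‖X i j‖ ^ 2 ≤ X i i * X j j := fun i j => by
    rw [Real.norm_eq_abs, sq_abs, hX_apply i j, hX_apply i i, hX_apply j j]
    simpa only [pow_two] using
      Finset.sum_mul_sq_le_sq_mul_sq Finset.univ (fun l => Y l i) fun l => Y l j
  calc hsNormSq X ≤ ∑ i, ∑ j, X i i * X j j :=
        Finset.sum_le_sum fun i _ => Finset.sum_le_sum fun j _ => hminor i j
    _ = X.trace ^ 2 := by
        rw [pow_two, trace, Finset.sum_mul_sum]
        rfl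

variable [DecidableEq n]

theorem hsNormSq_mul_transpose (A : Matrix m n ℝ) {O : Matrix n n ℝ} (hO : Oᵀ * O = 1) :
    hsNormSq (A * Oᵀ) = hsNormSq A := by
  rw [← hsNormSq_transpose, hsNormSq_eq_trace, ← hsNormSq_transpose A, hsNormSq_eq_trace,
    transpose_transpose, transpose_transpose, transpose_mul, transpose_transpose,
    Matrix.mul_assoc, ← Matrix.mul_assoc Oᵀ, hO, Matrix.one_mul]

theorem hsNormSq_sub_one (A : Matrix n n ℝ) :
    hsNormSq (A - 1) = hsNormSq A - 2 * A.trace + (1 : Matrix n n ℝ).trace := by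
  have hexpand : (A - 1)ᵀ * (A - 1) = Aᵀ * A - Aᵀ - A + 1 := by
    rw [transpose_sub, transpose_one]
    noncomm_ring
  rw [hsNormSq_eq_trace, hexpand, hsNormSq_eq_trace, trace_add, trace_sub, trace_sub,
    trace_transpose]
  ring

/-- The orthogonal matrix nearest to a positive matrix is the identity. -/
theorem trace_mul_transpose_le_trace {O H : Matrix n n ℝ} (hO : Oᵀ * O = 1) (hH : H.PosSemidef) :
    (H * Oᵀ).trace ≤ H.trace := by
  have hpos := (posSemidef_mul_mul_transpose hH (O - 1)).trace_nonneg
  have hexpand : (O - 1) * H * (O - 1)ᵀ = O * H * Oᵀ - O * H - H * Oᵀ + H := by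
    rw [transpose_sub, transpose_one]
    noncomm_ring
  have hconj : (O * H * Oᵀ).trace = H.trace := by
    rw [trace_mul_comm, ← mul_assoc, hO, one_mul]
  have hswap : (O * H).trace = (H * Oᵀ).trace := by
    rw [← trace_transpose, transpose_mul, transpose_eq_of_posSemidef hH]
  rw [hexpand, trace_add, trace_sub, trace_sub, hconj, hswap] at hpos
  linarith

theorem hsNormSq_orthogonal_sub_one_le {O H : Matrix n n ℝ} (hO : Oᵀ * O = 1)
    (hH : H.PosSemidef) : hsNormSq (O - 1) ≤ 4 * hsNormSq (H * Oᵀ - 1) := by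
  have hclosest : hsNormSq (H - 1) ≤ hsNormSq (H * Oᵀ - 1) := by
    rw [hsNormSq_sub_one, hsNormSq_sub_one, hsNormSq_mul_transpose _ hO]
    linarith [trace_mul_transpose_le_trace hO hH]
  have hdecomp : (O - 1)ᵀ = (H * Oᵀ - 1) - (H - 1) * Oᵀ := by
    rw [transpose_sub, transpose_one]
    noncomm_ring
  calc hsNormSq (O - 1) = hsNormSq ((H * Oᵀ - 1) - (H - 1) * Oᵀ) := by
        rw [← hsNormSq_transpose, hdecomp]
    _ ≤ 2 * hsNormSq (H * Oᵀ - 1) + 2 * hsNormSq ((H - 1) * Oᵀ) := hsNormSq_sub_le _ _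
    _ ≤ 4 * hsNormSq (H * Oᵀ - 1) := by
        rw [hsNormSq_mul_transpose _ hO]
        linarith

end HilbertSchmidt

section FunctionalCalculus

open Matrix

variable {ι : Type} [Fintype ι] [DecidableEq ι] {A B : Matrix ι ι ℝ}

theorem spectrum_pos_of_posDef (hA : A.PosDef) {x : ℝ} (hx : x ∈ spectrum ℝ A) : 0 < x := by
  rw [hA.isHermitian.spectrum_real_eq_range_eigenvalues] at hx
  obtain ⟨i, rfl⟩ := hx
  exact hA.eigenvalues_pos i

theorem spectrum_nonneg_of_posSemidef (hA : A.PosSemidef) {x : ℝ} (hx : x ∈ spectrum ℝ A) :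
    0 ≤ x :=
  (posSemidef_iff_isHermitian_and_spectrum_nonneg.mp hA).2 hx

theorem continuousOn_spectrum (f : ℝ → ℝ) (A : Matrix ι ι ℝ) : ContinuousOn f (spectrum ℝ A) :=
  A.finite_real_spectrum.continuousOn f

theorem transpose_cfc (f : ℝ → ℝ) (A : Matrix ι ι ℝ) : (cfc f A)ᵀ = cfc f A := by
  rw [← conjTranspose_eq_transpose_of_trivial, ← star_eq_conjTranspose]
  exact (cfc_predicate f A).star_eq

theorem posSemidef_cfc {f : ℝ → ℝ} (hf : ∀ x ∈ spectrum ℝ A, 0 ≤ f x) :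
    (cfc f A).PosSemidef := by
  have hsq : cfc f A = (cfc (fun x => √(f x)) A)ᵀ * cfc (fun x => √(f x)) A := by
    rw [transpose_cfc, ← cfc_mul _ _ A (continuousOn_spectrum _ _) (continuousOn_spectrum _ _)]
    exact cfc_congr fun x hx => (Real.mul_self_sqrt (hf x hx)).symm
  rw [hsq]
  exact posSemidef_transpose_mul_self _

theorem posSemidef_msqrt (A : Matrix ι ι ℝ) : (msqrt A).PosSemidef :=
  posSemidef_cfc fun x _ => Real.sqrt_nonneg x

theorem transpose_msqrt (A : Matrix ι ι ℝ) : (msqrt A)ᵀ = msqrt A := transpose_cfc _ _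

theorem msqrt_mul_msqrt (hA : A.PosSemidef) : msqrt A * msqrt A = A := by
  rw [msqrt, ← cfc_mul _ _ A (continuousOn_spectrum _ _) (continuousOn_spectrum _ _),
    cfc_congr (g := fun x => x) fun x hx =>
      Real.mul_self_sqrt (spectrum_nonneg_of_posSemidef hA hx)]
  exact cfc_id' ℝ A hA.isHermitian.isSelfAdjoint

theorem msqrt_mul_self (hB : B.PosSemidef) : msqrt (B * B) = B := by
  rw [← pow_two, msqrt, ← cfc_comp_pow Real.sqrt 2 B Real.continuous_sqrt.continuousOn
      hB.isHermitian.isSelfAdjoint,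
    cfc_congr (g := fun x => x) fun x hx => Real.sqrt_sq (spectrum_nonneg_of_posSemidef hB hx)]
  exact cfc_id' ℝ B hB.isHermitian.isSelfAdjoint

theorem posDef_msqrt (hA : A.PosDef) : (msqrt A).PosDef := by
  refine (posSemidef_msqrt A).posDef_iff_isUnit.mpr (isUnit_of_mul_isUnit_left (y := msqrt A) ?_)
  rw [msqrt_mul_msqrt hA.posSemidef]
  exact hA.isUnit

theorem four_mul_log_sq_le {x : ℝ} (hx : 0 < x) :
    4 * Real.log x ^ 2 ≤ x ^ 2 + (x ^ 2)⁻¹ - 2 := by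
  have hsinh : x - x⁻¹ = 2 * Real.sinh (Real.log x) := by
    rw [Real.sinh_eq, Real.exp_neg, Real.exp_log hx]
    ring
  have hlog : Real.log x ^ 2 ≤ Real.sinh (Real.log x) ^ 2 := by
    rw [sq_le_sq, Real.abs_sinh]
    exact Real.self_le_sinh_iff.mpr (abs_nonneg _)
  calc 4 * Real.log x ^ 2 ≤ (2 * Real.sinh (Real.log x)) ^ 2 := by linarith
    _ = x ^ 2 + (x ^ 2)⁻¹ - 2 := by
        rw [← hsinh]
        field_simp
        ring

theorem hsNormSq_mlog_msqrt_le (hA : A.PosDef) :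
    hsNormSq (mlog (msqrt A)) ≤ (A.trace + A⁻¹.trace - 2 * (1 : Matrix ι ι ℝ).trace) / 4 := by
  set M := msqrt A
  have hM : M.PosDef := posDef_msqrt hA
  have hM_sa : IsSelfAdjoint M := hM.isHermitian.isSelfAdjoint
  have hcont : ∀ f : ℝ → ℝ, ContinuousOn f (spectrum ℝ M) := fun f => continuousOn_spectrum f M
  have hA_eq : A = cfc (fun x : ℝ => x ^ 2) M := by
    rw [cfc_pow_id M 2, pow_two, msqrt_mul_msqrt hA.posSemidef]
  have hA_inv : A⁻¹ = cfc (fun x : ℝ => (x ^ 2)⁻¹) M := by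
    refine inv_eq_right_inv ?_
    rw [hA_eq, ← cfc_mul _ _ M (hcont _) (hcont _), cfc_congr (g := fun _ => 1) fun x hx =>
      mul_inv_cancel₀ (pow_pos (spectrum_pos_of_posDef hM hx) 2).ne']
    exact cfc_const_one ℝ M
  have hlog : (mlog M)ᵀ * mlog M = cfc (fun x => Real.log x * Real.log x) M := by
    rw [mlog, transpose_cfc, ← cfc_mul _ _ M (hcont _) (hcont _)]
  have hgap : (A + A⁻¹ - (2 : ℝ) • 1 - (4 : ℝ) • ((mlog M)ᵀ * mlog M)).PosSemidef := by
    have hcfc : A + A⁻¹ - (2 : ℝ) • (1 : Matrix ι ι ℝ) - (4 : ℝ) • ((mlog M)ᵀ * mlog M)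
        = cfc (fun x : ℝ => x ^ 2 + (x ^ 2)⁻¹ - 2 * 1 - 4 * (Real.log x * Real.log x)) M := by
      rw [cfc_sub _ _ M (hcont _) (hcont _), cfc_sub _ _ M (hcont _) (hcont _),
        cfc_add M _ _ (hcont _) (hcont _), ← hA_eq, ← hA_inv, hlog, cfc_const_mul _ _ M (hcont _),
        cfc_const_mul _ _ M (hcont _), cfc_const_one ℝ M]
    rw [hcfc]
    refine posSemidef_cfc fun x hx => ?_
    linarith [four_mul_log_sq_le (spectrum_pos_of_posDef hM hx)]
  have htrace := hgap.trace_nonneg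
  rw [trace_sub, trace_sub, trace_add, trace_smul, trace_smul, smul_eq_mul, smul_eq_mul,
    ← hsNormSq_eq_trace] at htrace
  linarith

end FunctionalCalculus

section PolarDecomposition

open Matrix

variable {ι : Type} [Fintype ι] [DecidableEq ι] {M Q H : Matrix ι ι ℝ}

theorem mabs_mul_mabs (M : Matrix ι ι ℝ) : mabs M * mabs M = Mᵀ * M :=
  msqrt_mul_msqrt (posSemidef_transpose_mul_self M)

theorem posDef_mabs (hM : IsUnit M) : (mabs M).PosDef :=
  posDef_msqrt <| (posSemidef_transpose_mul_self M).posDef_iff_isUnit.mpr <|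
    ((isUnit_transpose M).mpr hM).mul hM

theorem polarFactor_mul_mabs (hM : IsUnit M) : polarFactor M * mabs M = M := by
  rw [polarFactor, mul_assoc, nonsing_inv_mul _ ((isUnit_iff_isUnit_det _).mp
    (posDef_mabs hM).isUnit), mul_one]

theorem transpose_polarFactor_mul_self (hM : IsUnit M) :
    (polarFactor M)ᵀ * polarFactor M = 1 := by
  have hdet : IsUnit (mabs M).det := (isUnit_iff_isUnit_det _).mp (posDef_mabs hM).isUnit
  rw [polarFactor, transpose_mul, transpose_nonsing_inv,
    transpose_eq_of_posSemidef (posDef_mabs hM).posSemidef, mul_assoc, ← mul_assoc Mᵀ,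
    ← mabs_mul_mabs, mul_assoc (mabs M), mul_nonsing_inv _ hdet, mul_one,
    nonsing_inv_mul _ hdet]

theorem polarFactor_mul_eq (hQ : Qᵀ * Q = 1) (hH : H.PosDef) : polarFactor (Q * H) = Q := by
  have hmabs : mabs (Q * H) = H := by
    rw [mabs, transpose_mul, mul_assoc, ← mul_assoc Qᵀ, hQ, one_mul,
      transpose_eq_of_posSemidef hH.posSemidef, msqrt_mul_self hH.posSemidef]
  rw [polarFactor, hmabs, mul_assoc, mul_nonsing_inv _ ((isUnit_iff_isUnit_det _).mp hH.isUnit),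
    mul_one]

theorem polarFactor_mul_orthogonal (hM : IsUnit M) (hQ : Qᵀ * Q = 1) :
    polarFactor (M * Q) = polarFactor M * Q := by
  have hQ' : Q * Qᵀ = 1 := mul_eq_one_comm.mp hQ
  have hdecomp : M * Q = polarFactor M * Q * (Qᵀ * mabs M * Qᵀᵀ) := by
    have hassoc : polarFactor M * Q * (Qᵀ * mabs M * Q)
        = polarFactor M * (Q * Qᵀ) * mabs M * Q := by noncomm_ring
    rw [transpose_transpose, hassoc, hQ', mul_one, polarFactor_mul_mabs hM]
  have hconj : (Qᵀ * mabs M * Qᵀᵀ).PosDef :=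
    (posSemidef_mul_mul_transpose (posDef_mabs hM).posSemidef Qᵀ).posDef_iff_isUnit.mpr <|
      ((IsUnit.of_mul_eq_one _ hQ).mul (posDef_mabs hM).isUnit).mul (IsUnit.of_mul_eq_one _ (by
        rwa [transpose_transpose]))
  rw [hdecomp, polarFactor_mul_eq _ hconj]
  rw [transpose_mul, mul_assoc, ← mul_assoc _ (polarFactor M), transpose_polarFactor_mul_self hM,
    one_mul, hQ]

theorem inv_eq_inv_mabs_mul_transpose (hM : IsUnit M) :
    M⁻¹ = (mabs M)⁻¹ * (polarFactor M)ᵀ := by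
  nth_rewrite 1 [← polarFactor_mul_mabs hM]
  rw [Matrix.mul_inv_rev, inv_eq_left_inv (transpose_polarFactor_mul_self hM)]

theorem polarFactor_transpose_inv (hM : IsUnit M) : polarFactor M⁻¹ᵀ = polarFactor M := by
  rw [inv_eq_inv_mabs_mul_transpose hM, transpose_mul, transpose_transpose,
    transpose_eq_of_posSemidef (posDef_mabs hM).inv.posSemidef,
    polarFactor_mul_eq (transpose_polarFactor_mul_self hM) (posDef_mabs hM).inv]

theorem hsNormSq_polarFactor_sub_one_le (hM : IsUnit M) :
    hsNormSq (polarFactor M - 1) ≤ 4 * hsNormSq (M⁻¹ - 1) := by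
  rw [inv_eq_inv_mabs_mul_transpose hM]
  exact hsNormSq_orthogonal_sub_one_le (transpose_polarFactor_mul_self hM)
    (posDef_mabs hM).inv.posSemidef

end PolarDecomposition

section SymmetricBlocks

open Matrix

/-- The matrix which acts as `a` on the symmetric and as `c` on the antisymmetric vectors of two
copies of the index set. -/
noncomputable def symmBlock {ι : Type*} (a c : Matrix ι ι ℝ) : Matrix (ι ⊕ ι) (ι ⊕ ι) ℝ :=
  fromBlocks ((1 / 2 : ℝ) • (a + c)) ((1 / 2 : ℝ) • (a - c)) ((1 / 2 : ℝ) • (a - c))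
    ((1 / 2 : ℝ) • (a + c))

section

variable {ι : Type*}

theorem symmBlock_transpose (a c : Matrix ι ι ℝ) : (symmBlock a c)ᵀ = symmBlock aᵀ cᵀ := by
  simp only [symmBlock, fromBlocks_transpose, transpose_smul, transpose_add, transpose_sub]

theorem symmBlock_sub (a c a' c' : Matrix ι ι ℝ) :
    symmBlock a c - symmBlock a' c' = symmBlock (a - a') (c - c') := by
  simp only [symmBlock, sub_eq_add_neg, fromBlocks_neg, fromBlocks_add, ← smul_neg, ← smul_add]
  congr 2 <;> abel

theorem symmBlock_one [DecidableEq ι] : symmBlock (1 : Matrix ι ι ℝ) 1 = 1 := by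
  rw [symmBlock, ← fromBlocks_one, sub_self, smul_zero, ← two_smul ℝ (1 : Matrix ι ι ℝ),
    smul_smul, one_div, inv_mul_cancel₀ two_ne_zero, one_smul]

variable [Fintype ι]

theorem symmBlock_mul (a c a' c' : Matrix ι ι ℝ) :
    symmBlock a c * symmBlock a' c' = symmBlock (a * a') (c * c') := by
  simp only [symmBlock, fromBlocks_multiply, smul_mul_smul_comm, ← smul_add]
  congr 1 <;>
  · rw [← sub_eq_zero]
    simp only [add_mul, mul_add, sub_mul, mul_sub]
    module

theorem trace_symmBlock (a c : Matrix ι ι ℝ) : (symmBlock a c).trace = a.trace + c.trace := by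
  simp only [symmBlock, trace, Fintype.sum_sum_type, diag_apply, fromBlocks_apply₁₁,
    fromBlocks_apply₂₂, Matrix.smul_apply, Matrix.add_apply, smul_eq_mul,
    ← Finset.sum_add_distrib]
  exact Finset.sum_congr rfl fun i _ => by ring

theorem hsNormSq_symmBlock (a c : Matrix ι ι ℝ) :
    hsNormSq (symmBlock a c) = hsNormSq a + hsNormSq c := by
  simp only [hsNormSq_eq_trace, symmBlock_transpose, symmBlock_mul, trace_symmBlock]

theorem posSemidef_symmBlock {ι : Type*} [Finite ι] {a c : Matrix ι ι ℝ} (ha : a.PosSemidef)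
    (hc : c.PosSemidef) : (symmBlock a c).PosSemidef := by
  have := Fintype.ofFinite ι
  obtain ⟨a', rfl⟩ := exists_eq_transpose_mul_self ha
  obtain ⟨c', rfl⟩ := exists_eq_transpose_mul_self hc
  rw [← symmBlock_mul, ← symmBlock_transpose]
  exact posSemidef_transpose_mul_self _

variable [DecidableEq ι] {a c : Matrix ι ι ℝ}

theorem symmBlock_mul_inv (ha : IsUnit a) (hc : IsUnit c) :
    symmBlock a c * symmBlock a⁻¹ c⁻¹ = 1 := by
  rw [symmBlock_mul, mul_nonsing_inv _ ((isUnit_iff_isUnit_det _).mp ha),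
    mul_nonsing_inv _ ((isUnit_iff_isUnit_det _).mp hc), symmBlock_one]

theorem symmBlock_inv (ha : IsUnit a) (hc : IsUnit c) :
    (symmBlock a c)⁻¹ = symmBlock a⁻¹ c⁻¹ :=
  inv_eq_right_inv (symmBlock_mul_inv ha hc)

end

theorem posDef_symmBlock {ι : Type*} [Finite ι] {a c : Matrix ι ι ℝ} (ha : a.PosDef)
    (hc : c.PosDef) : (symmBlock a c).PosDef := by
  classical
  have := Fintype.ofFinite ι
  exact (posSemidef_symmBlock ha.posSemidef hc.posSemidef).posDef_iff_isUnit.mpr <|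
    IsUnit.of_mul_eq_one _ (symmBlock_mul_inv ha.isUnit hc.isUnit)

variable {ι : Type} [Fintype ι] [DecidableEq ι] {a c : Matrix ι ι ℝ}

theorem msqrt_symmBlock (ha : a.PosSemidef) (hc : c.PosSemidef) :
    msqrt (symmBlock a c) = symmBlock (msqrt a) (msqrt c) := by
  nth_rewrite 1 [← msqrt_mul_msqrt ha, ← msqrt_mul_msqrt hc]
  rw [← symmBlock_mul,
    msqrt_mul_self (posSemidef_symmBlock (posSemidef_msqrt a) (posSemidef_msqrt c))]

theorem polarFactor_symmBlock (ha : IsUnit a) (hc : IsUnit c) :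
    polarFactor (symmBlock a c) = symmBlock (polarFactor a) (polarFactor c) := by
  nth_rewrite 1 [← polarFactor_mul_mabs ha, ← polarFactor_mul_mabs hc]
  rw [← symmBlock_mul, polarFactor_mul_eq _ (posDef_symmBlock (posDef_mabs ha) (posDef_mabs hc))]
  rw [symmBlock_transpose, symmBlock_mul, transpose_polarFactor_mul_self ha,
    transpose_polarFactor_mul_self hc, symmBlock_one]

end SymmetricBlocks

/-! ### Bogoliubov maps and their orthogonal factors -/

section BogoliubovMap

open Matrix

theorem posSemidef_of_posSemidef_sub {ι : Type*} {A B : Matrix ι ι ℝ} (hA : A.PosSemidef)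
    (hBA : (B - A).PosSemidef) : B.PosSemidef := by
  simpa only [sub_add_cancel] using hBA.add hA

variable {ι : Type} [Fintype ι]

theorem hsNormSq_add_transpose (Z : Matrix ι ι ℝ) :
    hsNormSq (Z + Zᵀ) = 2 * hsNormSq Z + 2 * (Z * Z).trace := by
  have htrace : (Zᵀ * Zᵀ).trace = (Z * Z).trace := by rw [← transpose_mul, trace_transpose]
  rw [hsNormSq_eq_trace, hsNormSq_eq_trace, transpose_add, transpose_transpose, add_mul, mul_add,
    mul_add, trace_add, trace_add, trace_add, trace_mul_comm Z Zᵀ, htrace]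
  ring

/-- Both `Zᵀ Z` and `X = (1 + Z)ᵀ (1 + Z) - 1` have trace at most `tr X`, and `Z + Zᵀ` is their
difference. -/
theorem hsNormSq_le_of_posSemidef {X Z : Matrix ι ι ℝ} (hXZ : Z + Zᵀ = X - Zᵀ * Z)
    (hX : X.PosSemidef) (hZ : 0 ≤ Z.trace) (hZ_sq : 0 ≤ (Z * Z).trace) :
    hsNormSq Z ≤ 2 * X.trace ^ 2 := by
  have hZ_trace : hsNormSq Z ≤ X.trace := by
    have htrace := congrArg Matrix.trace hXZ
    rw [trace_add, trace_sub, trace_transpose, ← hsNormSq_eq_trace] at htrace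
    linarith
  have hgram_le : hsNormSq (Zᵀ * Z) ≤ X.trace ^ 2 :=
    (hsNormSq_le_trace_sq (posSemidef_transpose_mul_self Z)).trans <|
      pow_le_pow_left₀ (posSemidef_transpose_mul_self Z).trace_nonneg
        (hsNormSq_eq_trace Z ▸ hZ_trace) 2
  have hsub_le := hsNormSq_sub_le X (Zᵀ * Z)
  rw [← hXZ, hsNormSq_add_transpose] at hsub_le
  linarith [hsNormSq_le_trace_sq hX]

variable [DecidableEq ι]

theorem trace_inv_one_add_le {X : Matrix ι ι ℝ} (hX : X.PosSemidef) :
    ((1 + X)⁻¹).trace + X.trace - (1 : Matrix ι ι ℝ).trace ≤ X.trace ^ 2 := by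
  have hpos : (1 + X).PosDef := PosDef.one.add_posSemidef hX
  set G := (1 + X)⁻¹ with hG
  have hsub : 1 - G = G * X := by
    rw [sub_eq_iff_eq_add', ← mul_one_add, hG,
      nonsing_inv_mul _ ((isUnit_iff_isUnit_det _).mp hpos.isUnit)]
  have hsecond : G + X - 1 = G * (X * X) := by
    rw [← mul_assoc, ← hsub, sub_mul, one_mul, ← hsub]
    abel
  have hthird : X * X - G * (X * X) = G * (X * X * X) := by
    rw [mul_assoc X, ← mul_assoc G X (X * X), ← hsub, sub_mul, one_mul]
  have hcube : 0 ≤ (G * (X * X * X)).trace :=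
    trace_mul_nonneg_of_posSemidef hpos.inv.posSemidef
      (posSemidef_mul_mul_self hX (transpose_eq_of_posSemidef hX))
  have hsq : (X * X).trace ≤ X.trace ^ 2 := by
    simpa only [hsNormSq_eq_trace, transpose_eq_of_posSemidef hX] using hsNormSq_le_trace_sq hX
  rw [← hthird, trace_sub] at hcube
  rw [← trace_add, ← trace_sub, hsecond]
  linarith

theorem hsNormSq_mul_inv_sub_one_le {F S : Matrix ι ι ℝ} (hF : F.PosSemidef) (hS : S.PosDef)
    (hFS : (F - S).PosSemidef) (hFS_sq : (F * F - S * S).PosSemidef) :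
    hsNormSq (F * S⁻¹ - 1) ≤ 2 * (S⁻¹ * (F * F) * S⁻¹ - 1).trace ^ 2 := by
  set T := S⁻¹
  have hT_pos : T.PosSemidef := hS.inv.posSemidef
  have hT_symm : Tᵀ = T := transpose_eq_of_posSemidef hT_pos
  have hST : S * T = 1 := mul_nonsing_inv _ ((isUnit_iff_isUnit_det _).mp hS.isUnit)
  have hTS : T * S = 1 := mul_eq_one_comm.mp hST
  have hZ_eq : F * T - 1 = (F - S) * T := by rw [sub_mul, hST]
  refine hsNormSq_le_of_posSemidef ?_ ?_ ?_ ?_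
  · rw [transpose_sub, transpose_mul, hT_symm, transpose_eq_of_posSemidef hF, transpose_one]
    noncomm_ring
  · have hexpand : T * (F * F - S * S) * T = T * (F * F) * T - T * S * (S * T) := by
      noncomm_ring
    rw [hST, hTS, one_mul] at hexpand
    rw [← hexpand]
    exact posSemidef_mul_mul_self hFS_sq hT_symm
  · rw [hZ_eq]
    exact trace_mul_nonneg_of_posSemidef hFS hT_pos
  · rw [hZ_eq, ← mul_assoc]
    exact trace_mul_nonneg_of_posSemidef
      (posSemidef_mul_mul_self hT_pos (transpose_eq_of_posSemidef hFS)) hT_pos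

/-- The operator `(D^{1/2} B D^{1/2})^{1/2}`, whose eigenvalues are the excitation energies of the
quadratic Hamiltonian with position block `D` and momentum block `B`. -/
noncomputable def excitationEnergy (D B : Matrix ι ι ℝ) : Matrix ι ι ℝ :=
  msqrt (msqrt D * B * msqrt D)

/-- The map `D^{1/2} E^{-1/2}`, where `E` is the excitation energy, to normal coordinates of the
quadratic Hamiltonian with blocks `D` and `B`. -/
noncomputable def bogoliubovMap (D B : Matrix ι ι ℝ) : Matrix ι ι ℝ :=
  msqrt D * (msqrt (excitationEnergy D B))⁻¹

/-- The geometric mean `D^{-1/2} (D^{1/2} B D^{1/2})^{1/2} D^{-1/2}` of `D⁻¹` and `B`. -/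
noncomputable def invGeomMean (D B : Matrix ι ι ℝ) : Matrix ι ι ℝ :=
  (msqrt D)⁻¹ * excitationEnergy D B * (msqrt D)⁻¹

variable {D B : Matrix ι ι ℝ}

theorem msqrt_mul_inv_msqrt (hD : D.PosDef) : msqrt D * (msqrt D)⁻¹ = 1 :=
  mul_nonsing_inv _ ((isUnit_iff_isUnit_det _).mp (posDef_msqrt hD).isUnit)

theorem inv_msqrt_mul_msqrt (hD : D.PosDef) : (msqrt D)⁻¹ * msqrt D = 1 :=
  mul_eq_one_comm.mp (msqrt_mul_inv_msqrt hD)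

theorem transpose_inv_msqrt (D : Matrix ι ι ℝ) : (msqrt D)⁻¹ᵀ = (msqrt D)⁻¹ := by
  rw [transpose_nonsing_inv, transpose_msqrt]

theorem inv_msqrt_mul_mul_inv_msqrt (hD : D.PosDef) : (msqrt D)⁻¹ * D * (msqrt D)⁻¹ = 1 := by
  nth_rewrite 2 [← msqrt_mul_msqrt hD.posSemidef]
  rw [← mul_assoc, inv_msqrt_mul_msqrt hD, one_mul, msqrt_mul_inv_msqrt hD]

theorem excitationEnergy_mul_self (D : Matrix ι ι ℝ) (hB : B.PosSemidef) :
    excitationEnergy D B * excitationEnergy D B = msqrt D * B * msqrt D :=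
  msqrt_mul_msqrt (posSemidef_mul_mul_self hB (transpose_msqrt D))

theorem posDef_excitationEnergy (hD : D.PosDef) (hB : B.PosDef) :
    (excitationEnergy D B).PosDef :=
  posDef_msqrt <| (posSemidef_mul_mul_self hB.posSemidef (transpose_msqrt D)).posDef_iff_isUnit.mpr
    (((posDef_msqrt hD).isUnit.mul hB.isUnit).mul (posDef_msqrt hD).isUnit)

theorem posSemidef_excitationEnergy_sub (hD : D.PosDef) (hDB : (B - D).PosSemidef) :
    (excitationEnergy D B - D).PosSemidef := by
  refine posSemidef_sub_of_posSemidef_mul_self_sub (posSemidef_msqrt _) hD ?_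
  have hgap : excitationEnergy D B * excitationEnergy D B - D * D
      = msqrt D * (B - D) * msqrt D := by
    have hD_sq : D * D = msqrt D * D * msqrt D := by
      calc D * D = msqrt D * msqrt D * (msqrt D * msqrt D) := by rw [msqrt_mul_msqrt hD.posSemidef]
        _ = msqrt D * (msqrt D * msqrt D) * msqrt D := by noncomm_ring
        _ = msqrt D * D * msqrt D := by rw [msqrt_mul_msqrt hD.posSemidef]
    rw [excitationEnergy_mul_self D (posSemidef_of_posSemidef_sub hD.posSemidef hDB), hD_sq,
      mul_sub, sub_mul]
  rw [hgap]
  exact posSemidef_mul_mul_self hDB (transpose_msqrt D)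

theorem posSemidef_invGeomMean_sub_one (hD : D.PosDef) (hDB : (B - D).PosSemidef) :
    (invGeomMean D B - 1).PosSemidef := by
  rw [← inv_msqrt_mul_mul_inv_msqrt hD, invGeomMean, ← sub_mul, ← mul_sub]
  exact posSemidef_mul_mul_self (posSemidef_excitationEnergy_sub hD hDB) (transpose_inv_msqrt D)

/-- Twice the trace on the left is at most the trace on the right, because the Hilbert-Schmidt
distance between `E D⁻¹` and `1` is nonnegative. -/
theorem trace_invGeomMean_sub_one_le (hD : D.PosDef) (hB : B.PosSemidef) :
    (invGeomMean D B - 1).trace ≤ (D⁻¹ * (B - D)).trace / 2 := by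
  set E := excitationEnergy D B with hE
  set S := msqrt D
  set T := (msqrt D)⁻¹
  have hST : S * T = 1 := msqrt_mul_inv_msqrt hD
  have hTS : T * S = 1 := inv_msqrt_mul_msqrt hD
  have hD_inv : D⁻¹ = T * T := by rw [← Matrix.mul_inv_rev, msqrt_mul_msqrt hD.posSemidef]
  have hgram : (E * (T * T))ᵀ * (E * (T * T)) = T * B * T := by
    have hE_symm : Eᵀ = E := transpose_msqrt _
    have hT_symm : Tᵀ = T := transpose_inv_msqrt D
    rw [transpose_mul, transpose_mul, hE_symm, hT_symm, ← mul_assoc, mul_assoc (T * T), hE,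
      excitationEnergy_mul_self D hB]
    have hexpand : T * T * (S * B * S) * (T * T) = T * (T * S) * B * (S * T) * T := by noncomm_ring
    rw [hexpand, hTS, hST, mul_one, mul_one]
  have htrace : (E * (T * T)).trace = (invGeomMean D B).trace := by
    rw [invGeomMean, ← mul_assoc, trace_mul_comm, ← mul_assoc]
  have hcoupling : (D⁻¹ * (B - D)).trace = (T * B * T).trace - (1 : Matrix ι ι ℝ).trace := by
    rw [← inv_msqrt_mul_mul_inv_msqrt hD, ← trace_sub, ← sub_mul, ← mul_sub, hD_inv, mul_assoc,
      trace_mul_comm]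
  have hdist := hsNormSq_nonneg (E * (T * T) - 1)
  rw [hsNormSq_sub_one, hsNormSq_eq_trace, hgram, htrace] at hdist
  rw [hcoupling, trace_sub]
  linarith

theorem trace_invGeomMean_sub_one_sq_le (hD : D.PosDef) (hDB : (B - D).PosSemidef) :
    (invGeomMean D B - 1).trace ^ 2 ≤ (D⁻¹ * (B - D)).trace ^ 2 / 4 := by
  have hle := trace_invGeomMean_sub_one_le hD (posSemidef_of_posSemidef_sub hD.posSemidef hDB)
  have hsq := pow_le_pow_left₀ (posSemidef_invGeomMean_sub_one hD hDB).trace_nonneg hle 2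
  linarith

theorem isUnit_bogoliubovMap (hD : D.PosDef) (hB : B.PosDef) : IsUnit (bogoliubovMap D B) :=
  (posDef_msqrt hD).isUnit.mul (posDef_msqrt (posDef_excitationEnergy hD hB)).inv.isUnit

theorem inv_bogoliubovMap (hD : D.PosDef) (hB : B.PosDef) :
    (bogoliubovMap D B)⁻¹ = msqrt (excitationEnergy D B) * (msqrt D)⁻¹ := by
  rw [bogoliubovMap, Matrix.mul_inv_rev, nonsing_inv_nonsing_inv _ ((isUnit_iff_isUnit_det _).mp
    (posDef_msqrt (posDef_excitationEnergy hD hB)).isUnit)]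

theorem bogoliubovMap_mul_transpose (hD : D.PosDef) :
    bogoliubovMap D B * (bogoliubovMap D B)ᵀ = (invGeomMean D B)⁻¹ := by
  have hE : (excitationEnergy D B)⁻¹
      = (msqrt (excitationEnergy D B))⁻¹ * (msqrt (excitationEnergy D B))⁻¹ := by
    rw [← Matrix.mul_inv_rev, msqrt_mul_msqrt (A := excitationEnergy D B) (posSemidef_msqrt _)]
  rw [bogoliubovMap, invGeomMean, transpose_mul, transpose_msqrt, transpose_inv_msqrt,
    Matrix.mul_inv_rev, Matrix.mul_inv_rev, nonsing_inv_nonsing_inv _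
      ((isUnit_iff_isUnit_det _).mp (posDef_msqrt hD).isUnit), hE]
  simp only [mul_assoc]

theorem hsNormSq_polarFactor_bogoliubovMap_sub_one_le (hD : D.PosDef) (hB : B.PosDef)
    (hDB : (B - D).PosSemidef) :
    hsNormSq (polarFactor (bogoliubovMap D B) - 1) ≤ 2 * (D⁻¹ * (B - D)).trace ^ 2 := by
  set E := excitationEnergy D B
  have hE_sq : msqrt E * msqrt E = E := msqrt_mul_msqrt (posSemidef_msqrt _)
  have hsq_gap : (msqrt E * msqrt E - msqrt D * msqrt D).PosSemidef := by
    rw [hE_sq, msqrt_mul_msqrt hD.posSemidef]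
    exact posSemidef_excitationEnergy_sub hD hDB
  have hinv : hsNormSq ((bogoliubovMap D B)⁻¹ - 1) ≤ 2 * (invGeomMean D B - 1).trace ^ 2 := by
    have hgap := posSemidef_sub_of_posSemidef_mul_self_sub (posSemidef_msqrt E) (posDef_msqrt hD)
      hsq_gap
    rw [inv_bogoliubovMap hD hB, invGeomMean]
    simpa only [hE_sq] using
      hsNormSq_mul_inv_sub_one_le (posSemidef_msqrt E) (posDef_msqrt hD) hgap hsq_gap
  linarith [hsNormSq_polarFactor_sub_one_le (isUnit_bogoliubovMap hD hB),
    trace_invGeomMean_sub_one_sq_le hD hDB]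

end BogoliubovMap

section SymmetricHamiltonian

open Matrix

variable {ι : Type} [Fintype ι] [DecidableEq ι] {D B : Matrix ι ι ℝ}

theorem mabs_msqrt_mul_msqrt (D : Matrix ι ι ℝ) (hB : B.PosSemidef) :
    mabs (msqrt B * msqrt D) = excitationEnergy D B := by
  rw [mabs, excitationEnergy, transpose_mul, transpose_msqrt, transpose_msqrt, mul_assoc,
    ← mul_assoc (msqrt B), msqrt_mul_msqrt hB, mul_assoc]

theorem isUnit_msqrt_mul_msqrt (hD : D.PosDef) (hB : B.PosDef) :
    IsUnit (msqrt B * msqrt D) :=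
  (posDef_msqrt hB).isUnit.mul (posDef_msqrt hD).isUnit

theorem msqrt_mul_polarFactor (hD : D.PosDef) (hB : B.PosDef) :
    msqrt B * polarFactor (msqrt B * msqrt D) = (msqrt D)⁻¹ * excitationEnergy D B := by
  set A := polarFactor (msqrt B * msqrt D)
  set E := excitationEnergy D B
  have hpolar : A * E = msqrt B * msqrt D := by
    simpa only [mabs_msqrt_mul_msqrt D hB.posSemidef] using
      polarFactor_mul_mabs (isUnit_msqrt_mul_msqrt hD hB)
  have hE_symm : Eᵀ = E := transpose_msqrt _
  have hpolar_transpose : E * Aᵀ = msqrt D * msqrt B := by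
    simpa only [transpose_mul, hE_symm, transpose_msqrt] using congrArg transpose hpolar
  calc msqrt B * A = (msqrt D)⁻¹ * (msqrt D * msqrt B) * A := by
        rw [← mul_assoc, inv_msqrt_mul_msqrt hD, one_mul]
    _ = (msqrt D)⁻¹ * E := by
        rw [← hpolar_transpose, mul_assoc, mul_assoc E,
          transpose_polarFactor_mul_self (isUnit_msqrt_mul_msqrt hD hB), mul_one]

theorem msqrt_orthogonal_conj {A H : Matrix ι ι ℝ} (hA : Aᵀ * A = 1) (hH : H.PosSemidef) :
    msqrt (A * H * Aᵀ) = A * msqrt H * Aᵀ := by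
  have hsq : A * msqrt H * Aᵀ * (A * msqrt H * Aᵀ) = A * H * Aᵀ := by
    have hassoc : A * msqrt H * Aᵀ * (A * msqrt H * Aᵀ)
        = A * msqrt H * (Aᵀ * A) * msqrt H * Aᵀ := by noncomm_ring
    rw [hassoc, hA, mul_one, mul_assoc A, msqrt_mul_msqrt hH]
  rw [← hsq, msqrt_mul_self (posSemidef_mul_mul_transpose (posSemidef_msqrt H) A)]

theorem excitationEnergy_swap (hD : D.PosDef) (hB : B.PosDef) :
    excitationEnergy B D = polarFactor (msqrt B * msqrt D) * excitationEnergy D B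
      * (polarFactor (msqrt B * msqrt D))ᵀ := by
  set A := polarFactor (msqrt B * msqrt D)
  set E := excitationEnergy D B
  have hA : Aᵀ * A = 1 := transpose_polarFactor_mul_self (isUnit_msqrt_mul_msqrt hD hB)
  have hpolar : A * E = msqrt B * msqrt D := by
    simpa only [mabs_msqrt_mul_msqrt D hB.posSemidef] using
      polarFactor_mul_mabs (isUnit_msqrt_mul_msqrt hD hB)
  have hgram : msqrt B * D * msqrt B = A * (E * E) * Aᵀ := by
    have hE_symm : Eᵀ = E := transpose_msqrt _
    calc msqrt B * D * msqrt B = msqrt B * msqrt D * (msqrt B * msqrt D)ᵀ := by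
          rw [transpose_mul, transpose_msqrt, transpose_msqrt, mul_assoc (msqrt B) (msqrt D),
            ← mul_assoc (msqrt D), msqrt_mul_msqrt hD.posSemidef, mul_assoc]
      _ = A * (E * E) * Aᵀ := by
          rw [← hpolar, transpose_mul, hE_symm]
          simp only [mul_assoc]
  have hE_pos : E.PosSemidef := posSemidef_msqrt _
  rw [excitationEnergy, hgram, msqrt_orthogonal_conj hA
    (by simpa only [hE_pos.isHermitian.eq] using posSemidef_conjTranspose_mul_self E),
    msqrt_mul_self hE_pos]

/-- Exchanging the two blocks inverts and transposes the normal coordinates, up to the rotation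
which diagonalizes the exchanged problem in the original coordinates. -/
theorem bogoliubovMap_swap (hD : D.PosDef) (hB : B.PosDef) :
    bogoliubovMap B D = (bogoliubovMap D B)⁻¹ᵀ * (polarFactor (msqrt B * msqrt D))ᵀ := by
  set A := polarFactor (msqrt B * msqrt D)
  set E := excitationEnergy D B with hE
  have hE_pos : E.PosDef := posDef_excitationEnergy hD hB
  have hA : Aᵀ * A = 1 := transpose_polarFactor_mul_self (isUnit_msqrt_mul_msqrt hD hB)
  have hinv : (A * msqrt E * Aᵀ)⁻¹ = A * (msqrt E)⁻¹ * Aᵀ := by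
    refine inv_eq_right_inv ?_
    have hassoc : A * msqrt E * Aᵀ * (A * (msqrt E)⁻¹ * Aᵀ)
        = A * msqrt E * (Aᵀ * A) * (msqrt E)⁻¹ * Aᵀ := by noncomm_ring
    rw [hassoc, hA, mul_one, mul_assoc A, msqrt_mul_inv_msqrt hE_pos, mul_one,
      mul_eq_one_comm.mp hA]
  rw [bogoliubovMap, excitationEnergy_swap hD hB, msqrt_orthogonal_conj hA hE_pos.posSemidef, hinv,
    inv_bogoliubovMap hD hB, transpose_mul, transpose_inv_msqrt, transpose_msqrt, ← mul_assoc,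
    ← mul_assoc, msqrt_mul_polarFactor hD hB, ← hE]
  nth_rewrite 1 [← msqrt_mul_msqrt hE_pos.posSemidef]
  rw [← mul_assoc, mul_assoc _ (msqrt E) (msqrt E)⁻¹, msqrt_mul_inv_msqrt hE_pos, mul_one]

theorem excitationEnergy_symmBlock (hD : D.PosSemidef) (hB : B.PosSemidef) :
    excitationEnergy (symmBlock D B) (symmBlock B D)
      = symmBlock (excitationEnergy D B) (excitationEnergy B D) := by
  rw [excitationEnergy, msqrt_symmBlock hD hB, symmBlock_mul, symmBlock_mul, msqrt_symmBlock
    (posSemidef_mul_mul_self hB (transpose_msqrt D))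
    (posSemidef_mul_mul_self hD (transpose_msqrt B))]
  rfl

theorem bogoliubovMap_symmBlock (hD : D.PosDef) (hB : B.PosDef) :
    bogoliubovMap (symmBlock D B) (symmBlock B D)
      = symmBlock (bogoliubovMap D B) (bogoliubovMap B D) := by
  rw [bogoliubovMap, excitationEnergy_symmBlock hD.posSemidef hB.posSemidef,
    msqrt_symmBlock hD.posSemidef hB.posSemidef,
    msqrt_symmBlock (a := excitationEnergy D B) (c := excitationEnergy B D)
      (posSemidef_msqrt _) (posSemidef_msqrt _),
    symmBlock_inv (posDef_msqrt (posDef_excitationEnergy hD hB)).isUnit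
      (posDef_msqrt (posDef_excitationEnergy hB hD)).isUnit, symmBlock_mul]
  rfl

theorem polarFactor_bogoliubovMap_symmBlock_mul (hD : D.PosDef) (hB : B.PosDef) :
    polarFactor (bogoliubovMap (symmBlock D B) (symmBlock B D))
        * symmBlock 1 (polarFactor (msqrt B * msqrt D))
      = symmBlock (polarFactor (bogoliubovMap D B)) (polarFactor (bogoliubovMap D B)) := by
  set A := polarFactor (msqrt B * msqrt D)
  set M := bogoliubovMap D B
  have hA : Aᵀ * A = 1 := transpose_polarFactor_mul_self (isUnit_msqrt_mul_msqrt hD hB)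
  have hM : IsUnit M := isUnit_bogoliubovMap hD hB
  have hM_inv : IsUnit M⁻¹ᵀ := (isUnit_transpose _).mpr (isUnit_nonsing_inv_iff.mpr hM)
  rw [bogoliubovMap_symmBlock hD hB,
    polarFactor_symmBlock hM (isUnit_bogoliubovMap hB hD), bogoliubovMap_swap hD hB,
    polarFactor_mul_orthogonal hM_inv (by rw [transpose_transpose, mul_eq_one_comm.mp hA]),
    polarFactor_transpose_inv hM, symmBlock_mul, mul_one, mul_assoc, hA, mul_one]

theorem hsNormSq_mlog_bogoliubovMap_symmBlock_le (hD : D.PosDef) (hB : B.PosDef)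
    (hDB : (B - D).PosSemidef) :
    hsNormSq (mlog (mabs (bogoliubovMap (symmBlock D B) (symmBlock B D))ᵀ))
      ≤ (D⁻¹ * (B - D)).trace ^ 2 / 8 := by
  set M := bogoliubovMap D B
  set A := polarFactor (msqrt B * msqrt D)
  set G := invGeomMean D B
  have hA : Aᵀ * A = 1 := transpose_polarFactor_mul_self (isUnit_msqrt_mul_msqrt hD hB)
  have hX : (G - 1).PosSemidef := posSemidef_invGeomMean_sub_one hD hDB
  have hG_eq : 1 + (G - 1) = G := add_sub_cancel 1 G
  have hG : G.PosDef := hG_eq ▸ PosDef.one.add_posSemidef hX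
  have hM_gram : M * Mᵀ = G⁻¹ := bogoliubovMap_mul_transpose hD
  have hM_inv_gram : M⁻¹ᵀ * Aᵀ * (M⁻¹ᵀ * Aᵀ)ᵀ = G := by
    rw [transpose_mul, transpose_transpose, transpose_transpose, mul_assoc, ← mul_assoc Aᵀ, hA,
      one_mul, transpose_nonsing_inv, ← Matrix.mul_inv_rev, hM_gram,
      nonsing_inv_nonsing_inv _ ((isUnit_iff_isUnit_det _).mp hG.isUnit)]
  have hgram : bogoliubovMap (symmBlock D B) (symmBlock B D)
      * (bogoliubovMap (symmBlock D B) (symmBlock B D))ᵀ = symmBlock G⁻¹ G := by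
    rw [bogoliubovMap_symmBlock hD hB, symmBlock_transpose, symmBlock_mul, hM_gram,
      bogoliubovMap_swap hD hB, hM_inv_gram]
  have hinv : (symmBlock G⁻¹ G)⁻¹ = symmBlock G G⁻¹ := by
    rw [symmBlock_inv hG.inv.isUnit hG.isUnit,
      nonsing_inv_nonsing_inv _ ((isUnit_iff_isUnit_det _).mp hG.isUnit)]
  have htrace := (trace_inv_one_add_le hX).trans (trace_invGeomMean_sub_one_sq_le hD hDB)
  rw [hG_eq, trace_sub] at htrace
  rw [mabs, transpose_transpose, hgram]
  refine (hsNormSq_mlog_msqrt_le (posDef_symmBlock hG.inv hG)).trans ?_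
  rw [hinv, trace_symmBlock, trace_symmBlock, ← symmBlock_one, trace_symmBlock]
  linarith

end SymmetricHamiltonian

section OrthogonalLogarithm

theorem star_branchLog {t : ℝ} {z : ℂ} (hz : ‖z‖ = 1) :
    star (branchLog t z) = -branchLog t z := by
  have hnorm : ‖z * Complex.exp ((Real.pi - t : ℝ) * Complex.I)‖ = 1 := by
    rw [norm_mul, hz, Complex.norm_exp_ofReal_mul_I, one_mul]
  have hre : (branchLog t z).re = 0 := by
    simp only [branchLog, Complex.sub_re, Complex.log_re, hnorm, Real.log_one,
      Complex.re_ofReal_mul, Complex.I_re, mul_zero, sub_zero]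
  refine Complex.ext ?_ rfl
  rw [Complex.star_def, Complex.conj_re, Complex.neg_re, hre, neg_zero]

theorem log_exp_pi_sub_mul_I {t : ℝ} (ht_pos : 0 < t) (ht_lt : t < 2 * Real.pi) :
    Complex.log (Complex.exp ((Real.pi - t : ℝ) * Complex.I)) = (Real.pi - t : ℝ) * Complex.I := by
  refine Complex.log_exp ?_ ?_ <;> rw [Complex.im_ofReal_mul, Complex.I_im] <;> linarith

theorem branchLog_one {t : ℝ} (ht_pos : 0 < t) (ht_lt : t < 2 * Real.pi) : branchLog t 1 = 0 := by
  rw [branchLog, one_mul, log_exp_pi_sub_mul_I ht_pos ht_lt, sub_self]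

theorem differentiableAt_branchLog_one {t : ℝ} (ht_pos : 0 < t) (ht_lt : t < 2 * Real.pi) :
    DifferentiableAt ℂ (branchLog t) 1 := by
  have hslit : 1 * Complex.exp ((Real.pi - t : ℝ) * Complex.I) ∈ Complex.slitPlane := by
    rw [one_mul, Complex.mem_slitPlane_iff_arg, ← Complex.log_im,
      log_exp_pi_sub_mul_I ht_pos ht_lt, Complex.im_ofReal_mul, Complex.I_im, mul_one]
    exact ⟨by linarith, Complex.exp_ne_zero _⟩
  have hmul : DifferentiableAt ℂ
      (fun z : ℂ => z * Complex.exp ((Real.pi - t : ℝ) * Complex.I)) 1 :=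
    differentiableAt_fun_id.mul_const _
  exact (hmul.clog hslit).sub_const _

theorem norm_branchLog_le_two_pi {t : ℝ} (ht_pos : 0 < t) (ht_lt : t < 2 * Real.pi) {z : ℂ}
    (hz : ‖z‖ = 1) : ‖branchLog t z‖ ≤ 2 * Real.pi := by
  set w := z * Complex.exp ((Real.pi - t : ℝ) * Complex.I)
  have hnorm : ‖w‖ = 1 := by
    rw [norm_mul, hz, Complex.norm_exp_ofReal_mul_I, one_mul]
  have hlog : branchLog t z = ((Complex.arg w - (Real.pi - t) : ℝ) : ℂ) * Complex.I := by
    change Complex.log w - _ = _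
    rw [Complex.log, hnorm, Real.log_one, Complex.ofReal_zero, zero_add, ← sub_mul,
      ← Complex.ofReal_sub]
  rw [hlog, norm_mul, Complex.norm_I, mul_one, Complex.norm_real, Real.norm_eq_abs, abs_le]
  constructor <;> linarith [Complex.neg_pi_lt_arg w, Complex.arg_le_pi w, Real.pi_pos]

/-- Near `1` the bound is differentiability at `1`; away from `1` it is boundedness. -/
theorem exists_norm_branchLog_le {t : ℝ} (ht_pos : 0 < t) (ht_lt : t < 2 * Real.pi) :
    ∃ C : ℝ, 0 < C ∧ ∀ z : ℂ, ‖z‖ = 1 → ‖branchLog t z‖ ≤ C * ‖z - 1‖ := by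
  obtain ⟨c, hc⟩ := (differentiableAt_branchLog_one ht_pos ht_lt).isBigO_sub.bound
  obtain ⟨ε, hε, hc⟩ := Metric.eventually_nhds_iff.mp hc
  have hpi : 0 < 2 * Real.pi / ε := by positivity
  refine ⟨max c (2 * Real.pi / ε), lt_max_of_lt_right hpi, fun z hz => ?_⟩
  rcases lt_or_ge (dist z 1) ε with hnear | hfar
  · have hle := hc hnear
    rw [branchLog_one ht_pos ht_lt, sub_zero] at hle
    exact hle.trans (mul_le_mul_of_nonneg_right (le_max_left _ _) (norm_nonneg _))
  · calc ‖branchLog t z‖ ≤ 2 * Real.pi := norm_branchLog_le_two_pi ht_pos ht_lt hz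
      _ = 2 * Real.pi / ε * ε := (div_mul_cancel₀ _ hε.ne').symm
      _ ≤ max c (2 * Real.pi / ε) * ‖z - 1‖ :=
          mul_le_mul (le_max_right _ _) (dist_eq_norm z 1 ▸ hfar) hε.le
            (hpi.le.trans (le_max_right _ _))

open Matrix
open scoped Matrix.Norms.L2Operator

variable {ι : Type} [Fintype ι] [DecidableEq ι]

theorem hsNormSq_cfc_le {q : Matrix ι ι ℂ} {f g : ℂ → ℂ} {c : ℝ}
    [IsStarNormal q] (hfg : ∀ z ∈ spectrum ℂ q, ‖f z‖ ^ 2 ≤ c * ‖g z‖ ^ 2) :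
    hsNormSq (cfc f q) ≤ c * hsNormSq (cfc g q) := by
  have hcont : ∀ h : ℂ → ℂ, ContinuousOn h (spectrum ℂ q) := fun h =>
    q.finite_spectrum.continuousOn h
  set r : ℂ → ℂ := fun z => ((√(c * ‖g z‖ ^ 2 - ‖f z‖ ^ 2) : ℝ) : ℂ)
  have hgram : (cfc r q)ᴴ * cfc r q
      = (c : ℂ) • ((cfc g q)ᴴ * cfc g q) - (cfc f q)ᴴ * cfc f q := by
    simp only [← star_eq_conjTranspose]
    rw [← cfc_star, ← cfc_star, ← cfc_star, ← cfc_mul _ _ q (hcont _) (hcont _),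
      ← cfc_mul _ _ q (hcont _) (hcont _), ← cfc_mul _ _ q (hcont _) (hcont _),
      ← cfc_const_mul _ _ q (hcont _), ← cfc_sub _ _ q (hcont _) (hcont _)]
    refine cfc_congr fun z hz => ?_
    have hsq : (√(c * ‖g z‖ ^ 2 - ‖f z‖ ^ 2)) ^ 2 = c * ‖g z‖ ^ 2 - ‖f z‖ ^ 2 :=
      Real.sq_sqrt (sub_nonneg.mpr (hfg z hz))
    simp only [r, RCLike.star_def, RCLike.conj_mul, Complex.norm_real, Real.norm_eq_abs]
    rw [abs_of_nonneg (Real.sqrt_nonneg _)]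
    exact (Complex.ofReal_pow _ _).symm.trans <|
      (congrArg Complex.ofReal hsq).trans (by push_cast; rfl)
  have htrace := congrArg Matrix.trace hgram
  rw [trace_sub, trace_smul, trace_conjTranspose_mul_self, trace_conjTranspose_mul_self,
    trace_conjTranspose_mul_self, smul_eq_mul] at htrace
  have htrace_real : hsNormSq (cfc r q) = c * hsNormSq (cfc g q) - hsNormSq (cfc f q) := by
    exact Complex.ofReal_injective (htrace.trans (by push_cast; rfl))
  linarith [hsNormSq_nonneg (cfc r q)]

variable {Q : Matrix ι ι ℝ}

theorem map_ofReal_mem_unitary (hQ : Qᵀ * Q = 1) :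
    Q.map (fun x => (x : ℂ)) ∈ unitary (Matrix ι ι ℂ) := by
  have hstar : (Q.map fun x => (x : ℂ))ᴴ = Qᵀ.map Complex.ofRealHom := by
    ext i j
    exact Complex.conj_ofReal _
  have hmul : (Q.map fun x => (x : ℂ))ᴴ * (Q.map fun x => (x : ℂ)) = 1 := by
    rw [hstar]
    exact (Matrix.map_mul (f := Complex.ofRealHom)).symm.trans (by
      rw [hQ, Matrix.map_one _ (map_zero _) (map_one _)])
  exact Unitary.mem_iff.mpr ⟨hmul, mul_eq_one_comm.mp hmul⟩

theorem norm_eq_one_of_mem_spectrum_map_ofReal (hQ : Qᵀ * Q = 1) {z : ℂ}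
    (hz : z ∈ spectrum ℂ (Q.map fun x => (x : ℂ))) : ‖z‖ = 1 :=
  mem_sphere_zero_iff_norm.mp (spectrum.subset_circle_of_unitary (map_ofReal_mem_unitary hQ) hz)

theorem conjTranspose_orthLog (t : ℝ) (hQ : Qᵀ * Q = 1) : (orthLog t Q)ᴴ = -orthLog t Q := by
  rw [← star_eq_conjTranspose, orthLog, ← cfc_star, ← cfc_neg]
  exact cfc_congr fun z hz => star_branchLog (norm_eq_one_of_mem_spectrum_map_ofReal hQ hz)

theorem hsNormSq_orthLog_le {t C : ℝ}
    (hC : ∀ z : ℂ, ‖z‖ = 1 → ‖branchLog t z‖ ≤ C * ‖z - 1‖) (hQ : Qᵀ * Q = 1) :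
    hsNormSq (orthLog t Q) ≤ C ^ 2 * hsNormSq (Q - 1) := by
  set q : Matrix ι ι ℂ := Q.map fun x => (x : ℂ)
  have : IsStarNormal q := isStarNormal_of_mem_unitary (map_ofReal_mem_unitary hQ)
  have hsub_one : cfc (fun z : ℂ => z - 1) q = (Q - 1).map fun x => (x : ℂ) := by
    rw [cfc_sub _ _ q, cfc_id' ℂ q, cfc_const_one ℂ q, Matrix.map_sub _ Complex.ofReal_sub,
      Matrix.map_one _ Complex.ofReal_zero Complex.ofReal_one]
  rw [← hsNormSq_map_ofReal, ← hsub_one]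
  refine hsNormSq_cfc_le fun z hz => ?_
  rw [← mul_pow]
  exact pow_le_pow_left₀ (norm_nonneg _)
    (hC z (norm_eq_one_of_mem_spectrum_map_ofReal hQ hz)) 2

end OrthogonalLogarithm

/-! ### Bounds on the kernels -/

namespace PatchDecomposition

open Matrix

variable {kF R C₀ : ℝ} {n : ℕ} (P : PatchDecomposition kF R C₀ n)

section Reflection

theorem mem_cap_not (α : Fin n × Bool) (x : E3) : x ∈ P.cap (α.1, !α.2) ↔ -x ∈ P.cap α := by
  rcases α with ⟨i, _ | _⟩
  · rw [P.cap_mirror, neg_neg, Bool.not_false]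
  · exact P.cap_mirror i x

theorem mem_patch_not (α : Fin n × Bool) (x : E3) :
    x ∈ P.patch (α.1, !α.2) ↔ -x ∈ P.patch α := by
  simp only [patch, shell, Set.mem_ofPred_eq, norm_neg, P.mem_cap_not, smul_neg]

theorem mem_pairs_not (α : Fin n × Bool) (k p : Mom) :
    p ∈ P.pairs (α.1, !α.2) (-k) ↔ -p ∈ P.pairs α k := by
  have hhole : -toE3 (p - -k) = toE3 (-p - k) := by
    rw [← toE3_neg, sub_neg_eq_add, neg_add']
  simp only [mem_pairs, mem_patch_not, mem_fermiBall, ← hhole, toE3_neg, norm_neg]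

theorem nrm_not (α : Fin n × Bool) (k : Mom) : P.nrm (α.1, !α.2) (-k) = P.nrm α k := by
  rw [nrm, nrm, Finset.card_nbij' Neg.neg Neg.neg (fun p hp => (P.mem_pairs_not α k p).mp hp)
    (fun p hp => (P.mem_pairs_not α k (-p)).mpr ((neg_neg p).symm ▸ hp))
    (fun p _ => neg_neg p) (fun p _ => neg_neg p)]

theorem cosAngle_not (α : Fin n × Bool) (k : Mom) :
    P.cosAngle k (α.1, !α.2) = P.cosAngle k α := by
  rw [cosAngle, P.center_not, inner_neg_right, abs_neg, cosAngle]

end Reflection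

section Coupling

theorem kappa_pos (hkF : 0 < kF) : 0 < kappa kF := div_pos hkF (numN_rpow_pos hkF _)

theorem hbar_mul_kappa_mul_numN (hkF : 0 < kF) :
    hbar kF * kappa kF * numN kF = kF * (numN kF : ℝ) ^ (1 / 3 : ℝ) := by
  have hN : (0 : ℝ) < numN kF := Nat.cast_pos.mpr (numN_pos hkF)
  have hroot := (numN_rpow_pos hkF (1 / 3)).ne'
  have hN_eq : (numN kF : ℝ) = ((numN kF : ℝ) ^ (1 / 3 : ℝ)) ^ 3 := by
    rw [← Real.rpow_natCast, ← Real.rpow_mul hN.le]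
    norm_num
  have hhbar : hbar kF = ((numN kF : ℝ) ^ (1 / 3 : ℝ))⁻¹ := by
    rw [hbar, ← Real.rpow_neg hN.le]
  rw [hhbar, kappa]
  nth_rewrite 3 [hN_eq]
  field_simp [hroot]

theorem coupling_eq (hkF : 0 < kF) (V : ℝ) {x : ℝ} (hx : 0 < x) :
    V / (2 * hbar kF * kappa kF * numN kF * x)
      = kappa kF / 2 * V * (hbar kF / (kappa kF * √x)) ^ 2 := by
  have hN : (0 : ℝ) < numN kF := Nat.cast_pos.mpr (numN_pos hkF)
  have hhbar : 0 < hbar kF := numN_rpow_pos hkF _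
  have hkappa : 0 < kappa kF := kappa_pos hkF
  have hhbar_cube : hbar kF ^ 3 * numN kF = 1 := by
    rw [hbar, ← Real.rpow_natCast, ← Real.rpow_mul hN.le]
    norm_num
    rw [Real.rpow_neg_one, inv_mul_cancel₀ hN.ne']
  rw [div_pow, mul_pow, Real.sq_sqrt hx.le]
  field_simp
  linear_combination -V * hhbar_cube

end Coupling

section Kernels

variable (Vhat : Mom → ℝ) (δ : ℝ) {k : Mom}

theorem b_apply (hkF : 0 < kF) (hk : k ≠ 0) (α β : P.IPlus δ k) :
    P.b Vhat δ k α β = Vhat k / (2 * hbar kF * kappa kF * numN kF * ‖toE3 k‖)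
      * (P.nrm α.1 k * P.nrm β.1 k) := by
  rw [coupling_eq hkF _ (norm_pos_iff.mpr (toE3_ne_zero hk))]
  simp only [b, v, Matrix.smul_apply, vecMulVec_apply, smul_eq_mul]
  ring

theorem W_eq_fromBlocks (hkF : 0 < kF) (hk : k ≠ 0) :
    P.W Vhat δ k = fromBlocks (P.b Vhat δ k) 0 0 (P.b Vhat δ k) := by
  ext (α | α) (β | β) <;>
  simp only [W, nI, label, signedMom, P.nrm_not, P.b_apply Vhat δ hkF hk, Sum.isLeft_inl,
    Sum.isLeft_inr, if_true, if_false, Bool.false_eq_true, Bool.true_eq_false, fromBlocks_apply₁₁,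
    fromBlocks_apply₁₂, fromBlocks_apply₂₁, fromBlocks_apply₂₂, Matrix.zero_apply]

theorem Wt_eq_fromBlocks (hkF : 0 < kF) (hk : k ≠ 0) :
    P.Wt Vhat δ k = fromBlocks 0 (P.b Vhat δ k) (P.b Vhat δ k) 0 := by
  ext (α | α) (β | β) <;>
  simp only [Wt, nI, label, signedMom, P.nrm_not, P.b_apply Vhat δ hkF hk, Sum.isLeft_inl,
    Sum.isLeft_inr, if_true, if_false, Bool.false_eq_true, Bool.true_eq_false, fromBlocks_apply₁₁,
    fromBlocks_apply₁₂, fromBlocks_apply₂₁, fromBlocks_apply₂₂, Matrix.zero_apply]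

theorem D_eq_fromBlocks : P.D δ k = fromBlocks (P.d δ k) 0 0 (P.d δ k) := by
  rw [D, d, fromBlocks_diagonal]
  congr 1
  ext (α | α)
  · rfl
  · exact P.cosAngle_not α.1 k

theorem D_add_W_sub_Wt (hkF : 0 < kF) (hk : k ≠ 0) :
    P.D δ k + P.W Vhat δ k - P.Wt Vhat δ k
      = symmBlock (P.d δ k) (P.d δ k + (2 : ℝ) • P.b Vhat δ k) := by
  rw [P.D_eq_fromBlocks, P.W_eq_fromBlocks Vhat δ hkF hk, P.Wt_eq_fromBlocks Vhat δ hkF hk,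
    fromBlocks_add, sub_eq_add_neg, fromBlocks_neg, fromBlocks_add, symmBlock]
  congr 1 <;> module

theorem D_add_W_add_Wt (hkF : 0 < kF) (hk : k ≠ 0) :
    P.D δ k + P.W Vhat δ k + P.Wt Vhat δ k
      = symmBlock (P.d δ k + (2 : ℝ) • P.b Vhat δ k) (P.d δ k) := by
  rw [P.D_eq_fromBlocks, P.W_eq_fromBlocks Vhat δ hkF hk, P.Wt_eq_fromBlocks Vhat δ hkF hk,
    fromBlocks_add, fromBlocks_add, symmBlock]
  congr 1 <;> module

theorem S1_eq_bogoliubovMap (hkF : 0 < kF) (hk : k ≠ 0) :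
    P.S1 Vhat δ k = bogoliubovMap (symmBlock (P.d δ k) (P.d δ k + (2 : ℝ) • P.b Vhat δ k))
      (symmBlock (P.d δ k + (2 : ℝ) • P.b Vhat δ k) (P.d δ k)) := by
  rw [S1, E, P.D_add_W_sub_Wt Vhat δ hkF hk, P.D_add_W_add_Wt Vhat δ hkF hk]
  rfl

theorem Ot_eq_symmBlock : P.Ot Vhat δ k = symmBlock 1 (P.A Vhat δ k) := by
  have hsqrt : (√2 : ℝ)⁻¹ * (√2)⁻¹ = 1 / 2 := by
    rw [← mul_inv, Real.mul_self_sqrt zero_le_two, one_div]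
  simp only [Ot, U, transpose_smul, fromBlocks_transpose, transpose_one, transpose_neg,
    Matrix.smul_mul, Matrix.mul_smul, smul_smul, hsqrt, fromBlocks_multiply, symmBlock,
    fromBlocks_smul, one_mul, mul_one, mul_zero, add_zero, zero_add, neg_mul, mul_neg, neg_neg,
    smul_neg, smul_add, sub_eq_add_neg]

theorem posSemidef_b (hkF : 0 < kF) (hV : 0 ≤ Vhat k) : (P.b Vhat δ k).PosSemidef := by
  have hv := posSemidef_vecMulVec_self_star (P.v δ k)
  rw [star_trivial] at hv
  exact hv.smul (mul_nonneg (half_pos (kappa_pos hkF)).le hV)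

theorem inner_center_pos (hkF : 0 < kF) (α : P.IPlus δ k) :
    0 < inner ℝ (toE3 k) (P.center α.1) :=
  (numN_rpow_pos hkF _).trans_le α.2

theorem cosAngle_pos (hkF : 0 < kF) (hk : k ≠ 0) (α : P.IPlus δ k) : 0 < P.cosAngle k α.1 :=
  div_pos (abs_pos.mpr (P.inner_center_pos δ hkF α).ne') (norm_pos_iff.mpr (toE3_ne_zero hk))

theorem posDef_d (hkF : 0 < kF) (hk : k ≠ 0) : (P.d δ k).PosDef :=
  PosDef.diagonal (P.cosAngle_pos δ hkF hk)

theorem trace_inv_d_mul_b (hkF : 0 < kF) (hk : k ≠ 0) :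
    ((P.d δ k)⁻¹ * P.b Vhat δ k).trace = Vhat k / (2 * (kF * (numN kF : ℝ) ^ (1 / 3 : ℝ)))
      * ∑ α : P.IPlus δ k, ((P.pairs α.1 k).card : ℝ) / inner ℝ (toE3 k) (P.center α.1) := by
  have hd_inv : (P.d δ k)⁻¹ = diagonal fun α => (P.cosAngle k α.1)⁻¹ := by
    refine inv_eq_right_inv ?_
    rw [d, diagonal_mul_diagonal, ← diagonal_one]
    exact congrArg _ (funext fun α => mul_inv_cancel₀ (P.cosAngle_pos δ hkF hk α).ne')
  rw [hd_inv, trace, Finset.mul_sum, ← hbar_mul_kappa_mul_numN hkF]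
  refine Finset.sum_congr rfl fun α _ => ?_
  have hinner := P.inner_center_pos δ hkF α
  have hk_norm : 0 < ‖toE3 k‖ := norm_pos_iff.mpr (toE3_ne_zero hk)
  rw [diag_apply, diagonal_mul, P.b_apply Vhat δ hkF hk, nrm,
    Real.mul_self_sqrt (Nat.cast_nonneg _), cosAngle, abs_of_pos hinner]
  field_simp

variable {P Vhat δ}

theorem IsFine.trace_inv_d_mul_b_le {ε : ℝ} (hP : P.IsFine δ ε) (hε : ε ≤ 1 / 2)
    (hV : 0 ≤ Vhat k) (hk : k ≠ 0) (hkR : ‖toE3 k‖ ≤ R) :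
    ((P.d δ k)⁻¹ * P.b Vhat δ k).trace ≤ 352 * Vhat k := by
  have hkF := hP.kF_pos
  have hroot := numN_rpow_pos hkF (1 / 3)
  rw [P.trace_inv_d_mul_b Vhat δ hkF hk]
  refine (mul_le_mul_of_nonneg_left (hP.sum_card_pairs_le hε hk hkR) (by positivity)).trans ?_
  rw [div_mul_eq_mul_div, div_le_iff₀ (by positivity)]
  calc Vhat k * (352 * kF ^ 2) = 704 * (Vhat k * kF) * (kF / 2) := by ring
    _ ≤ 704 * (Vhat k * kF) * (numN kF : ℝ) ^ (1 / 3 : ℝ) := by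
        gcongr
        exact half_le_numN_rpow hkF
    _ = 352 * Vhat k * (2 * (kF * (numN kF : ℝ) ^ (1 / 3 : ℝ))) := by ring

theorem IsFine.trace_inv_d_mul_two_smul_b_sq_le {ε : ℝ} (hP : P.IsFine δ ε) (hε : ε ≤ 1 / 2)
    (hV : 0 ≤ Vhat k) (hk : k ≠ 0) (hkR : ‖toE3 k‖ ≤ R) :
    ((P.d δ k)⁻¹ * (P.d δ k + (2 : ℝ) • P.b Vhat δ k - P.d δ k)).trace ^ 2
      ≤ 4 * (352 * Vhat k) ^ 2 := by
  have hnonneg : 0 ≤ ((P.d δ k)⁻¹ * P.b Vhat δ k).trace :=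
    trace_mul_nonneg_of_posSemidef (P.posDef_d δ hP.kF_pos hk).inv.posSemidef
      (P.posSemidef_b Vhat δ hP.kF_pos hV)
  rw [add_sub_cancel_left, Matrix.mul_smul, trace_smul, smul_eq_mul, mul_pow]
  linarith [pow_le_pow_left₀ hnonneg (hP.trace_inv_d_mul_b_le hε hV hk hkR) 2]

theorem posDef_d_add_two_smul_b (hkF : 0 < kF) (hV : 0 ≤ Vhat k) (hk : k ≠ 0) :
    (P.d δ k + (2 : ℝ) • P.b Vhat δ k).PosDef :=
  (P.posDef_d δ hkF hk).add_posSemidef ((P.posSemidef_b Vhat δ hkF hV).smul zero_le_two)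

theorem posSemidef_d_add_two_smul_b_sub (hkF : 0 < kF) (hV : 0 ≤ Vhat k) :
    (P.d δ k + (2 : ℝ) • P.b Vhat δ k - P.d δ k).PosSemidef := by
  rw [add_sub_cancel_left]
  exact (P.posSemidef_b Vhat δ hkF hV).smul zero_le_two

theorem IsFine.hsNormSq_K_le {ε : ℝ} (hP : P.IsFine δ ε) (hε : ε ≤ 1 / 2) (hV : 0 ≤ Vhat k)
    (hk : k ≠ 0) (hkR : ‖toE3 k‖ ≤ R) : hsNormSq (P.K Vhat δ k) ≤ (352 * Vhat k) ^ 2 := by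
  have hkF := hP.kF_pos
  rw [K, P.S1_eq_bogoliubovMap Vhat δ hkF hk]
  have hlog := hsNormSq_mlog_bogoliubovMap_symmBlock_le (P.posDef_d δ hkF hk)
    (posDef_d_add_two_smul_b hkF hV hk) (posSemidef_d_add_two_smul_b_sub hkF hV)
  linarith [hP.trace_inv_d_mul_two_smul_b_sq_le hε hV hk hkR, sq_nonneg (352 * Vhat k)]

theorem O_mul_Ot_eq_symmBlock (hkF : 0 < kF) (hV : 0 ≤ Vhat k) (hk : k ≠ 0) :
    P.O Vhat δ k * P.Ot Vhat δ k = symmBlock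
      (polarFactor (bogoliubovMap (P.d δ k) (P.d δ k + (2 : ℝ) • P.b Vhat δ k)))
      (polarFactor (bogoliubovMap (P.d δ k) (P.d δ k + (2 : ℝ) • P.b Vhat δ k))) := by
  rw [O, P.S1_eq_bogoliubovMap Vhat δ hkF hk, P.Ot_eq_symmBlock]
  exact polarFactor_bogoliubovMap_symmBlock_mul (P.posDef_d δ hkF hk)
    (posDef_d_add_two_smul_b hkF hV hk)

theorem transpose_O_mul_Ot_mul_self (hkF : 0 < kF) (hV : 0 ≤ Vhat k) (hk : k ≠ 0) :
    (P.O Vhat δ k * P.Ot Vhat δ k)ᵀ * (P.O Vhat δ k * P.Ot Vhat δ k) = 1 := by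
  rw [O_mul_Ot_eq_symmBlock hkF hV hk, symmBlock_transpose, symmBlock_mul,
    transpose_polarFactor_mul_self (isUnit_bogoliubovMap (P.posDef_d δ hkF hk)
      (posDef_d_add_two_smul_b hkF hV hk)), symmBlock_one]

theorem conjTranspose_L (hkF : 0 < kF) (hV : 0 ≤ Vhat k) (hk : k ≠ 0) (t : ℝ) :
    (P.L Vhat δ k t)ᴴ = -P.L Vhat δ k t :=
  conjTranspose_orthLog t (transpose_O_mul_Ot_mul_self hkF hV hk)

theorem IsFine.hsNormSq_L_le {ε : ℝ} (hP : P.IsFine δ ε) (hε : ε ≤ 1 / 2) (hV : 0 ≤ Vhat k)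
    (hk : k ≠ 0) (hkR : ‖toE3 k‖ ≤ R) {t C : ℝ}
    (hC : ∀ z : ℂ, ‖z‖ = 1 → ‖branchLog t z‖ ≤ C * ‖z - 1‖) :
    hsNormSq (P.L Vhat δ k t) ≤ (1408 * C * Vhat k) ^ 2 := by
  have hkF := hP.kF_pos
  have hQ : hsNormSq (P.O Vhat δ k * P.Ot Vhat δ k - 1) ≤ 16 * (352 * Vhat k) ^ 2 := by
    rw [O_mul_Ot_eq_symmBlock hkF hV hk, ← symmBlock_one, symmBlock_sub, hsNormSq_symmBlock]
    linarith [hP.trace_inv_d_mul_two_smul_b_sq_le hε hV hk hkR,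
      hsNormSq_polarFactor_bogoliubovMap_sub_one_le (P.posDef_d δ hkF hk)
        (posDef_d_add_two_smul_b hkF hV hk) (posSemidef_d_add_two_smul_b_sub hkF hV)]
  calc hsNormSq (P.L Vhat δ k t) ≤ C ^ 2 * hsNormSq (P.O Vhat δ k * P.Ot Vhat δ k - 1) :=
        hsNormSq_orthLog_le hC (transpose_O_mul_Ot_mul_self hkF hV hk)
    _ ≤ C ^ 2 * (16 * (352 * Vhat k) ^ 2) := mul_le_mul_of_nonneg_left hQ (sq_nonneg C)
    _ = (1408 * C * Vhat k) ^ 2 := by ring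

end Kernels

end PatchDecomposition

/-! ### Weights and pair annihilators on Fock space -/

/-- Multiplication of the amplitudes of a Fock space vector by a bounded real weight. -/
noncomputable def diagOp (w : Finset Mom → ℝ) (hw : ∃ M, ∀ S, |w S| ≤ M) : Fock →L[ℂ] Fock :=
  have hM : 0 ≤ hw.choose := (abs_nonneg (w ∅)).trans (hw.choose_spec ∅)
  lp.mapCLM 2 (fun S => (w S : ℂ) • ContinuousLinearMap.id ℂ ℂ) hM fun S =>
    ContinuousLinearMap.opNorm_le_bound _ hM fun z => by
      simpa using mul_le_mul_of_nonneg_right (hw.choose_spec S) (norm_nonneg z)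

section diagOp

variable {w : Finset Mom → ℝ} (hw : ∃ M, ∀ S, |w S| ≤ M) (ψ : Fock)

theorem diagOp_apply (S : Finset Mom) : diagOp w hw ψ S = w S * ψ S := rfl

theorem isSymmetric_diagOp : (diagOp w hw : Fock →ₗ[ℂ] Fock).IsSymmetric := fun ψ φ => by
  rw [ContinuousLinearMap.coe_coe, lp.inner_eq_tsum, lp.inner_eq_tsum]
  refine tsum_congr fun S => ?_
  rw [diagOp_apply, diagOp_apply, RCLike.inner_apply, RCLike.inner_apply, map_mul,
    Complex.conj_ofReal]
  ring

theorem adjoint_diagOp : ContinuousLinearMap.adjoint (diagOp w hw) = diagOp w hw :=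
  (isSymmetric_diagOp hw).clm_adjoint_eq

theorem hasSum_reApplyInnerSelf_diagOp :
    HasSum (fun S => w S * ‖ψ S‖ ^ 2) ((diagOp w hw).reApplyInnerSelf ψ) := by
  convert (lp.hasSum_inner (diagOp w hw ψ) ψ).mapL Complex.reCLM using 1
  · funext S
    rw [diagOp_apply, RCLike.inner_apply, Complex.reCLM_apply, map_mul, Complex.conj_ofReal,
      mul_left_comm, Complex.mul_conj, ← Complex.ofReal_mul, Complex.ofReal_re,
      Complex.normSq_eq_norm_sq]
  · rfl

theorem reApplyInnerSelf_diagOp_nonneg (hw0 : ∀ S, 0 ≤ w S) :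
    0 ≤ (diagOp w hw).reApplyInnerSelf ψ :=
  (hasSum_reApplyInnerSelf_diagOp hw ψ).nonneg fun S => mul_nonneg (hw0 S) (sq_nonneg _)

theorem ofReal_reApplyInnerSelf_diagOp (hw0 : ∀ S, 0 ≤ w S) :
    ENNReal.ofReal ((diagOp w hw).reApplyInnerSelf ψ)
      = ∑' S, ENNReal.ofReal (w S * ‖ψ S‖ ^ 2) := by
  have hsum := hasSum_reApplyInnerSelf_diagOp hw ψ
  rw [← hsum.tsum_eq]
  exact ENNReal.ofReal_tsum_of_nonneg (fun S => mul_nonneg (hw0 S) (sq_nonneg _)) hsum.summable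

end diagOp

theorem le_exp_mul_of_hasDerivAt_le {f f' : ℝ → ℝ} {c : ℝ} (hf : ∀ s, HasDerivAt f (f' s) s)
    (hf' : ∀ s, f' s ≤ c * f s) : f 1 ≤ Real.exp c * f 0 := by
  have hderiv : ∀ s, HasDerivAt (fun s => Real.exp (-c * s) * f s)
      (Real.exp (-c * s) * (f' s - c * f s)) s := fun s => by
    have hexp : HasDerivAt (fun u : ℝ => Real.exp (-c * u)) (Real.exp (-c * s) * (-c)) s := by
      simpa using ((hasDerivAt_id s).const_mul (-c)).exp
    exact (hexp.mul (hf s)).congr_deriv (by ring)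
  have hanti : Antitone fun s => Real.exp (-c * s) * f s :=
    antitone_of_deriv_nonpos (fun s => (hderiv s).differentiableAt) fun s => by
      rw [(hderiv s).deriv]
      exact mul_nonpos_of_nonneg_of_nonpos (Real.exp_pos _).le (sub_nonpos.mpr (hf' s))
  have h01 := hanti (zero_le_one : (0 : ℝ) ≤ 1)
  simp only [mul_one, mul_zero, Real.exp_zero, one_mul, Real.exp_neg] at h01
  rwa [inv_mul_le_iff₀ (Real.exp_pos c)] at h01

section expectation

variable {H : Type*} [NormedAddCommGroup H] [InnerProductSpace ℂ H] {V X : H →L[ℂ] H}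

theorem hasDerivAt_reApplyInnerSelf (hV : (V : H →ₗ[ℂ] H).IsSymmetric) {y : ℝ → H} {y' : H}
    {s : ℝ} (hy : HasDerivAt y y' s) :
    HasDerivAt (fun u => V.reApplyInnerSelf (y u)) (2 * RCLike.re (inner ℂ (V (y s)) y')) s := by
  have hVy : HasDerivAt (fun u => V (y u)) (V y') s :=
    (V.restrictScalars ℝ).hasFDerivAt.comp_hasDerivAt s hy
  refine (Complex.reCLM.hasFDerivAt.comp_hasDerivAt s (hVy.inner ℂ hy)).congr_deriv ?_
  have hsymm : inner ℂ (V y') (y s) = inner ℂ y' (V (y s)) := hV _ _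
  rw [hsymm, map_add, Complex.reCLM_apply, Complex.reCLM_apply,
    ← inner_conj_symm y' (V (y s)), Complex.conj_re, RCLike.re_to_complex, two_mul]

variable [CompleteSpace H]

theorem hasDerivAt_exp_smul_apply (X : H →L[ℂ] H) (x : H) (s : ℝ) :
    HasDerivAt (fun u : ℝ => NormedSpace.exp (u • X) x) (X (NormedSpace.exp (s • X) x)) s :=
  ((ContinuousLinearMap.apply ℂ H x).restrictScalars ℝ).hasFDerivAt.comp_hasDerivAt s
    (hasDerivAt_exp_smul_const' X s)

theorem reApplyInnerSelf_exp_le (hV : (V : H →ₗ[ℂ] H).IsSymmetric) {c : ℝ}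
    (h : ∀ x, 2 * RCLike.re (inner ℂ (V x) (X x)) ≤ c * V.reApplyInnerSelf x) (x : H) :
    V.reApplyInnerSelf (NormedSpace.exp X x) ≤ Real.exp c * V.reApplyInnerSelf x := by
  simpa using le_exp_mul_of_hasDerivAt_le
    (fun s => hasDerivAt_reApplyInnerSelf hV (hasDerivAt_exp_smul_apply X x s)) fun s => h _

end expectation

theorem form_eq_ofReal {w : Finset Mom → ℕ} (hw : ∃ M, ∀ S, |(w S : ℝ)| ≤ M) (ψ : Fock) :
    form w ψ = ENNReal.ofReal ((diagOp (fun S => (w S : ℝ)) hw).reApplyInnerSelf ψ) := by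
  rw [ofReal_reApplyInnerSelf_diagOp hw ψ fun S => Nat.cast_nonneg _, form]
  refine tsum_congr fun S => ?_
  rw [ENNReal.ofReal_mul (Nat.cast_nonneg _), ENNReal.ofReal_natCast,
    ENNReal.ofReal_pow (norm_nonneg _), ofReal_norm]

theorem form_exp_le {X : Fock →L[ℂ] Fock} {w : Finset Mom → ℕ}
    (hw : ∃ M, ∀ S, |(w S : ℝ)| ≤ M) {c : ℝ}
    (h : ∀ ψ, 2 * RCLike.re (inner ℂ (diagOp (fun S => (w S : ℝ)) hw ψ) (X ψ))
      ≤ c * (diagOp (fun S => (w S : ℝ)) hw).reApplyInnerSelf ψ) (ψ : Fock) :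
    form w (NormedSpace.exp X ψ) ≤ ENNReal.ofReal (Real.exp c) * form w ψ := by
  rw [form_eq_ofReal hw, form_eq_ofReal hw, ← ENNReal.ofReal_mul (Real.exp_pos c).le]
  exact ENNReal.ofReal_le_ofReal (reApplyInnerSelf_exp_le (isSymmetric_diagOp hw) h ψ)

theorem form_mono {w w' : Finset Mom → ℕ} (h : w ≤ w') (ψ : Fock) : form w ψ ≤ form w' ψ :=
  ENNReal.tsum_le_tsum fun S => by
    gcongr
    exact h S

theorem form_le_of_forall_exists_le {w : Finset Mom → ℕ} {v : ℕ → Finset Mom → ℕ}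
    (hv : ∀ s : Finset (Finset Mom), ∃ n, ∀ S ∈ s, w S ≤ v n S) {ψ : Fock} {B : ℝ≥0∞}
    (h : ∀ n, form (v n) ψ ≤ B) : form w ψ ≤ B := by
  rw [form, ENNReal.tsum_eq_iSup_sum]
  refine iSup_le fun s => ?_
  obtain ⟨n, hn⟩ := hv s
  refine le_trans (Finset.sum_le_sum fun S hS => ?_) ((ENNReal.sum_le_tsum s).trans (h n))
  gcongr
  exact hn S hS

/-- The occupied set obtained from `S` by creating the pair `p`, `p - k`. -/
def addPair (k p : Mom) (S : Finset Mom) : Finset Mom := insert p (insert (p - k) S)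

/-- The pair `p`, `p - k` consists of two distinct momenta that are not occupied in `S`. -/
def IsFreePair (k p : Mom) (S : Finset Mom) : Prop := p - k ∉ S ∧ p ∉ S ∧ k ≠ 0

theorem mem_addPair {k p q : Mom} {S : Finset Mom} :
    q ∈ addPair k p S ↔ q = p ∨ q = p - k ∨ q ∈ S := by
  rw [addPair, Finset.mem_insert, Finset.mem_insert]

theorem subset_addPair (k p : Mom) (S : Finset Mom) : S ⊆ addPair k p S := fun _ hq =>
  mem_addPair.mpr (Or.inr (Or.inr hq))

theorem IsFreePair.notMem_insert {k p : Mom} {S : Finset Mom} (h : IsFreePair k p S) :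
    p ∉ insert (p - k) S := by
  rw [Finset.mem_insert, not_or]
  exact ⟨fun hp => h.2.2 (by simpa using hp.symm), h.2.1⟩

theorem IsFreePair.card_addPair {k p : Mom} {S : Finset Mom} (h : IsFreePair k p S) :
    (addPair k p S).card = S.card + 2 := by
  rw [addPair, Finset.card_insert_of_notMem h.notMem_insert, Finset.card_insert_of_notMem h.1]

theorem IsFreePair.addPair_injOn (k p : Mom) : Set.InjOn (addPair k p) {S | IsFreePair k p S} := by
  have key : ∀ {S S' : Finset Mom}, IsFreePair k p S → addPair k p S = addPair k p S' → S ⊆ S' := by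
    intro S S' hS heq q hq
    rcases mem_addPair.mp (heq ▸ subset_addPair k p S hq) with rfl | rfl | hq'
    · exact absurd hq hS.2.1
    · exact absurd hq hS.1
    · exact hq'
  exact fun S hS S' hS' heq => (key hS heq).antisymm (key hS' heq.symm)

open Classical in
/-- The sum of `h` over all occupied sets that arise from `S` by creating one of the pairs
`p`, `p - k` with `p ∈ F`. -/
noncomputable def pairSum {A : Type*} [AddCommMonoid A] (F : Finset Mom) (k : Mom)
    (h : Finset Mom → A) (S : Finset Mom) : A :=
  ∑ p ∈ F, if IsFreePair k p S then h (addPair k p S) else 0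

/-- The normalization of `pairSum` by the square root of the number of pairs, which is the one of
the pair operators. -/
noncomputable def pairAvg (F : Finset Mom) (k : Mom) (h : Finset Mom → ℝ) (S : Finset Mom) : ℝ :=
  (√(F.card : ℝ))⁻¹ * pairSum F k h S

section pairSum

variable {F : Finset Mom} {k : Mom}

theorem pairSum_mono {A : Type*} [AddCommMonoid A] [PartialOrder A] [IsOrderedAddMonoid A]
    {h h' : Finset Mom → A} {S : Finset Mom}
    (hle : ∀ p, IsFreePair k p S → h (addPair k p S) ≤ h' (addPair k p S)) :
    pairSum F k h S ≤ pairSum F k h' S := by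
  refine Finset.sum_le_sum fun p _ => ?_
  split_ifs with hp
  · exact hle p hp
  · exact le_rfl

theorem pairSum_const_mul {A : Type*} [NonUnitalNonAssocSemiring A] (c : A) (h : Finset Mom → A)
    (S : Finset Mom) : pairSum F k (fun S => c * h S) S = c * pairSum F k h S := by
  simp only [pairSum, Finset.mul_sum, mul_ite, mul_zero]

theorem pairSum_nonneg {h : Finset Mom → ℝ} (hh : ∀ S, 0 ≤ h S) (S : Finset Mom) :
    0 ≤ pairSum F k h S :=
  Finset.sum_nonneg fun p _ => by
    split_ifs
    · exact hh _
    · exact le_rfl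

theorem ofReal_pairSum {h : Finset Mom → ℝ} (hh : ∀ S, 0 ≤ h S) (S : Finset Mom) :
    ENNReal.ofReal (pairSum F k h S) = pairSum F k (fun S => ENNReal.ofReal (h S)) S := by
  rw [pairSum, pairSum, ENNReal.ofReal_sum_of_nonneg]
  · simp only [apply_ite ENNReal.ofReal, ENNReal.ofReal_zero]
  · intro p _
    split_ifs
    · exact hh _
    · exact le_rfl

theorem pairAvg_const_mul (c : ℝ) (h : Finset Mom → ℝ) (S : Finset Mom) :
    pairAvg F k (fun S => c * h S) S = c * pairAvg F k h S := by
  rw [pairAvg, pairAvg, pairSum_const_mul, mul_left_comm]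

theorem pairAvg_nonneg {h : Finset Mom → ℝ} (hh : ∀ S, 0 ≤ h S) (S : Finset Mom) :
    0 ≤ pairAvg F k h S :=
  mul_nonneg (inv_nonneg.mpr (Real.sqrt_nonneg _)) (pairSum_nonneg hh S)

variable (F k) in
theorem pairAvg_sq_le (h : Finset Mom → ℝ) (S : Finset Mom) :
    pairAvg F k h S ^ 2 ≤ pairSum F k (fun S => h S ^ 2) S := by
  have hsq : pairSum F k h S ^ 2 ≤ F.card * pairSum F k (fun S => h S ^ 2) S := by
    simpa only [pairSum, ite_pow, zero_pow two_ne_zero] using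
      sq_sum_le_card_mul_sum_sq (s := F)
        (f := fun p => open Classical in if IsFreePair k p S then h (addPair k p S) else 0)
  rw [pairAvg, mul_pow, inv_pow, Real.sq_sqrt (Nat.cast_nonneg _)]
  rcases F.eq_empty_or_nonempty with rfl | hF
  · simp [pairSum]
  · rwa [inv_mul_le_iff₀ (by exact_mod_cast hF.card_pos)]

theorem pairAvg_pairAvg_sq_le (F F' : Finset Mom) (k k' : Mom) (h : Finset Mom → ℝ)
    (S : Finset Mom) : pairAvg F k (pairAvg F' k' h) S ^ 2
      ≤ pairSum F k (pairSum F' k' fun S => h S ^ 2) S :=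
  (pairAvg_sq_le F k _ S).trans (pairSum_mono fun _ _ => pairAvg_sq_le F' k' h _)

end pairSum

open Classical in
theorem tsum_addPair_le (k p : Mom) (h : Finset Mom → ℝ≥0∞) :
    ∑' S, (if IsFreePair k p S then h (addPair k p S) else 0)
      ≤ ∑' S : Finset Mom, if p ∈ S ∧ p - k ∈ S then h S else 0 := by
  set g : Finset Mom → ℝ≥0∞ := fun S => if p ∈ S ∧ p - k ∈ S then h S else 0
  have hadd : ∀ S, g (addPair k p S) = h (addPair k p S) := fun S =>
    if_pos ⟨mem_addPair.mpr (Or.inl rfl), mem_addPair.mpr (Or.inr (Or.inl rfl))⟩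
  calc ∑' S, (if IsFreePair k p S then h (addPair k p S) else 0)
      = ∑' S : {S | IsFreePair k p S}, g (addPair k p S) := by
        rw [tsum_subtype {S | IsFreePair k p S} fun S => g (addPair k p S)]
        simp only [hadd, Set.indicator_apply, Set.mem_ofPred_eq]
    _ ≤ ∑' S, g S := ENNReal.tsum_comp_le_tsum_of_injective
        (IsFreePair.addPair_injOn k p).injective g

section PairFamily

variable {J : Type*} [Fintype J]

/-- The finite family of pairs `p`, `p - κ j` with `p ∈ F j` has at most `G S` members in every
occupied set `S`. -/
structure IsPairCountBound (F : J → Finset Mom) (κ : J → Mom) (G : Finset Mom → ℕ) : Prop where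
  ne_zero : ∀ j, κ j ≠ 0
  sum_card_le : ∀ S, ∑ j, {p ∈ F j | p ∈ S ∧ p - κ j ∈ S}.card ≤ G S
  mono : Monotone G

variable {F : J → Finset Mom} {κ : J → Mom} {G : Finset Mom → ℕ}

theorem IsPairCountBound.sum_tsum_pairSum_le (hG : IsPairCountBound F κ G)
    (h : Finset Mom → ℝ≥0∞) :
    ∑ j, ∑' S, pairSum (F j) (κ j) h S ≤ ∑' S, (G S : ℝ≥0∞) * h S := by
  classical
  calc ∑ j, ∑' S, pairSum (F j) (κ j) h S
      = ∑ j, ∑ p ∈ F j, ∑' S, (if IsFreePair (κ j) p S then h (addPair (κ j) p S) else 0) :=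
        Finset.sum_congr rfl fun j _ => Summable.tsum_finsetSum fun _ _ => ENNReal.summable
    _ ≤ ∑ j, ∑ p ∈ F j, ∑' S : Finset Mom, (if p ∈ S ∧ p - κ j ∈ S then h S else 0) :=
        Finset.sum_le_sum fun j _ => Finset.sum_le_sum fun p _ => tsum_addPair_le _ _ _
    _ = ∑' S : Finset Mom, ∑ j, ∑ p ∈ F j, (if p ∈ S ∧ p - κ j ∈ S then h S else 0) := by
        simp only [Summable.tsum_finsetSum fun _ _ => ENNReal.summable]
    _ = ∑' S, ((∑ j, {p ∈ F j | p ∈ S ∧ p - κ j ∈ S}.card : ℕ) : ℝ≥0∞) * h S := by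
        simp only [← Finset.sum_filter, Finset.sum_const, nsmul_eq_mul, Nat.cast_sum,
          Finset.sum_mul]
    _ ≤ ∑' S, (G S : ℝ≥0∞) * h S := by
        gcongr with S
        exact hG.sum_card_le S

theorem IsPairCountBound.sum_tsum_pairSum_pairSum_le (hG : IsPairCountBound F κ G)
    (h : Finset Mom → ℝ≥0∞) :
    ∑ i, ∑ j, ∑' S, pairSum (F i) (κ i) (pairSum (F j) (κ j) h) S
      ≤ ∑' S, (G S : ℝ≥0∞) ^ 2 * h S := by
  rw [Finset.sum_comm]
  calc ∑ j, ∑ i, ∑' S, pairSum (F i) (κ i) (pairSum (F j) (κ j) h) S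
      ≤ ∑ j, ∑' S, (G S : ℝ≥0∞) * pairSum (F j) (κ j) h S :=
        Finset.sum_le_sum fun j _ => hG.sum_tsum_pairSum_le _
    _ ≤ ∑ j, ∑' S, pairSum (F j) (κ j) (fun S => (G S : ℝ≥0∞) * h S) S := by
        gcongr with j _ S
        rw [← pairSum_const_mul]
        refine pairSum_mono fun p _ => ?_
        gcongr
        exact hG.mono (subset_addPair _ _ _)
    _ ≤ ∑' S, (G S : ℝ≥0∞) * ((G S : ℝ≥0∞) * h S) := hG.sum_tsum_pairSum_le _
    _ = ∑' S, (G S : ℝ≥0∞) ^ 2 * h S := by simp only [pow_two, mul_assoc]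

end PairFamily

/-- The normalized sum of the annihilators of the pairs `p`, `p - k` with `p ∈ F`. -/
noncomputable def pairAnn (F : Finset Mom) (k : Mom) : Fock →L[ℂ] Fock :=
  (((√(F.card : ℝ))⁻¹ : ℝ) : ℂ) • ∑ p ∈ F, ann (p - k) ∘L ann p

/-- The sign in the action of `a_{p-k} a_p`. -/
noncomputable def pairSign (k p : Mom) (S : Finset Mom) : ℂ :=
  jwSign (p - k) S * jwSign p (insert (p - k) S)

theorem norm_pairSign (k p : Mom) (S : Finset Mom) : ‖pairSign k p S‖ = 1 := by
  rw [pairSign, norm_mul, norm_jwSign, norm_jwSign, one_mul]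

open Classical in
theorem ann_ann_apply {k : Mom} (hk : k ≠ 0) (p : Mom) (ψ : Fock) (S : Finset Mom) :
    ann (p - k) (ann p ψ) S
      = if IsFreePair k p S then pairSign k p S * ψ (addPair k p S) else 0 := by
  change annCoeff (p - k) (annCoeff p ψ) S = _
  rw [annCoeff, annCoeff]
  split_ifs with hpk hfree hp hfree hfree
  · exact absurd hpk hfree.1
  · rfl
  · exact absurd hp hfree.notMem_insert
  · exact mul_zero _
  · rw [pairSign, addPair, mul_assoc]
  · exact absurd ⟨hpk, fun h => hp (Finset.mem_insert_of_mem h), hk⟩ hfree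

open Classical in
theorem pairAnn_apply (F : Finset Mom) {k : Mom} (hk : k ≠ 0) (ψ : Fock) (S : Finset Mom) :
    pairAnn F k ψ S = (((√(F.card : ℝ))⁻¹ : ℝ) : ℂ)
      * ∑ p ∈ F, if IsFreePair k p S then pairSign k p S * ψ (addPair k p S) else 0 := by
  simp only [← ann_ann_apply hk]
  rw [← Finset.sum_apply, ← lp.coeFn_sum, ← smul_eq_mul, ← Pi.smul_apply, ← lp.coeFn_smul, pairAnn,
    smul_apply, sum_apply]
  rfl

theorem norm_pairAnn_apply_le {F : Finset Mom} {k : Mom} (hk : k ≠ 0) {ψ : Fock}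
    {y : Finset Mom → ℝ} {S : Finset Mom}
    (h : ∀ p, IsFreePair k p S → ‖ψ (addPair k p S)‖ ≤ y (addPair k p S)) :
    ‖pairAnn F k ψ S‖ ≤ pairAvg F k y S := by
  rw [pairAnn_apply F hk, norm_mul, Complex.norm_real,
    Real.norm_of_nonneg (inv_nonneg.mpr (Real.sqrt_nonneg _)), pairAvg]
  gcongr
  refine (norm_sum_le _ _).trans (Finset.sum_le_sum fun p _ => ?_)
  split_ifs with hp
  · rw [norm_mul, norm_pairSign, one_mul]
    exact h p hp
  · exact norm_zero.le

/-! ### Commutators of pairs with weights -/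

theorem norm_le_of_hasSum_of_tsum_le {ι E : Type*} [NormedAddCommGroup E] {f : ι → E} {z : E}
    (hf : HasSum f z) {a : ι → ℝ} (ha : ∀ i, ‖f i‖ ≤ a i) {b : ℝ} (hb : 0 ≤ b)
    (h : ∑' i, ENNReal.ofReal (a i) ≤ ENNReal.ofReal b) : ‖z‖ ≤ b := by
  rw [← ENNReal.ofReal_le_ofReal_iff hb, ofReal_norm, ← hf.tsum_eq]
  refine enorm_tsum_le_tsum_enorm.trans ((ENNReal.tsum_le_tsum fun i => ?_).trans h)
  rw [← ofReal_norm]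
  exact ENNReal.ofReal_le_ofReal (ha i)

section PairFamily

variable {J : Type*} [Fintype J]

theorem norm_sum_sum_mul_le {A z : Matrix J J ℂ} {B b : ℝ} (hB : 0 ≤ B) (hb : 0 ≤ b)
    (hA : hsNormSq A ≤ B ^ 2) (hz : hsNormSq z ≤ b ^ 2) :
    ‖∑ i, ∑ j, A i j * z i j‖ ≤ B * b := by
  simp only [hsNormSq, ← Fintype.sum_prod_type'] at hA hz ⊢
  calc ‖∑ x : J × J, A x.1 x.2 * z x.1 x.2‖
      ≤ ∑ x : J × J, ‖A x.1 x.2‖ * ‖z x.1 x.2‖ :=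
        norm_sum_le_of_le _ fun x _ => (norm_mul _ _).le
    _ ≤ √(∑ x : J × J, ‖A x.1 x.2‖ ^ 2) * √(∑ x : J × J, ‖z x.1 x.2‖ ^ 2) :=
        Real.sum_mul_le_sqrt_mul_sqrt _ _ _
    _ ≤ B * b := mul_le_mul ((Real.sqrt_le_left hB).mpr hA) ((Real.sqrt_le_left hb).mpr hz)
        (Real.sqrt_nonneg _) hB

theorem hasSum_sum_mul_inner (A : Matrix J J ℂ) (φ φ' : J → J → Fock) :
    HasSum (fun S => ∑ i, ∑ j, A i j * inner ℂ (φ i j S) (φ' i j S))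
      (∑ i, ∑ j, A i j * inner ℂ (φ i j) (φ' i j)) :=
  hasSum_sum fun i _ => hasSum_sum fun j _ =>
    (lp.hasSum_inner (φ i j) (φ' i j)).mul_left (A i j)

variable {F : J → Finset Mom} {κ : J → Mom} {G : Finset Mom → ℕ}

theorem IsPairCountBound.tsum_ofReal_sum_pairSum_le (hG : IsPairCountBound F κ G)
    {h : Finset Mom → ℝ} (hh : ∀ S, 0 ≤ h S) :
    ∑' S, ENNReal.ofReal (∑ j, pairSum (F j) (κ j) h S) ≤ ∑' S, ENNReal.ofReal (G S * h S) := by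
  simp only [ENNReal.ofReal_sum_of_nonneg fun _ _ => pairSum_nonneg hh _, ofReal_pairSum hh,
    ENNReal.ofReal_mul (Nat.cast_nonneg _), ENNReal.ofReal_natCast,
    Summable.tsum_finsetSum fun _ _ => ENNReal.summable]
  exact hG.sum_tsum_pairSum_le _

theorem IsPairCountBound.tsum_ofReal_sum_pairSum_pairSum_le (hG : IsPairCountBound F κ G)
    {h : Finset Mom → ℝ} (hh : ∀ S, 0 ≤ h S) :
    ∑' S, ENNReal.ofReal (∑ i, ∑ j, pairSum (F i) (κ i) (pairSum (F j) (κ j) h) S)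
      ≤ ∑' S, ENNReal.ofReal (G S ^ 2 * h S) := by
  have hh' : ∀ j S, 0 ≤ pairSum (F j) (κ j) h S := fun j => pairSum_nonneg hh
  simp only [ENNReal.ofReal_sum_of_nonneg fun _ _ => Finset.sum_nonneg fun j _ =>
      pairSum_nonneg (hh' j) _, ENNReal.ofReal_sum_of_nonneg fun j _ => pairSum_nonneg (hh' j) _,
    ofReal_pairSum (hh' _), ofReal_pairSum hh, ENNReal.ofReal_mul (sq_nonneg (_ : ℝ)),
    ENNReal.ofReal_pow (Nat.cast_nonneg _), ENNReal.ofReal_natCast,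
    Summable.tsum_finsetSum fun _ _ => ENNReal.summable]
  exact hG.sum_tsum_pairSum_pairSum_le _

section doubleCommutator

/-- The weight `w` changes by little when four particles are added, measured against the number `G`
of pairs available for two annihilations. -/
def IsSlowlyVarying (w : Finset Mom → ℝ) (G : Finset Mom → ℕ) (C : ℝ) : Prop :=
  ∀ ⦃S S'⦄, S ⊆ S' → S'.card = S.card + 4 → |w S' - w S| * (G S' + 1) ≤ C * (√(w S) * √(w S'))

variable {w : Finset Mom → ℝ} {C : ℝ}

theorem norm_pairAnn_pairAnn_commutator_le {F F' : Finset Mom} {k k' : Mom} (hk : k ≠ 0)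
    (hk' : k' ≠ 0) (hw : ∃ M, ∀ S, |w S| ≤ M) (hwG : IsSlowlyVarying w G C) (ψ : Fock)
    (S : Finset Mom) :
    ‖(pairAnn F k (pairAnn F' k' (diagOp w hw ψ))
        - diagOp w hw (pairAnn F k (pairAnn F' k' ψ))) S‖
      ≤ C * √(w S) * pairAvg F k (pairAvg F' k' fun S => √(w S) * ‖ψ S‖ / (G S + 1)) S := by
  have hlin : (pairAnn F k (pairAnn F' k' (diagOp w hw ψ))
        - diagOp w hw (pairAnn F k (pairAnn F' k' ψ))) S
      = pairAnn F k (pairAnn F' k' (diagOp w hw ψ - (w S : ℂ) • ψ)) S := by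
    rw [map_sub, map_sub, map_smul, map_smul]
    rfl
  rw [hlin, ← pairAvg_const_mul]
  refine norm_pairAnn_apply_le hk fun p hp => ?_
  rw [← pairAvg_const_mul]
  refine norm_pairAnn_apply_le hk' fun q hq => ?_
  set S' := addPair k' q (addPair k p S)
  have hcard : S'.card = S.card + 4 := by rw [hq.card_addPair, hp.card_addPair]
  have hvar := hwG ((subset_addPair k p S).trans (subset_addPair k' q _)) hcard
  rw [← le_div_iff₀ (by positivity)] at hvar
  calc ‖(diagOp w hw ψ - (w S : ℂ) • ψ) S'‖
      = ‖((w S' - w S : ℝ) : ℂ) * ψ S'‖ := by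
        rw [Complex.ofReal_sub, sub_mul]
        rfl
    _ = |w S' - w S| * ‖ψ S'‖ := by rw [norm_mul, Complex.norm_real, Real.norm_eq_abs]
    _ ≤ C * (√(w S) * √(w S')) / (G S' + 1) * ‖ψ S'‖ := by gcongr
    _ = C * √(w S) * (√(w S') * ‖ψ S'‖ / (G S' + 1)) := by ring

theorem norm_sum_mul_inner_commutator_apply_le (hκ : ∀ j, κ j ≠ 0) (hw : ∃ M, ∀ S, |w S| ≤ M)
    (hw0 : ∀ S, 0 ≤ w S) (hC : 0 ≤ C) (hwG : IsSlowlyVarying w G C) {A : Matrix J J ℂ} {B : ℝ}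
    (hB : 0 ≤ B) (hA : hsNormSq A ≤ B ^ 2) (ψ : Fock) (S : Finset Mom) :
    ‖∑ i, ∑ j, A i j * inner ℂ ((pairAnn (F i) (κ i) (pairAnn (F j) (κ j) (diagOp w hw ψ))
        - diagOp w hw (pairAnn (F i) (κ i) (pairAnn (F j) (κ j) ψ))) S) (ψ S)‖
      ≤ C * B / 2 * (w S * ‖ψ S‖ ^ 2 + ∑ i, ∑ j, pairSum (F i) (κ i) (pairSum (F j) (κ j)
          fun S => (√(w S) * ‖ψ S‖ / (G S + 1)) ^ 2) S) := by
  set y : Finset Mom → ℝ := fun S => √(w S) * ‖ψ S‖ / (G S + 1)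
  set ℓ : ℝ := ∑ i, ∑ j, pairSum (F i) (κ i) (pairSum (F j) (κ j) fun S => y S ^ 2) S
  have hℓ : 0 ≤ ℓ := Finset.sum_nonneg fun i _ => Finset.sum_nonneg fun j _ =>
    pairSum_nonneg (pairSum_nonneg fun _ => sq_nonneg _) S
  set z : Matrix J J ℂ := fun i j =>
    inner ℂ ((pairAnn (F i) (κ i) (pairAnn (F j) (κ j) (diagOp w hw ψ))
      - diagOp w hw (pairAnn (F i) (κ i) (pairAnn (F j) (κ j) ψ))) S) (ψ S)
  have hz : ∀ i j, ‖z i j‖ ^ 2 ≤ (C * (√(w S) * ‖ψ S‖)) ^ 2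
      * pairSum (F i) (κ i) (pairSum (F j) (κ j) fun S => y S ^ 2) S := fun i j => by
    have hzij : ‖z i j‖ ≤ C * (√(w S) * ‖ψ S‖) * pairAvg (F i) (κ i) (pairAvg (F j) (κ j) y) S :=
      calc ‖z i j‖ ≤ _ * ‖ψ S‖ := norm_inner_le_norm _ _
        _ ≤ C * √(w S) * pairAvg (F i) (κ i) (pairAvg (F j) (κ j) y) S * ‖ψ S‖ := by
            gcongr
            exact norm_pairAnn_pairAnn_commutator_le (hκ i) (hκ j) hw hwG ψ S
        _ = _ := by ring
    refine (pow_le_pow_left₀ (norm_nonneg _) hzij 2).trans ?_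
    rw [mul_pow]
    gcongr
    exact pairAvg_pairAvg_sq_le _ _ _ _ _ _
  have hzsum : hsNormSq z ≤ (C * (√(w S) * ‖ψ S‖) * √ℓ) ^ 2 := by
    rw [mul_pow, Real.sq_sqrt hℓ, Finset.mul_sum]
    refine Finset.sum_le_sum fun i _ => ?_
    rw [Finset.mul_sum]
    exact Finset.sum_le_sum fun j _ => hz i j
  calc ‖∑ i, ∑ j, A i j * z i j‖ ≤ B * (C * (√(w S) * ‖ψ S‖) * √ℓ) :=
        norm_sum_sum_mul_le hB (by positivity) hA hzsum
    _ = C * B / 2 * (2 * (√(w S) * ‖ψ S‖) * √ℓ) := by ring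
    _ ≤ C * B / 2 * ((√(w S) * ‖ψ S‖) ^ 2 + √ℓ ^ 2) := by
        gcongr
        exact two_mul_le_add_sq _ _
    _ = C * B / 2 * (w S * ‖ψ S‖ ^ 2 + ℓ) := by
        rw [mul_pow, Real.sq_sqrt (hw0 S), Real.sq_sqrt hℓ]

theorem IsPairCountBound.norm_sum_mul_inner_commutator_le (hG : IsPairCountBound F κ G)
    (hw : ∃ M, ∀ S, |w S| ≤ M) (hw0 : ∀ S, 0 ≤ w S) (hC : 0 ≤ C) (hwG : IsSlowlyVarying w G C)
    {A : Matrix J J ℂ} {B : ℝ} (hB : 0 ≤ B) (hA : hsNormSq A ≤ B ^ 2) (ψ : Fock) :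
    ‖∑ i, ∑ j, A i j * inner ℂ
      (pairAnn (F i) (κ i) (pairAnn (F j) (κ j) (diagOp w hw ψ))
        - diagOp w hw (pairAnn (F i) (κ i) (pairAnn (F j) (κ j) ψ))) ψ‖
      ≤ C * B * (diagOp w hw).reApplyInnerSelf ψ := by
  have hV := reApplyInnerSelf_diagOp_nonneg hw ψ hw0
  have hVsum := ofReal_reApplyInnerSelf_diagOp hw ψ hw0
  set y : Finset Mom → ℝ := fun S => √(w S) * ‖ψ S‖ / (G S + 1) with hy
  set ℓ : Finset Mom → ℝ := fun S =>
    ∑ i, ∑ j, pairSum (F i) (κ i) (pairSum (F j) (κ j) fun S => y S ^ 2) S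
  have hℓ : ∀ S, 0 ≤ ℓ S := fun S => Finset.sum_nonneg fun i _ => Finset.sum_nonneg fun j _ =>
    pairSum_nonneg (pairSum_nonneg fun _ => sq_nonneg _) S
  have hyw : ∀ S, (G S : ℝ) ^ 2 * y S ^ 2 ≤ w S * ‖ψ S‖ ^ 2 := fun S => by
    rw [hy, div_pow, mul_pow, Real.sq_sqrt (hw0 S), mul_div_assoc', div_le_iff₀ (by positivity),
      mul_comm]
    have := hw0 S
    gcongr
    exact le_add_of_nonneg_right zero_le_one
  have hℓsum : ∑' S, ENNReal.ofReal (ℓ S) ≤ ENNReal.ofReal ((diagOp w hw).reApplyInnerSelf ψ) :=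
    hVsum ▸ (hG.tsum_ofReal_sum_pairSum_pairSum_le fun S => sq_nonneg (y S)).trans
      (ENNReal.tsum_le_tsum fun S => ENNReal.ofReal_le_ofReal (hyw S))
  refine norm_le_of_hasSum_of_tsum_le (hasSum_sum_mul_inner A _ fun _ _ => ψ)
    (norm_sum_mul_inner_commutator_apply_le hG.ne_zero hw hw0 hC hwG hB hA ψ) (by positivity) ?_
  calc ∑' S, ENNReal.ofReal (C * B / 2 * (w S * ‖ψ S‖ ^ 2 + ℓ S))
      = ENNReal.ofReal (C * B / 2) * (ENNReal.ofReal ((diagOp w hw).reApplyInnerSelf ψ)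
          + ∑' S, ENNReal.ofReal (ℓ S)) := by
        simp only [ENNReal.ofReal_mul (by positivity : 0 ≤ C * B / 2), ENNReal.tsum_mul_left,
          ENNReal.ofReal_add (mul_nonneg (hw0 _) (sq_nonneg _)) (hℓ _), ENNReal.tsum_add, hVsum]
    _ ≤ ENNReal.ofReal (C * B / 2) * (ENNReal.ofReal ((diagOp w hw).reApplyInnerSelf ψ)
          + ENNReal.ofReal ((diagOp w hw).reApplyInnerSelf ψ)) := by gcongr
    _ = ENNReal.ofReal (C * B * (diagOp w hw).reApplyInnerSelf ψ) := by
        rw [← ENNReal.ofReal_add hV hV, ← ENNReal.ofReal_mul (by positivity)]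
        ring_nf

end doubleCommutator

section pairMove

variable {w : Finset Mom → ℝ} {h : ℕ → ℝ}

theorem sqrt_mul_norm_pairAnn_le {F : Finset Mom} {k : Mom} (hk : k ≠ 0) (ψ : Fock)
    (S : Finset Mom) : √(h (S.card + 2)) * ‖pairAnn F k ψ S‖
      ≤ pairAvg F k (fun S => √(h S.card) * ‖ψ S‖) S := by
  have hle : ‖pairAnn F k ((√(h (S.card + 2)) : ℂ) • ψ) S‖
      ≤ pairAvg F k (fun S => √(h S.card) * ‖ψ S‖) S :=
    norm_pairAnn_apply_le hk fun p hp => by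
      rw [lp.coeFn_smul, Pi.smul_apply, norm_smul, Complex.norm_real,
        Real.norm_of_nonneg (Real.sqrt_nonneg _), hp.card_addPair]
  rwa [map_smul, lp.coeFn_smul, Pi.smul_apply, norm_smul, Complex.norm_real,
    Real.norm_of_nonneg (Real.sqrt_nonneg _)] at hle

/-- A pair changes the gapped number by at most two, so that the centered weight on its range is
bounded by `h`. -/
theorem norm_pairAnn_diagOp_sub_le {F : Finset Mom} {k : Mom} (hk : k ≠ 0)
    (hw : ∃ M, ∀ S, |w S| ≤ M) (hh : ∀ m, 0 ≤ h m) (hwh : ∀ S, w S = G S * h S.card)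
    (hGmono : Monotone G) (hGadd : ∀ S S', S ⊆ S' → S'.card = S.card + 2 → G S' ≤ G S + 2)
    (ψ : Fock) (S : Finset Mom) :
    ‖pairAnn F k (diagOp w hw ψ) S - ((h (S.card + 2) * (G S + 1) : ℝ) : ℂ) * pairAnn F k ψ S‖
      ≤ √(h (S.card + 2)) * pairAvg F k (fun S => √(h S.card) * ‖ψ S‖) S := by
  set w₀ : ℝ := h (S.card + 2) * (G S + 1) with hw₀
  have hlin : pairAnn F k (diagOp w hw ψ) S - (w₀ : ℂ) * pairAnn F k ψ S
      = pairAnn F k (diagOp w hw ψ - (w₀ : ℂ) • ψ) S := by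
    rw [map_sub, map_smul]
    rfl
  rw [hlin, ← pairAvg_const_mul]
  refine norm_pairAnn_apply_le hk fun p hp => ?_
  set S' := addPair k p S
  have hcard : S'.card = S.card + 2 := hp.card_addPair
  have hlower : (G S : ℝ) ≤ G S' := by exact_mod_cast hGmono (subset_addPair k p S)
  have hupper : (G S' : ℝ) ≤ G S + 2 := by
    exact_mod_cast hGadd S S' (subset_addPair k p S) hcard
  have hcenter : |w S' - w₀| ≤ h (S.card + 2) := by
    rw [hwh, hw₀, hcard, mul_comm, ← mul_sub, abs_mul, abs_of_nonneg (hh _)]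
    exact mul_le_of_le_one_right (hh _) (abs_le.mpr ⟨by linarith, by linarith⟩)
  calc ‖(diagOp w hw ψ - (w₀ : ℂ) • ψ) S'‖
      = ‖((w S' - w₀ : ℝ) : ℂ) * ψ S'‖ := by
        rw [Complex.ofReal_sub, sub_mul]
        rfl
    _ = |w S' - w₀| * ‖ψ S'‖ := by rw [norm_mul, Complex.norm_real, Real.norm_eq_abs]
    _ ≤ h (S.card + 2) * ‖ψ S'‖ := by gcongr
    _ = √(h (S.card + 2)) * (√(h S'.card) * ‖ψ S'‖) := by
        rw [hcard, ← mul_assoc, Real.mul_self_sqrt (hh _)]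

theorem norm_inner_pairAnn_diagOp_sub_le {F F' : Finset Mom} {k k' : Mom} (hk : k ≠ 0)
    (hk' : k' ≠ 0) (hw : ∃ M, ∀ S, |w S| ≤ M) (hh : ∀ m, 0 ≤ h m)
    (hwh : ∀ S, w S = G S * h S.card) (hGmono : Monotone G)
    (hGadd : ∀ S S', S ⊆ S' → S'.card = S.card + 2 → G S' ≤ G S + 2) (ψ : Fock)
    (S : Finset Mom) :
    ‖inner ℂ (pairAnn F k (diagOp w hw ψ) S) (pairAnn F' k' ψ S)
        - inner ℂ (pairAnn F k ψ S) (pairAnn F' k' (diagOp w hw ψ) S)‖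
      ≤ 2 * (pairAvg F k (fun S => √(h S.card) * ‖ψ S‖) S
        * pairAvg F' k' (fun S => √(h S.card) * ‖ψ S‖) S) := by
  set x := pairAvg F k (fun S => √(h S.card) * ‖ψ S‖) S
  set x' := pairAvg F' k' (fun S => √(h S.card) * ‖ψ S‖) S
  have hx : 0 ≤ x := pairAvg_nonneg (fun _ => by positivity) S
  have hx' : 0 ≤ x' := pairAvg_nonneg (fun _ => by positivity) S
  set w₀ : ℝ := h (S.card + 2) * (G S + 1)
  set r := √(h (S.card + 2))
  set a := pairAnn F k ψ S
  set a' := pairAnn F' k' ψ S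
  set e := pairAnn F k (diagOp w hw ψ) S - (w₀ : ℂ) * a with he_def
  set e' := pairAnn F' k' (diagOp w hw ψ) S - (w₀ : ℂ) * a' with he_def'
  have he : ‖e‖ ≤ r * x := norm_pairAnn_diagOp_sub_le hk hw hh hwh hGmono hGadd ψ S
  have he' : ‖e'‖ ≤ r * x' := norm_pairAnn_diagOp_sub_le hk' hw hh hwh hGmono hGadd ψ S
  have ha : r * ‖a‖ ≤ x := sqrt_mul_norm_pairAnn_le hk ψ S
  have ha' : r * ‖a'‖ ≤ x' := sqrt_mul_norm_pairAnn_le hk' ψ S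
  have hcancel : inner ℂ (pairAnn F k (diagOp w hw ψ) S) a'
      - inner ℂ a (pairAnn F' k' (diagOp w hw ψ) S) = inner ℂ e a' - inner ℂ a e' := by
    simp only [he_def, he_def', RCLike.inner_apply, map_sub, map_mul, Complex.conj_ofReal]
    ring
  rw [hcancel]
  calc ‖inner ℂ e a' - inner ℂ a e'‖
      ≤ ‖e‖ * ‖a'‖ + ‖a‖ * ‖e'‖ := (norm_sub_le _ _).trans
        (add_le_add (norm_inner_le_norm _ _) (norm_inner_le_norm _ _))
    _ ≤ r * x * ‖a'‖ + ‖a‖ * (r * x') := by gcongr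
    _ = x * (r * ‖a'‖) + r * ‖a‖ * x' := by ring
    _ ≤ x * x' + x * x' := by gcongr
    _ = 2 * (x * x') := by ring

theorem norm_sum_mul_inner_sub_inner_apply_le (hκ : ∀ j, κ j ≠ 0)
    (hw : ∃ M, ∀ S, |w S| ≤ M) (hh : ∀ m, 0 ≤ h m) (hwh : ∀ S, w S = G S * h S.card)
    (hGmono : Monotone G) (hGadd : ∀ S S', S ⊆ S' → S'.card = S.card + 2 → G S' ≤ G S + 2)
    {A : Matrix J J ℂ} {B : ℝ} (hB : 0 ≤ B) (hA : hsNormSq A ≤ B ^ 2) (ψ : Fock)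
    (S : Finset Mom) :
    ‖∑ i, ∑ j, A i j *
      (inner ℂ (pairAnn (F i) (κ i) (diagOp w hw ψ) S) (pairAnn (F j) (κ j) ψ S)
        - inner ℂ (pairAnn (F i) (κ i) ψ S) (pairAnn (F j) (κ j) (diagOp w hw ψ) S))‖
      ≤ 2 * B * ∑ j, pairSum (F j) (κ j) (fun S => (√(h S.card) * ‖ψ S‖) ^ 2) S := by
  set x : J → ℝ := fun j => pairAvg (F j) (κ j) (fun S => √(h S.card) * ‖ψ S‖) S
  set z : Matrix J J ℂ := fun i j =>
    inner ℂ (pairAnn (F i) (κ i) (diagOp w hw ψ) S) (pairAnn (F j) (κ j) ψ S)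
      - inner ℂ (pairAnn (F i) (κ i) ψ S) (pairAnn (F j) (κ j) (diagOp w hw ψ) S)
  have hz : hsNormSq z ≤ (2 * ∑ j, x j ^ 2) ^ 2 :=
    calc hsNormSq z ≤ ∑ i, ∑ j, (2 * (x i * x j)) ^ 2 :=
          Finset.sum_le_sum fun i _ => Finset.sum_le_sum fun j _ =>
            pow_le_pow_left₀ (norm_nonneg _) (norm_inner_pairAnn_diagOp_sub_le (hκ i) (hκ j) hw hh
              hwh hGmono hGadd ψ S) 2
      _ = (2 * ∑ j, x j ^ 2) ^ 2 := by
          rw [mul_pow, pow_two (∑ j, x j ^ 2), Finset.sum_mul_sum, Finset.mul_sum]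
          simp only [mul_pow, Finset.mul_sum]
  calc ‖∑ i, ∑ j, A i j * z i j‖ ≤ B * (2 * ∑ j, x j ^ 2) :=
        norm_sum_sum_mul_le hB (by positivity) hA hz
    _ = 2 * B * ∑ j, x j ^ 2 := by ring
    _ ≤ _ := by
        gcongr with j
        exact pairAvg_sq_le _ _ _ _

theorem IsPairCountBound.norm_sum_mul_inner_sub_inner_le (hG : IsPairCountBound F κ G)
    (hGadd : ∀ S S', S ⊆ S' → S'.card = S.card + 2 → G S' ≤ G S + 2)
    (hw : ∃ M, ∀ S, |w S| ≤ M) (hh : ∀ m, 0 ≤ h m) (hwh : ∀ S, w S = G S * h S.card)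
    {A : Matrix J J ℂ} {B : ℝ} (hB : 0 ≤ B) (hA : hsNormSq A ≤ B ^ 2) (ψ : Fock) :
    ‖∑ i, ∑ j, A i j *
      (inner ℂ (pairAnn (F i) (κ i) (diagOp w hw ψ)) (pairAnn (F j) (κ j) ψ)
        - inner ℂ (pairAnn (F i) (κ i) ψ) (pairAnn (F j) (κ j) (diagOp w hw ψ)))‖
      ≤ 2 * B * (diagOp w hw).reApplyInnerSelf ψ := by
  have hw0 : ∀ S, 0 ≤ w S := fun S => hwh S ▸ mul_nonneg (Nat.cast_nonneg _) (hh _)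
  have hV := reApplyInnerSelf_diagOp_nonneg hw ψ hw0
  have hsum : HasSum (fun S => ∑ i, ∑ j, A i j *
      (inner ℂ (pairAnn (F i) (κ i) (diagOp w hw ψ) S) (pairAnn (F j) (κ j) ψ S)
        - inner ℂ (pairAnn (F i) (κ i) ψ S) (pairAnn (F j) (κ j) (diagOp w hw ψ) S)))
      (∑ i, ∑ j, A i j *
        (inner ℂ (pairAnn (F i) (κ i) (diagOp w hw ψ)) (pairAnn (F j) (κ j) ψ)
          - inner ℂ (pairAnn (F i) (κ i) ψ) (pairAnn (F j) (κ j) (diagOp w hw ψ)))) := by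
    simp only [mul_sub, Finset.sum_sub_distrib]
    exact (hasSum_sum_mul_inner A (fun i _ => pairAnn (F i) (κ i) (diagOp w hw ψ))
      fun _ j => pairAnn (F j) (κ j) ψ).sub (hasSum_sum_mul_inner A
        (fun i _ => pairAnn (F i) (κ i) ψ) fun _ j => pairAnn (F j) (κ j) (diagOp w hw ψ))
  refine norm_le_of_hasSum_of_tsum_le hsum (norm_sum_mul_inner_sub_inner_apply_le hG.ne_zero hw hh
    hwh hG.mono hGadd hB hA ψ) (by positivity) ?_
  simp only [ENNReal.ofReal_mul (by positivity : 0 ≤ 2 * B), ENNReal.tsum_mul_left]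
  rw [ofReal_reApplyInnerSelf_diagOp hw ψ hw0]
  gcongr _ * ?_
  refine (hG.tsum_ofReal_sum_pairSum_le fun S => sq_nonneg _).trans_eq (tsum_congr fun S => ?_)
  rw [mul_pow, Real.sq_sqrt (hh _), hwh, mul_assoc]

end pairMove

end PairFamily

/-! ### Slowly growing weights and number sectors -/

theorem nTot_eq_card (S : Finset Mom) : nTot S = S.card := by
  simp [nTot, cnt]

theorem cnt_mono (T : Set Mom) : Monotone (cnt T) := fun _ _ h => by
  classical exact Finset.card_le_card (Finset.filter_subset_filter _ h)

theorem cnt_le_card (T : Set Mom) (S : Finset Mom) : cnt T S ≤ S.card := by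
  classical exact Finset.card_filter_le _ _

theorem cnt_le_cnt_add (T : Set Mom) {S S' : Finset Mom} (h : S ⊆ S') {j : ℕ}
    (hcard : S'.card = S.card + j) : cnt T S' ≤ cnt T S + j := by
  classical
  calc cnt T S' = cnt T (S ∪ (S' \ S)) := by rw [Finset.union_sdiff_of_subset h]
    _ ≤ cnt T S + cnt T (S' \ S) := by
        rw [cnt, Finset.filter_union]
        exact Finset.card_union_le _ _
    _ ≤ cnt T S + (S' \ S).card := by
        gcongr
        exact cnt_le_card T _
    _ = cnt T S + j := by rw [Finset.card_sdiff_of_subset h, hcard, Nat.add_sub_cancel_left]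

theorem mul_pow_sub_pow_le {x y : ℝ} (hx : 0 < x) (hy : 0 ≤ y) (m : ℕ) :
    x * (x ^ m - y ^ m) ≤ m * x ^ m * (x - y) := by
  have hbernoulli : 1 + m * (y / x - 1) ≤ (y / x) ^ m := by
    refine one_add_mul_sub_le_pow ?_ m
    linarith [div_nonneg hy hx.le]
  calc x * (x ^ m - y ^ m) = x * x ^ m * (1 - (y / x) ^ m) := by
        rw [div_pow]
        field_simp
    _ ≤ x * x ^ m * (m * (1 - y / x)) := by
        gcongr
        linarith
    _ = m * x ^ m * (x - y) := by field_simp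

theorem add_four_pow_le {a : ℝ} (ha : 1 ≤ a) (m : ℕ) : (a + 4) ^ m ≤ 5 ^ m * a ^ m := by
  rw [← mul_pow]
  gcongr
  linarith

theorem mul_add_four_pow_sub_le {a : ℝ} (ha : 1 ≤ a) (m : ℕ) :
    (a + 4) * ((a + 4) ^ m - a ^ m) ≤ 4 * m * (5 ^ m * a ^ m) :=
  calc (a + 4) * ((a + 4) ^ m - a ^ m) ≤ m * (a + 4) ^ m * (a + 4 - a) :=
        mul_pow_sub_pow_le (by linarith) (by linarith) m
    _ = 4 * m * (a + 4) ^ m := by ring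
    _ ≤ 4 * m * (5 ^ m * a ^ m) := by
        gcongr
        exact add_four_pow_le ha m

/-- A monotone, possibly unbounded weight `w` whose growth when four particles are added is at
most of order `w / (G + 1)`. This makes the bounded truncations of `w` slowly varying. -/
structure IsSlowlyGrowing (w G : Finset Mom → ℕ) (C : ℝ) : Prop where
  mono : Monotone w
  growth_le : ∀ ⦃S S'⦄, S ⊆ S' → S'.card = S.card + 4 →
    ((w S' : ℝ) - w S) * (G S' + 1) ≤ C * w S

theorem isSlowlyGrowing_one (G : Finset Mom → ℕ) {C : ℝ} (hC : 0 ≤ C) :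
    IsSlowlyGrowing (fun _ => 1) G C where
  mono := monotone_const
  growth_le S S' _ _ := by simpa using hC

theorem isSlowlyGrowing_cnt_add_one (T : Set Mom) :
    IsSlowlyGrowing (fun S => cnt T S + 1) (cnt T) 20 where
  mono := (cnt_mono T).add_const 1
  growth_le S S' h hcard := by
    have hadd : (cnt T S' : ℝ) ≤ cnt T S + 4 := by exact_mod_cast cnt_le_cnt_add T h hcard
    push_cast
    calc ((cnt T S' : ℝ) + 1 - (cnt T S + 1)) * (cnt T S' + 1)
        ≤ 4 * (5 * (cnt T S + 1)) := by
          gcongr <;> linarith [Nat.cast_nonneg (α := ℝ) (cnt T S)]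
      _ = 20 * (cnt T S + 1) := by ring

theorem IsSlowlyGrowing.mul_nTot_add_one_pow {w G : Finset Mom → ℕ} {C : ℝ}
    (hw : IsSlowlyGrowing w G C) (hG : ∀ S, G S ≤ S.card) (m : ℕ) :
    IsSlowlyGrowing (fun S => w S * (nTot S + 1) ^ m) G ((C + 4 * m) * 5 ^ m) where
  mono S S' h := by
    have hw' := hw.mono h
    have hcard := Finset.card_le_card h
    simp only [nTot_eq_card]
    gcongr
  growth_le S S' h hcard := by
    have hGb : (G S' : ℝ) + 1 ≤ S.card + 1 + 4 := by
      have : (G S' : ℝ) ≤ S.card + 4 := by exact_mod_cast hcard ▸ hG S'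
      linarith
    have hgrowth := hw.growth_le h hcard
    have ha : (1 : ℝ) ≤ S.card + 1 := le_add_of_nonneg_left (Nat.cast_nonneg _)
    have hpow : ((S.card : ℝ) + 1) ^ m ≤ (S.card + 1 + 4) ^ m :=
      pow_le_pow_left₀ (by linarith) (by linarith) m
    have hw0 : 0 ≤ C * w S := (mul_nonneg (sub_nonneg.mpr (by exact_mod_cast hw.mono h))
      (by positivity)).trans hgrowth
    simp only [nTot_eq_card, hcard, Nat.cast_mul, Nat.cast_pow, Nat.cast_add, Nat.cast_one,
      Nat.cast_ofNat, add_right_comm (S.card : ℝ) 4 1]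
    set a : ℝ := S.card + 1
    calc (w S' * (a + 4) ^ m - w S * a ^ m) * ((G S' : ℝ) + 1)
        = ((w S' : ℝ) - w S) * (G S' + 1) * (a + 4) ^ m
          + w S * ((G S' + 1) * ((a + 4) ^ m - a ^ m)) := by ring
      _ ≤ C * w S * (5 ^ m * a ^ m) + w S * ((a + 4) * ((a + 4) ^ m - a ^ m)) := by
          have := sub_nonneg.mpr hpow
          gcongr
          exact add_four_pow_le ha m
      _ ≤ C * w S * (5 ^ m * a ^ m) + w S * (4 * m * (5 ^ m * a ^ m)) := by
          gcongr _ + _ * ?_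
          exact mul_add_four_pow_sub_le ha m
      _ = (C + 4 * m) * 5 ^ m * (w S * a ^ m) := by ring

theorem IsSlowlyGrowing.isSlowlyVarying_min {w G : Finset Mom → ℕ} {C : ℝ}
    (hw : IsSlowlyGrowing w G C) (hC : 0 ≤ C) (m : ℕ) :
    IsSlowlyVarying (fun S => ((min (w S) m : ℕ) : ℝ)) G C := by
  intro S S' h hcard
  have hmono : ((min (w S) m : ℕ) : ℝ) ≤ (min (w S') m : ℕ) := by
    exact_mod_cast min_le_min_right m (hw.mono h)
  rw [abs_of_nonneg (sub_nonneg.mpr hmono)]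
  calc ((min (w S') m : ℕ) - (min (w S) m : ℕ) : ℝ) * (G S' + 1)
      ≤ C * (min (w S) m : ℕ) := by
        rcases le_total m (w S) with hm | hm
        · rw [min_eq_right hm, min_eq_right (hm.trans (hw.mono h)), sub_self, zero_mul]
          positivity
        · rw [min_eq_left hm]
          refine le_trans ?_ (hw.growth_le h hcard)
          gcongr
          exact min_le_left _ _
    _ = C * (√(min (w S) m : ℕ) * √(min (w S) m : ℕ)) := by
        rw [Real.mul_self_sqrt (Nat.cast_nonneg _)]
    _ ≤ C * (√(min (w S) m : ℕ) * √(min (w S') m : ℕ)) := by gcongr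

theorem pairAnn_comp_diagOp (F : Finset Mom) {k : Mom} (hk : k ≠ 0) (f : ℕ → ℝ)
    (hf : ∃ M, ∀ S : Finset Mom, |f S.card| ≤ M)
    (hf' : ∃ M, ∀ S : Finset Mom, |f (S.card + 2)| ≤ M) :
    pairAnn F k ∘L diagOp (fun S => f S.card) hf
      = diagOp (fun S => f (S.card + 2)) hf' ∘L pairAnn F k := by
  classical
  ext ψ S
  rw [ContinuousLinearMap.comp_apply, ContinuousLinearMap.comp_apply, diagOp_apply,
    pairAnn_apply F hk, pairAnn_apply F hk, mul_left_comm]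
  congr 1
  rw [Finset.mul_sum]
  refine Finset.sum_congr rfl fun p _ => ?_
  split_ifs with hp
  · rw [diagOp_apply, hp.card_addPair, mul_left_comm]
  · rw [mul_zero]

/-- The projection to the sector of `j` particles. -/
noncomputable def sector (j : ℕ) : Fock →L[ℂ] Fock :=
  diagOp (fun S => if S.card = j then 1 else 0) ⟨1, fun S => by split_ifs <;> simp⟩

theorem sector_apply (j : ℕ) (ψ : Fock) (S : Finset Mom) :
    sector j ψ S = if S.card = j then ψ S else 0 := by
  rw [sector, diagOp_apply]
  split_ifs <;> simp

theorem adjoint_sector (j : ℕ) : ContinuousLinearMap.adjoint (sector j) = sector j :=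
  adjoint_diagOp _

theorem commute_sector_adjoint_pairAnn_comp (F F' : Finset Mom) {k k' : Mom} (hk : k ≠ 0)
    (hk' : k' ≠ 0) (j : ℕ) :
    Commute (sector j) (ContinuousLinearMap.adjoint (pairAnn F k) ∘L pairAnn F' k') := by
  have hbdd : ∃ M : ℝ, ∀ S : Finset Mom, |if S.card + 2 = j then 1 else 0| ≤ M :=
    ⟨1, fun S => by split_ifs <;> simp⟩
  have hshift : ∀ (E : Finset Mom) {q : Mom}, q ≠ 0 →
      pairAnn E q ∘L sector j = diagOp _ hbdd ∘L pairAnn E q := fun E _ hq =>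
    pairAnn_comp_diagOp E hq (fun i => if i = j then 1 else 0) _ hbdd
  have hshift' := congrArg ContinuousLinearMap.adjoint (hshift F hk)
  rw [ContinuousLinearMap.adjoint_comp, ContinuousLinearMap.adjoint_comp, adjoint_sector,
    adjoint_diagOp] at hshift'
  change sector j ∘L (_ ∘L _) = (_ ∘L _) ∘L sector j
  rw [← ContinuousLinearMap.comp_assoc, hshift', ContinuousLinearMap.comp_assoc,
    ContinuousLinearMap.comp_assoc, hshift F' hk']

theorem apply_eq_of_commute_sector {U : Fock →L[ℂ] Fock} (hU : ∀ j, Commute (sector j) U)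
    (f : ℕ → ℂ) {ψ φ : Fock} (h : ∀ S, φ S = f S.card * ψ S) (S : Finset Mom) :
    U φ S = f S.card * U ψ S := by
  have hlocal : ∀ χ : Fock, U χ S = U (sector S.card χ) S := fun χ =>
    calc U χ S = sector S.card (U χ) S := by rw [sector_apply, if_pos rfl]
      _ = U (sector S.card χ) S := congrArg (fun T : Fock →L[ℂ] Fock => T χ S) (hU S.card)
  have hsector : sector S.card φ = f S.card • sector S.card ψ := by
    ext S'
    rw [lp.coeFn_smul, Pi.smul_apply, sector_apply, sector_apply, smul_eq_mul]
    split_ifs with hcard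
    · rw [h, hcard]
    · rw [mul_zero]
  rw [hlocal φ, hlocal ψ, hsector, map_smul]
  rfl

section conjOp

variable {U : Fock →L[ℂ] Fock} (hU : ∀ j, Commute (sector j) U) (f : ℕ → ℕ)
include hU

theorem commute_sector_adjoint (j : ℕ) :
    Commute (sector j) (ContinuousLinearMap.adjoint U) := by
  have h := congrArg ContinuousLinearMap.adjoint (hU j).eq
  rw [ContinuousLinearMap.mul_def, ContinuousLinearMap.mul_def, ContinuousLinearMap.adjoint_comp,
    ContinuousLinearMap.adjoint_comp, adjoint_sector] at h
  exact h.symm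

theorem apply_mem_domain_mulOp {ψ : Fock} (hψ : ψ ∈ (mulOp fun S => f S.card).domain) :
    U ψ ∈ (mulOp fun S => f S.card).domain := by
  have hmul := funext (apply_eq_of_commute_sector hU (fun j => (f j : ℂ)) (ψ := ψ)
    (φ := (mulOp fun S => f S.card) ⟨ψ, hψ⟩) fun _ => rfl)
  change Memℓp (fun S => (f S.card : ℂ) * U ψ S) 2
  rw [← hmul]
  exact lp.memℓp _

theorem mulOp_apply_eq {ψ : Fock} (hψ : ψ ∈ (mulOp fun S => f S.card).domain) :
    (mulOp fun S => f S.card) ⟨U ψ, apply_mem_domain_mulOp hU f hψ⟩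
      = U ((mulOp fun S => f S.card) ⟨ψ, hψ⟩) := by
  ext S
  exact (apply_eq_of_commute_sector hU (fun j => (f j : ℂ)) (fun _ => rfl) S).symm

theorem conjOp_mulOp_eq (hUU : ContinuousLinearMap.adjoint U * U = 1) :
    conjOp U (mulOp fun S => f S.card) = mulOp fun S => f S.card := by
  have hinv : ∀ ψ, ContinuousLinearMap.adjoint U (U ψ) = ψ := fun ψ =>
    congrArg (fun T : Fock →L[ℂ] Fock => T ψ) hUU
  refine LinearPMap.ext (Submodule.ext fun ψ => ⟨fun hψ => ?_, apply_mem_domain_mulOp hU f⟩)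
    fun ψ hψ hψ' => ?_
  · rw [← hinv ψ]
    exact apply_mem_domain_mulOp (commute_sector_adjoint hU) f hψ
  · change ContinuousLinearMap.adjoint U
      ((mulOp fun S => f S.card) ⟨U ψ, apply_mem_domain_mulOp hU f hψ'⟩) = _
    rw [mulOp_apply_eq hU, hinv]

end conjOp

/-! ### The unitaries -/

section HilbertSpace

variable {H : Type*} [NormedAddCommGroup H] [InnerProductSpace ℂ H] [CompleteSpace H]

theorem re_inner_smul_sub_adjoint {V : H →L[ℂ] H} (hV : (V : H →ₗ[ℂ] H).IsSymmetric)
    (X : H →L[ℂ] H) (lam : ℝ) (ψ : H) :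
    RCLike.re (inner ℂ (V ψ) (((lam : ℂ) • (X - ContinuousLinearMap.adjoint X)) ψ))
      = lam * RCLike.re (inner ℂ (ContinuousLinearMap.adjoint X (V ψ)
          - V (ContinuousLinearMap.adjoint X ψ)) ψ) := by
  have hadj : RCLike.re (inner ℂ (V ψ) (ContinuousLinearMap.adjoint X ψ))
      = RCLike.re (inner ℂ (V (ContinuousLinearMap.adjoint X ψ)) ψ) := by
    rw [← inner_re_symm]
    exact congrArg RCLike.re (hV _ _).symm
  rw [smul_apply, sub_apply, inner_smul_right, inner_sub_right, inner_sub_left, map_sub, ← hadj,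
    ContinuousLinearMap.adjoint_inner_left, ← map_sub]
  exact Complex.re_ofReal_mul _ _

theorem two_mul_re_inner_smul_of_adjoint_eq_neg {X : H →L[ℂ] H}
    (hX : ContinuousLinearMap.adjoint X = -X) (lam : ℝ) (φ ψ : H) :
    2 * RCLike.re (inner ℂ φ (((lam : ℂ) • X) ψ))
      = lam * RCLike.re (inner ℂ φ (X ψ) - inner ℂ ψ (X φ)) := by
  have hskew : RCLike.re (inner ℂ ψ (X φ)) = -RCLike.re (inner ℂ φ (X ψ)) := by
    rw [← ContinuousLinearMap.adjoint_inner_left, hX, neg_apply, inner_neg_left, map_neg,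
      inner_re_symm]
  rw [smul_apply, inner_smul_right, map_sub, hskew]
  change 2 * ((lam : ℂ) * _).re = _
  rw [Complex.re_ofReal_mul, RCLike.re_to_complex]
  ring

end HilbertSpace

theorem mul_re_le_of_abs_le_one {lam : ℝ} (hlam : |lam| ≤ 1) {z : ℂ} {B : ℝ} (hz : ‖z‖ ≤ B) :
    lam * RCLike.re z ≤ B :=
  calc lam * RCLike.re z ≤ |lam| * |RCLike.re z| := (le_abs_self _).trans (abs_mul _ _).le
    _ ≤ 1 * ‖z‖ := mul_le_mul hlam (RCLike.abs_re_le_norm z) (abs_nonneg _) zero_le_one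
    _ ≤ B := by rwa [one_mul]

namespace PatchDecomposition

variable {kF R C₀ : ℝ} {n : ℕ}

section PairOperators

variable (P : PatchDecomposition kF R C₀ n) (δ : ℝ) (k : Mom) (α : P.I δ k)

theorem c_eq_pairAnn :
    P.c δ k α = pairAnn (P.pairs (P.label δ k α) (P.signedMom δ k α)) (P.signedMom δ k α) := by
  unfold c cStar bStar pairAnn nrm cre
  simp only [map_smulₛₗ, map_sum, Complex.conj_ofReal, ContinuousLinearMap.adjoint_comp,
    ContinuousLinearMap.adjoint_adjoint]

theorem cStar_eq_adjoint : P.cStar δ k α = ContinuousLinearMap.adjoint (P.c δ k α) := by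
  rw [c, ContinuousLinearMap.adjoint_adjoint]

theorem signedMom_ne_zero (hk : k ≠ 0) : P.signedMom δ k α ≠ 0 := by
  cases α
  · exact hk
  · exact neg_ne_zero.mpr hk

end PairOperators

variable {P : PatchDecomposition kF R C₀ n} {Vhat : Mom → ℝ} {δ ε θ t C lam : ℝ}
  {b : Mom → ℝ} {w : Finset Mom → ℝ}

theorem IsFine.isPairCountBound (hP : P.IsFine δ ε) (hεθ : 2 * ε ≤ 1 - 2 * θ) {k : Mom}
    (hk : k ∈ gammaNor R) :
    IsPairCountBound (fun α : P.I δ k => P.pairs (P.label δ k α) (P.signedMom δ k α))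
      (P.signedMom δ k) (nGap kF δ θ) where
  ne_zero α := P.signedMom_ne_zero δ k α (ne_zero_of_mem_gammaNor hk)
  sum_card_le S := by
    convert hP.sum_card_filter_pairs_le hεθ (norm_lt_of_mem_gammaNor hk).le S
  mono := cnt_mono _

theorem inner_adjoint_expT_left (φ φ' : Fock) :
    inner ℂ (ContinuousLinearMap.adjoint (P.expT Vhat δ) φ) φ'
      = (1 / 2 : ℂ) * ∑ k ∈ gammaNor R, ∑ i, ∑ j,
        (P.K Vhat δ k).transpose.map (fun x => (x : ℂ)) i j
          * inner ℂ (P.c δ k i (P.c δ k j φ)) φ' := by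
  rw [ContinuousLinearMap.adjoint_inner_left, expT]
  simp only [cStar_eq_adjoint, smul_apply, sum_apply, ContinuousLinearMap.comp_apply,
    inner_smul_right, inner_sum, ContinuousLinearMap.adjoint_inner_right]
  congr 1
  exact Finset.sum_congr rfl fun k _ => Finset.sum_comm

theorem inner_commutator_adjoint_expT {V : Fock →L[ℂ] Fock}
    (hV : (V : Fock →ₗ[ℂ] Fock).IsSymmetric) (ψ : Fock) :
    inner ℂ (ContinuousLinearMap.adjoint (P.expT Vhat δ) (V ψ)
        - V (ContinuousLinearMap.adjoint (P.expT Vhat δ) ψ)) ψ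
      = (1 / 2 : ℂ) * ∑ k ∈ gammaNor R, ∑ i, ∑ j,
        (P.K Vhat δ k).transpose.map (fun x => (x : ℂ)) i j
          * inner ℂ (P.c δ k i (P.c δ k j (V ψ)) - V (P.c δ k i (P.c δ k j ψ))) ψ := by
  have hV' : ∀ φ φ' : Fock, inner ℂ (V φ) φ' = inner ℂ φ (V φ') := hV
  simp only [inner_sub_left, hV', inner_adjoint_expT_left, mul_sub, Finset.sum_sub_distrib]

theorem IsFine.two_mul_re_inner_expT_le (hP : P.IsFine δ ε) (hεθ : 2 * ε ≤ 1 - 2 * θ)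
    (hb : ∀ k, 0 ≤ b k) (hK : ∀ k ∈ gammaNor R, hsNormSq (P.K Vhat δ k) ≤ b k ^ 2)
    (hw : ∃ M, ∀ S, |w S| ≤ M) (hw0 : ∀ S, 0 ≤ w S) (hC : 0 ≤ C)
    (hwG : IsSlowlyVarying w (nGap kF δ θ) C) (hlam : |lam| ≤ 1) (ψ : Fock) :
    2 * RCLike.re (inner ℂ (diagOp w hw ψ) (((lam : ℂ) •
      (P.expT Vhat δ - ContinuousLinearMap.adjoint (P.expT Vhat δ))) ψ))
      ≤ C * (∑ k ∈ gammaNor R, b k) * (diagOp w hw).reApplyInnerSelf ψ := by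
  set V := diagOp w hw
  set Q := ContinuousLinearMap.adjoint (P.expT Vhat δ)
  have hV : (V : Fock →ₗ[ℂ] Fock).IsSymmetric := isSymmetric_diagOp hw
  have hcommutator : ‖inner ℂ (Q (V ψ) - V (Q ψ)) ψ‖
      ≤ 1 / 2 * ∑ k ∈ gammaNor R, C * b k * V.reApplyInnerSelf ψ := by
    rw [inner_commutator_adjoint_expT hV, norm_mul, norm_div, norm_one, RCLike.norm_ofNat]
    gcongr 1 / 2 * ?_
    refine norm_sum_le_of_le _ fun k hk => ?_
    simp only [c_eq_pairAnn]
    refine (hP.isPairCountBound hεθ hk).norm_sum_mul_inner_commutator_le hw hw0 hC hwG (hb k) ?_ ψ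
    rw [hsNormSq_map_ofReal, hsNormSq_transpose]
    exact hK k hk
  rw [re_inner_smul_sub_adjoint hV]
  calc 2 * (lam * RCLike.re (inner ℂ (Q (V ψ) - V (Q ψ)) ψ))
      ≤ 2 * (1 / 2 * ∑ k ∈ gammaNor R, C * b k * V.reApplyInnerSelf ψ) := by
        gcongr 2 * ?_
        exact mul_re_le_of_abs_le_one hlam hcommutator
    _ = C * (∑ k ∈ gammaNor R, b k) * V.reApplyInnerSelf ψ := by
        rw [← Finset.sum_mul, ← Finset.mul_sum]
        ring

theorem IsFine.form_T_le (hP : P.IsFine δ ε) (hεθ : 2 * ε ≤ 1 - 2 * θ) (hb : ∀ k, 0 ≤ b k)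
    (hK : ∀ k ∈ gammaNor R, hsNormSq (P.K Vhat δ k) ≤ b k ^ 2) {w : Finset Mom → ℕ}
    (hC : 0 ≤ C) (hw : IsSlowlyGrowing w (nGap kF δ θ) C) (hlam : |lam| ≤ 1) (ψ : Fock) :
    form w (P.T Vhat δ lam ψ)
      ≤ ENNReal.ofReal (Real.exp (C * ∑ k ∈ gammaNor R, b k)) * form w ψ := by
  refine form_le_of_forall_exists_le (v := fun m S => min (w S) m)
    (fun s => ⟨s.sup w, fun S hS => le_min le_rfl (Finset.le_sup hS)⟩) fun m => ?_
  have hbdd : ∃ M : ℝ, ∀ S, |((min (w S) m : ℕ) : ℝ)| ≤ M := ⟨m, fun S => by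
    rw [Nat.abs_cast]
    exact_mod_cast min_le_right _ _⟩
  refine (form_exp_le hbdd (fun φ => hP.two_mul_re_inner_expT_le hεθ hb hK hbdd
    (fun _ => Nat.cast_nonneg _) hC (hw.isSlowlyVarying_min hC m) hlam φ) ψ).trans ?_
  gcongr
  exact form_mono (fun S => min_le_left _ _) ψ

open scoped Matrix

theorem adjoint_expZ (hL : ∀ k ∈ gammaNor R, (P.L Vhat δ k t)ᴴ = -P.L Vhat δ k t) :
    ContinuousLinearMap.adjoint (P.expZ Vhat δ t) = -P.expZ Vhat δ t := by
  rw [expZ, map_sum, ← Finset.sum_neg_distrib]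
  refine Finset.sum_congr rfl fun k hk => ?_
  have hconj : ∀ α β, (starRingEnd ℂ) (P.L Vhat δ k t α β) = -P.L Vhat δ k t β α := fun α β =>
    congrFun (congrFun (hL k hk) β) α
  simp only [cStar_eq_adjoint, map_sum, map_smulₛₗ, ContinuousLinearMap.adjoint_comp,
    ContinuousLinearMap.adjoint_adjoint, hconj, neg_smul, Finset.sum_neg_distrib]
  rw [Finset.sum_comm]

theorem inner_expZ_right (φ φ' : Fock) :
    inner ℂ φ (P.expZ Vhat δ t φ') = ∑ k ∈ gammaNor R, ∑ i, ∑ j,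
      P.L Vhat δ k t i j * inner ℂ (P.c δ k i φ) (P.c δ k j φ') := by
  simp only [expZ, cStar_eq_adjoint, smul_apply, sum_apply, ContinuousLinearMap.comp_apply,
    inner_smul_right, inner_sum, ContinuousLinearMap.adjoint_inner_right]

theorem IsFine.two_mul_re_inner_expZ_le (hP : P.IsFine δ ε) (hεθ : 2 * ε ≤ 1 - 2 * θ)
    (hb : ∀ k, 0 ≤ b k) (hL : ∀ k ∈ gammaNor R, (P.L Vhat δ k t)ᴴ = -P.L Vhat δ k t)
    (hLb : ∀ k ∈ gammaNor R, hsNormSq (P.L Vhat δ k t) ≤ b k ^ 2) (hw : ∃ M, ∀ S, |w S| ≤ M)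
    {h : ℕ → ℝ} (hh : ∀ m, 0 ≤ h m) (hwh : ∀ S, w S = nGap kF δ θ S * h S.card)
    (hlam : |lam| ≤ 1) (ψ : Fock) :
    2 * RCLike.re (inner ℂ (diagOp w hw ψ) (((lam : ℂ) • P.expZ Vhat δ t) ψ))
      ≤ 2 * (∑ k ∈ gammaNor R, b k) * (diagOp w hw).reApplyInnerSelf ψ := by
  set V := diagOp w hw
  set Y := P.expZ Vhat δ t
  rw [two_mul_re_inner_smul_of_adjoint_eq_neg (adjoint_expZ hL)]
  refine mul_re_le_of_abs_le_one hlam ?_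
  calc ‖inner ℂ (V ψ) (Y ψ) - inner ℂ ψ (Y (V ψ))‖
      = ‖∑ k ∈ gammaNor R, ∑ i, ∑ j, P.L Vhat δ k t i j *
          (inner ℂ (P.c δ k i (V ψ)) (P.c δ k j ψ)
            - inner ℂ (P.c δ k i ψ) (P.c δ k j (V ψ)))‖ := by
        simp only [Y, inner_expZ_right, mul_sub, Finset.sum_sub_distrib]
    _ ≤ ∑ k ∈ gammaNor R, 2 * b k * V.reApplyInnerSelf ψ := by
        refine norm_sum_le_of_le _ fun k hk => ?_
        simp only [c_eq_pairAnn]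
        exact (hP.isPairCountBound hεθ hk).norm_sum_mul_inner_sub_inner_le
          (fun _ _ hS hcard => cnt_le_cnt_add _ hS hcard) hw hh hwh (hb k) (hLb k hk) ψ
    _ = 2 * (∑ k ∈ gammaNor R, b k) * V.reApplyInnerSelf ψ := by
        rw [← Finset.sum_mul, ← Finset.mul_sum]

theorem IsFine.form_Z_le (hP : P.IsFine δ ε) (hεθ : 2 * ε ≤ 1 - 2 * θ) (hb : ∀ k, 0 ≤ b k)
    (hL : ∀ k ∈ gammaNor R, (P.L Vhat δ k t)ᴴ = -P.L Vhat δ k t)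
    (hLb : ∀ k ∈ gammaNor R, hsNormSq (P.L Vhat δ k t) ≤ b k ^ 2) (h : ℕ → ℕ)
    (hlam : |lam| ≤ 1) (ψ : Fock) :
    form (fun S => nGap kF δ θ S * h (nTot S)) (P.Z Vhat δ t lam ψ)
      ≤ ENNReal.ofReal (Real.exp (2 * ∑ k ∈ gammaNor R, b k))
        * form (fun S => nGap kF δ θ S * h (nTot S)) ψ := by
  simp only [nTot_eq_card]
  let v (l : ℕ) (S : Finset Mom) : ℕ := nGap kF δ θ S * if S.card ≤ l then h S.card else 0
  refine form_le_of_forall_exists_le (v := v) (fun s => ⟨s.sup Finset.card, fun S hS => ?_⟩)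
    fun l => ?_
  · simp only [v, if_pos (Finset.le_sup (f := Finset.card) hS), le_refl]
  have hbdd : ∃ M : ℝ, ∀ S, |(v l S : ℝ)| ≤ M := by
    refine ⟨(l * (Finset.range (l + 1)).sup h : ℕ), fun S => ?_⟩
    rw [Nat.abs_cast, Nat.cast_le]
    dsimp only [v]
    split_ifs with hcard
    · gcongr
      · exact (cnt_le_card _ S).trans hcard
      · exact Finset.le_sup (Finset.mem_range_succ_iff.mpr hcard)
    · exact Nat.zero_le _
  have hle : v l ≤ fun S => nGap kF δ θ S * h S.card := fun S => by
    dsimp only [v]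
    split_ifs
    · exact le_rfl
    · exact Nat.zero_le _
  refine (form_exp_le hbdd (fun φ => hP.two_mul_re_inner_expZ_le hεθ hb hL hLb hbdd
    (h := fun j => ((if j ≤ l then h j else 0 : ℕ) : ℝ)) (fun _ => Nat.cast_nonneg _)
    (fun S => Nat.cast_mul _ _) hlam φ) ψ).trans ?_
  gcongr
  exact form_mono hle ψ

theorem sum_gammaNor_mul_le (hV_nonneg : ∀ k, 0 ≤ Vhat k) (hV_sum : Summable Vhat) {a : ℝ}
    (ha : 0 ≤ a) : ∑ k ∈ gammaNor R, a * Vhat k ≤ a * ∑' k, Vhat k := by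
  rw [← Finset.mul_sum]
  exact mul_le_mul_of_nonneg_left (hV_sum.sum_le_tsum _ fun k _ => hV_nonneg k) ha

theorem IsFine.form_T_le_exp_tsum (hP : P.IsFine δ ε) (hε : ε ≤ 1 / 2) (hεθ : 2 * ε ≤ 1 - 2 * θ)
    (hV_nonneg : ∀ k, 0 ≤ Vhat k) (hV_sum : Summable Vhat) {w : Finset Mom → ℕ} (hC : 0 ≤ C)
    (hw : IsSlowlyGrowing w (nGap kF δ θ) C) (hlam : |lam| ≤ 1) (ψ : Fock) :
    form w (P.T Vhat δ lam ψ)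
      ≤ ENNReal.ofReal (Real.exp (C * (352 * ∑' k, Vhat k))) * form w ψ := by
  refine (hP.form_T_le hεθ (fun k => mul_nonneg (by norm_num) (hV_nonneg k)) (fun k hk =>
    hP.hsNormSq_K_le hε (hV_nonneg k) (ne_zero_of_mem_gammaNor hk)
      (norm_lt_of_mem_gammaNor hk).le) hC hw hlam ψ).trans ?_
  gcongr
  exact sum_gammaNor_mul_le hV_nonneg hV_sum (by norm_num)

theorem IsFine.form_nTot_pow_T_le (hP : P.IsFine δ ε) (hε : ε ≤ 1 / 2)
    (hεθ : 2 * ε ≤ 1 - 2 * θ) (hV_nonneg : ∀ k, 0 ≤ Vhat k) (hV_sum : Summable Vhat)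
    (hlam : |lam| ≤ 1) (m : ℕ) (ψ : Fock) :
    form (fun S => nTot S ^ m) (P.T Vhat δ lam ψ)
      ≤ ENNReal.ofReal (Real.exp ((20 + 4 * m) * 5 ^ m * (352 * ∑' k, Vhat k)))
        * form (fun S => (nTot S + 1) ^ m) ψ := by
  have hw := (isSlowlyGrowing_one (nGap kF δ θ) (C := 20) (by norm_num)).mul_nTot_add_one_pow
    (cnt_le_card _) m
  simp only [one_mul] at hw
  exact (form_mono (fun S => Nat.pow_le_pow_left (Nat.le_succ _) m) _).trans
    (hP.form_T_le_exp_tsum hε hεθ hV_nonneg hV_sum (by positivity) hw hlam ψ)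

theorem IsFine.form_nGap_mul_nTot_pow_T_le (hP : P.IsFine δ ε) (hε : ε ≤ 1 / 2)
    (hεθ : 2 * ε ≤ 1 - 2 * θ) (hV_nonneg : ∀ k, 0 ≤ Vhat k) (hV_sum : Summable Vhat)
    (hlam : |lam| ≤ 1) (m : ℕ) (ψ : Fock) :
    form (fun S => nGap kF δ θ S * nTot S ^ m) (P.T Vhat δ lam ψ)
      ≤ ENNReal.ofReal (Real.exp ((20 + 4 * m) * 5 ^ m * (352 * ∑' k, Vhat k)))
        * form (fun S => (nGap kF δ θ S + 1) * (nTot S + 1) ^ m) ψ :=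
  (form_mono (fun S => Nat.mul_le_mul (Nat.le_succ _) (Nat.pow_le_pow_left (Nat.le_succ _) m))
    _).trans (hP.form_T_le_exp_tsum hε hεθ hV_nonneg hV_sum (by positivity)
      ((isSlowlyGrowing_cnt_add_one _).mul_nTot_add_one_pow (cnt_le_card _) m) hlam ψ)

theorem IsFine.form_Z_le_exp_tsum (hP : P.IsFine δ ε) (hε : ε ≤ 1 / 2) (hεθ : 2 * ε ≤ 1 - 2 * θ)
    (hV_nonneg : ∀ k, 0 ≤ Vhat k) (hV_sum : Summable Vhat) (hC_nonneg : 0 ≤ C)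
    (hC : ∀ z : ℂ, ‖z‖ = 1 → ‖branchLog t z‖ ≤ C * ‖z - 1‖) (h : ℕ → ℕ) (hlam : |lam| ≤ 1)
    (ψ : Fock) :
    form (fun S => nGap kF δ θ S * h (nTot S)) (P.Z Vhat δ t lam ψ)
      ≤ ENNReal.ofReal (Real.exp (2 * (1408 * C * ∑' k, Vhat k)))
        * form (fun S => nGap kF δ θ S * h (nTot S)) ψ := by
  refine (hP.form_Z_le hεθ (fun k => mul_nonneg (by positivity) (hV_nonneg k))
    (fun k hk => conjTranspose_L hP.kF_pos (hV_nonneg k) (ne_zero_of_mem_gammaNor hk) t)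
    (fun k hk => hP.hsNormSq_L_le hε (hV_nonneg k) (ne_zero_of_mem_gammaNor hk)
      (norm_lt_of_mem_gammaNor hk).le hC) h hlam ψ).trans ?_
  gcongr
  exact sum_gammaNor_mul_le hV_nonneg hV_sum (by positivity)

theorem commute_sector_expZ (j : ℕ) : Commute (sector j) (P.expZ Vhat δ t) := by
  unfold expZ
  refine Commute.sum_right _ _ _ fun k hk => Commute.sum_right _ _ _ fun α _ =>
    Commute.sum_right _ _ _ fun β _ => Commute.smul_right ?_ _
  have hk0 := ne_zero_of_mem_gammaNor hk
  rw [cStar_eq_adjoint, c_eq_pairAnn, c_eq_pairAnn]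
  exact commute_sector_adjoint_pairAnn_comp _ _ (P.signedMom_ne_zero δ k α hk0)
    (P.signedMom_ne_zero δ k β hk0) j

theorem conjOp_Z_eq (hL : ∀ k ∈ gammaNor R, (P.L Vhat δ k t)ᴴ = -P.L Vhat δ k t) (lam : ℝ)
    (f : ℕ → ℕ) :
    conjOp (P.Z Vhat δ t lam) (mulOp fun S => f (nTot S)) = mulOp fun S => f (nTot S) := by
  simp only [nTot_eq_card]
  let _ : NormedAlgebra ℚ (Fock →L[ℂ] Fock) := NormedAlgebra.restrictScalars ℚ ℂ _
  have hskew : (lam : ℂ) • P.expZ Vhat δ t ∈ skewAdjoint (Fock →L[ℂ] Fock) := by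
    rw [skewAdjoint.mem_iff, star_smul, ContinuousLinearMap.star_eq_adjoint, adjoint_expZ hL,
      smul_neg, Complex.star_def, Complex.conj_ofReal]
  exact conjOp_mulOp_eq (fun j => ((commute_sector_expZ j).smul_right _).exp_right) f
    (Unitary.star_mul_self_of_mem (NormedSpace.exp_mem_unitary_of_mem_skewAdjoint hskew))

end PatchDecomposition

end RPA

theorem lemma6p3_general
    (Vhat : RPA.Mom → ℝ) (hV_nonneg : ∀ k, 0 ≤ Vhat k) (hV_sum : Summable Vhat)
    (δ θ : ℝ) (hθ_lt : θ < 1 / 2)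
    (t : ℝ) (ht_pos : 0 < t) (ht_lt : t < 2 * Real.pi)
    (C₀ : ℝ) :
    ∃ A : ℝ, 0 < A ∧ ∀ m : ℕ, ∃ C : NNReal, 0 < C ∧
      ∀ (kF R : ℝ), 0 < kF → 0 < R →
      ∀ (n : ℕ) (P : RPA.PatchDecomposition kF R C₀ n),
        A * ((RPA.numN kF : ℝ) ^ (2 * δ) * R ^ 2) ≤ 2 * n →
        ∀ lam ∈ Set.Icc (-1 : ℝ) 1,
          (∀ ψ : RPA.Fock,
            RPA.form (fun S => RPA.nTot S ^ m) (P.T Vhat δ lam ψ)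
              ≤ C * RPA.form (fun S => (RPA.nTot S + 1) ^ m) ψ) ∧
          (∀ ψ : RPA.Fock,
            RPA.form (fun S => RPA.nGap kF δ θ S * RPA.nTot S ^ m) (P.T Vhat δ lam ψ)
              ≤ C * RPA.form
                  (fun S => (RPA.nGap kF δ θ S + 1) * (RPA.nTot S + 1) ^ m) ψ) ∧
          RPA.conjOp (P.Z Vhat δ t lam) (RPA.mulOp (fun S => RPA.nTot S ^ m))
            = RPA.mulOp (fun S => RPA.nTot S ^ m) ∧
          (∀ ψ : RPA.Fock,
            RPA.form (fun S => RPA.nGap kF δ θ S * RPA.nTot S ^ m) (P.Z Vhat δ t lam ψ)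
              ≤ C * RPA.form (fun S => RPA.nGap kF δ θ S * RPA.nTot S ^ m) ψ) := by
  obtain ⟨Ct, hCt_pos, hCt⟩ := RPA.exists_norm_branchLog_le ht_pos ht_lt
  obtain ⟨ε, hε_pos, hε, hεθ⟩ : ∃ ε : ℝ, 0 < ε ∧ ε ≤ 1 / 2 ∧ 2 * ε ≤ 1 - 2 * θ :=
    ⟨min (1 / 2) (1 / 2 - θ), lt_min one_half_pos (sub_pos.mpr hθ_lt), min_le_left _ _, by
      linarith [min_le_right (1 / 2) (1 / 2 - θ)]⟩
  refine ⟨(C₀ ^ 2 + 32) / ε ^ 2, by positivity, fun m => ?_⟩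
  set a := (20 + 4 * m) * 5 ^ m * (352 * ∑' k, Vhat k)
  set b := 2 * (1408 * Ct * ∑' k, Vhat k)
  refine ⟨(Real.exp (max a b)).toNNReal, Real.toNNReal_pos.mpr (Real.exp_pos _),
    fun kF R hkF hR n P hM lam hlam => ?_⟩
  have hP := P.isFine_of_le hε_pos hkF hR hM
  have hlam' := abs_le.mpr hlam
  have ha : ENNReal.ofReal (Real.exp a) ≤ (Real.exp (max a b)).toNNReal :=
    ENNReal.ofReal_le_ofReal (Real.exp_le_exp.mpr (le_max_left a b))
  have hb : ENNReal.ofReal (Real.exp b) ≤ (Real.exp (max a b)).toNNReal :=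
    ENNReal.ofReal_le_ofReal (Real.exp_le_exp.mpr (le_max_right a b))
  exact ⟨fun ψ => (hP.form_nTot_pow_T_le hε hεθ hV_nonneg hV_sum hlam' m ψ).trans (by gcongr),
    fun ψ => (hP.form_nGap_mul_nTot_pow_T_le hε hεθ hV_nonneg hV_sum hlam' m ψ).trans (by gcongr),
    RPA.PatchDecomposition.conjOp_Z_eq (fun k hk => RPA.PatchDecomposition.conjTranspose_L hkF
      (hV_nonneg k) (RPA.ne_zero_of_mem_gammaNor hk) t) lam (· ^ m),
    fun ψ => (hP.form_Z_le_exp_tsum hε hεθ hV_nonneg hV_sum hCt_pos.le hCt (· ^ m) hlam' ψ).trans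
      (by gcongr)⟩

theorem lemma6p3
    (Vhat : RPA.Mom → ℝ) (hV_nonneg : ∀ k, 0 ≤ Vhat k) (hV_sum : Summable Vhat)
    (δ : ℝ) (hδ_pos : 0 < δ) (hδ_lt : δ < 1 / 6)
    (θ : ℝ) (hθ_pos : 0 < θ) (hθ_lt : θ < 1 / 2)
    (t : ℝ) (ht_pos : 0 < t) (ht_lt : t < 2 * Real.pi)
    (C₀ : ℝ) :
    ∃ A : ℝ, 0 < A ∧ ∀ m : ℕ, ∃ C : NNReal, 0 < C ∧
      ∀ (kF R : ℝ), 0 < kF → 0 < R →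
      ∀ (n : ℕ) (P : RPA.PatchDecomposition kF R C₀ n),
        A * ((RPA.numN kF : ℝ) ^ (2 * δ) * R ^ 2) ≤ 2 * n →
        ∀ lam ∈ Set.Icc (-1 : ℝ) 1,
          (∀ ψ : RPA.Fock,
            RPA.form (fun S => RPA.nTot S ^ m) (P.T Vhat δ lam ψ)
              ≤ C * RPA.form (fun S => (RPA.nTot S + 1) ^ m) ψ) ∧
          (∀ ψ : RPA.Fock,
            RPA.form (fun S => RPA.nGap kF δ θ S * RPA.nTot S ^ m) (P.T Vhat δ lam ψ)
              ≤ C * RPA.form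
                  (fun S => (RPA.nGap kF δ θ S + 1) * (RPA.nTot S + 1) ^ m) ψ) ∧
          RPA.conjOp (P.Z Vhat δ t lam) (RPA.mulOp (fun S => RPA.nTot S ^ m))
            = RPA.mulOp (fun S => RPA.nTot S ^ m) ∧
          (∀ ψ : RPA.Fock,
            RPA.form (fun S => RPA.nGap kF δ θ S * RPA.nTot S ^ m) (P.Z Vhat δ t lam ψ)
              ≤ C * RPA.form (fun S => RPA.nGap kF δ θ S * RPA.nTot S ^ m) ψ) :=
  lemma6p3_general Vhat hV_nonneg hV_sum δ θ hθ_lt t ht_pos ht_lt C₀
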